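/- Let $M$ be a connected oriented smooth three-manifold without boundary (Hausdorff, second countable, not necessarily compact) and let $X$ be a smooth nowhere vanishing vector field on $M$. **Definitions.** - $X$ is *Reeb-like* if there is a smooth one-form $\alpha$ on $M$ with $\alpha\wedge d\alpha\neq 0$ everywhere, $\alpha(X)>0$ and $\iota_X d\alpha=0$. - A *partial section* of $X$ is a smooth immersion $\iota:\Sigma\to M$ of a nonempty compact surface $\Sigma$, possibly with boundary, such that the restriction of $\iota$ to the interior of $\Sigma$ is an embedding transverse to $X$, and $\iota|_{\partial\Sigma}$ is tangent to $X$. Orient $\Sigma$ so that $X$ is positively transverse to its interior, i.e. $(X,\iota_*u,\iota_*v)$ is positive in $M$ for every positive frame $(u,v)$ at an interior point, and orient $\partial\Sigma$ as the boundary (outward normal first). The partial section is *positive* if $\iota$ maps positive tangent vectors of every boundary component to positive multiples of $X$, and *negative* if it maps them to negative multiples of $X$. - Suppose that $X$ preserves a volume form $\mu$. An *integrable region* of $X$ is a domain $U\subset M$ with a diffeomorphism $U\cong T^2\times[0,1]$, where $T^2=\mathbb R^2/\mathbb Z^2$, such that $X$ is tangent to the tori $T^2\times\{r\}$; its coordinates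 $(x,y,r)$ are chosen positively oriented. Write $\mu=dr\wedge\sigma_r$ on $U$. The one-form $\iota_X\sigma_r$ on $T^2\times\{r\}$ is closed with nonzero class in $H^1(T^2;\mathbb R)$. The *slope* $k(r)$ is the oriented line spanned by this class, seen as a point of the unit circle $S^1$ of $H^1(T^2;\mathbb R)\cong\mathbb R^2$ with basis $[dx],[dy]$. A point of $S^1$ is *rational* if it is a positive multiple of an integral class. For $p\ne q$ in $S^1$, let $(p,q)$ be the open arc that starts at $p$ and ends at $q$ when rotating clockwise. - $X$ admits a *rational positive* (resp. *negative*) *half-twisting region* if there are an integrable region and $0\le a<b\le 1$ such that $k(a)$ and $k(b)$ are rational, $k(b)=-k(a)$, and $k(r)\in(k(a),k(b))$ (resp. $k(r)\in(k(b),k(a))$) for all $r\in(a,b)$. **Theorem.** 1. If $X$ admits a positive and a negative partial section, then $X$ is not Reeb-like. 2. If $X$ preserves a volume form and admits a rational positive (resp. negative) half-twisting region, then $X$ admits a positive (resp. negative) partial section. 3. If $X$ preserves a volume form and admits a rational positive and a rational negative half-twisting region, then $X$ is not Reeb-like. -/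

import Mathlib

open Set
open scoped Manifold ContDiff Topology

noncomputable section

namespace PartialSections

/-! ### Differential forms on a manifold -/

section Forms

variable {E : Type*} [NormedAddCommGroup E] [NormedSpace ℝ E]
  {H : Type*} [TopologicalSpace H] (I : ModelWithCorners ℝ E H)
  {M : Type*} [TopologicalSpace M] [ChartedSpace H M]

/-- A (not necessarily smooth) differential `k`-form on `M`. -/
abbrev DiffForm (M : Type*) [TopologicalSpace M] [ChartedSpace H M] (k : ℕ) :=
  ∀ x : M, (TangentSpace I x) [⋀^Fin k]→L[ℝ] ℝ

variable {I}

/-- The expression of a form in the preferred chart at `x₀`: its pullback under the inverse of the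
extended chart. It is meaningful on the target of that chart. -/
def formInChart {k : ℕ} (η : DiffForm I M k) (x₀ : M) (y : E) : E [⋀^Fin k]→L[ℝ] ℝ :=
  (η ((extChartAt I x₀).symm y)).compContinuousLinearMap
    (mfderivWithin 𝓘(ℝ, E) I (extChartAt I x₀).symm (range I) y)

/-- A form is smooth if its expressions in the charts are smooth. -/
def IsSmoothForm {k : ℕ} (η : DiffForm I M k) : Prop :=
  ∀ x₀ : M, ContDiffOn ℝ ∞ (formInChart η x₀) (extChartAt I x₀).target

/-- The exterior derivative: at `x`, take the exterior derivative of the expression of the form in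
the chart at `x`, and pull it back by that chart. -/
def extD {k : ℕ} (η : DiffForm I M k) : DiffForm I M (k + 1) := fun x =>
  (extDerivWithin (formInChart η x) (range I) (extChartAt I x x)).compContinuousLinearMap
    (mfderiv I 𝓘(ℝ, E) (extChartAt I x) x)

/-- The interior product `ι_X η = η(X, ·, …, ·)`. -/
def interiorProd {k : ℕ} (X : ∀ x : M, TangentSpace I x) (η : DiffForm I M (k + 1)) :
    DiffForm I M k := fun x =>
  ContinuousAlternatingMap.curryLeft (E := E) (η x) (X x)

/-- A smooth nowhere vanishing form. For `k = dim M` this is a volume form (an area form if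
`dim M = 2`). A volume form `o` also represents the orientation of `M` for which a frame
`e` is positive when `o (e) > 0`. -/
def IsVolumeForm {k : ℕ} (η : DiffForm I M k) : Prop :=
  IsSmoothForm η ∧ ∀ x, η x ≠ 0

/-- The wedge product `α ∧ β` of a one-form and a two-form, evaluated at `(u, v, w)`. -/
def wedge {x : M} (α : (TangentSpace I x) [⋀^Fin 1]→L[ℝ] ℝ)
    (β : (TangentSpace I x) [⋀^Fin 2]→L[ℝ] ℝ) (u v w : TangentSpace I x) : ℝ :=
  α ![u] * β ![v, w] + α ![v] * β ![w, u] + α ![w] * β ![u, v]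

end Forms

/-! ### Vector fields on three-manifolds -/

section Fields

variable {M : Type*} [TopologicalSpace M] [ChartedSpace (EuclideanSpace ℝ (Fin 3)) M]

/-- `X` is a smooth nowhere vanishing vector field. -/
def IsNonvanishingField [IsManifold (𝓡 3) ∞ M] (X : ∀ x : M, TangentSpace (𝓡 3) x) : Prop :=
  ContMDiff (𝓡 3) (𝓡 3).tangent ∞ (fun x => (⟨x, X x⟩ : TangentBundle (𝓡 3) M)) ∧
    ∀ x, X x ≠ 0

/-- `X` preserves the volume form `μ`: by Cartan's formula `L_X μ = d (ι_X μ)`, as `dμ = 0`. -/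
def Preserves (X : ∀ x : M, TangentSpace (𝓡 3) x) (μ : DiffForm (𝓡 3) M 3) : Prop :=
  ∀ x, extD (interiorProd X μ) x = 0

/-- `α` is a contact form: a smooth one-form such that `α ∧ dα` vanishes nowhere. -/
def IsContactForm (α : DiffForm (𝓡 3) M 1) : Prop :=
  IsSmoothForm α ∧ ∀ x : M, ∃ u v w : TangentSpace (𝓡 3) x, wedge (α x) (extD α x) u v w ≠ 0

/-- `X` is Reeb-like: there is a contact form `α` with `α(X) > 0` and `ι_X dα = 0`. -/
def IsReebLike (X : ∀ x : M, TangentSpace (𝓡 3) x) : Prop :=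
  ∃ α : DiffForm (𝓡 3) M 1, IsContactForm α ∧
    (∀ x, 0 < α x ![X x]) ∧ ∀ x, interiorProd X (extD α) x = 0

/-! ### Partial sections -/

section Surface

variable {S : Type*} [TopologicalSpace S] [ChartedSpace (EuclideanHalfSpace 2) S]

/-- For a boundary point `p` of a surface, the derivative in the direction `v` of the chart
coordinate that is nonnegative on the half-plane and zero on its boundary line. Thus `v` is tangent
to the boundary if this is `0`, and points out of the surface if this is negative. -/
def inwardCoord (p : S) (v : TangentSpace (𝓡∂ 2) p) : ℝ :=
  let w : EuclideanSpace ℝ (Fin 2) :=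
    mfderiv (𝓡∂ 2) 𝓘(ℝ, EuclideanSpace ℝ (Fin 2)) (extChartAt (𝓡∂ 2) p) p v
  w 0

/-- The map `f : S → M` is a partial section of `X`: a smooth immersion, which on the interior of
`S` is an embedding transverse to `X`, and on the boundary of `S` is tangent to `X`. -/
structure IsPartialSection (X : ∀ x : M, TangentSpace (𝓡 3) x) (f : S → M) : Prop where
  smooth : ContMDiff (𝓡∂ 2) (𝓡 3) ∞ f
  immersion : ∀ p, Function.Injective (mfderiv (𝓡∂ 2) (𝓡 3) f p)
  interior_embedded : Topology.IsEmbedding (fun p : (𝓡∂ 2).interior S => f p)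
  interior_transverse : ∀ p ∈ (𝓡∂ 2).interior S, X (f p) ∉ range (mfderiv (𝓡∂ 2) (𝓡 3) f p)
  boundary_tangent : ∀ p ∈ (𝓡∂ 2).boundary S, ∀ τ : TangentSpace (𝓡∂ 2) p, inwardCoord p τ = 0 →
    ∃ c : ℝ, mfderiv (𝓡∂ 2) (𝓡 3) f p τ = c • X (f p)

/-- The area form `θ` represents the orientation of `S` that makes `X` positively transverse to the
interior of `S`, where `M` is oriented by `o`. -/
def IsCoorientedBy (o : DiffForm (𝓡 3) M 3) (X : ∀ x : M, TangentSpace (𝓡 3) x) (f : S → M)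
    (θ : DiffForm (𝓡∂ 2) S 2) : Prop :=
  IsVolumeForm θ ∧ ∀ p ∈ (𝓡∂ 2).interior S, ∀ u v : TangentSpace (𝓡∂ 2) p,
    0 < θ p ![u, v] ↔
      0 < o (f p) ![X (f p), mfderiv (𝓡∂ 2) (𝓡 3) f p u, mfderiv (𝓡∂ 2) (𝓡 3) f p v]

/-- `τ` is a positive tangent vector of the boundary at `p`, for the boundary orientation induced by
the orientation `θ` of `S` (outward normal first). -/
def IsBoundaryPositive (θ : DiffForm (𝓡∂ 2) S 2) (p : S) (τ : TangentSpace (𝓡∂ 2) p) : Prop :=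
  inwardCoord p τ = 0 ∧
    ∃ n : TangentSpace (𝓡∂ 2) p, inwardCoord p n < 0 ∧ 0 < θ p ![n, τ]

/-- A partial section is positive if the induced orientation of each boundary component is the one
given by `X`. -/
def IsPositivePartialSection (o : DiffForm (𝓡 3) M 3) (X : ∀ x : M, TangentSpace (𝓡 3) x)
    (f : S → M) : Prop :=
  IsPartialSection X f ∧ ∃ θ : DiffForm (𝓡∂ 2) S 2, IsCoorientedBy o X f θ ∧
    ∀ p ∈ (𝓡∂ 2).boundary S, ∀ τ, IsBoundaryPositive θ p τ →
      ∃ c : ℝ, 0 < c ∧ mfderiv (𝓡∂ 2) (𝓡 3) f p τ = c • X (f p)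

/-- A partial section is negative if the induced orientation of each boundary component is opposite
to the one given by `X`. -/
def IsNegativePartialSection (o : DiffForm (𝓡 3) M 3) (X : ∀ x : M, TangentSpace (𝓡 3) x)
    (f : S → M) : Prop :=
  IsPartialSection X f ∧ ∃ θ : DiffForm (𝓡∂ 2) S 2, IsCoorientedBy o X f θ ∧
    ∀ p ∈ (𝓡∂ 2).boundary S, ∀ τ, IsBoundaryPositive θ p τ →
      ∃ c : ℝ, c < 0 ∧ mfderiv (𝓡∂ 2) (𝓡 3) f p τ = c • X (f p)

end Surface

/-- `X` admits a positive partial section, defined on a nonempty compact smooth surface that may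
have boundary. -/
def AdmitsPositivePartialSection (o : DiffForm (𝓡 3) M 3)
    (X : ∀ x : M, TangentSpace (𝓡 3) x) : Prop :=
  ∃ (S : Type) (_ : TopologicalSpace S) (_ : ChartedSpace (EuclideanHalfSpace 2) S),
    IsManifold (𝓡∂ 2) ∞ S ∧ T2Space S ∧ CompactSpace S ∧ Nonempty S ∧
      ∃ f : S → M, IsPositivePartialSection o X f

/-- `X` admits a negative partial section, defined on a nonempty compact smooth surface that may
have boundary. -/
def AdmitsNegativePartialSection (o : DiffForm (𝓡 3) M 3)
    (X : ∀ x : M, TangentSpace (𝓡 3) x) : Prop :=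
  ∃ (S : Type) (_ : TopologicalSpace S) (_ : ChartedSpace (EuclideanHalfSpace 2) S),
    IsManifold (𝓡∂ 2) ∞ S ∧ T2Space S ∧ CompactSpace S ∧ Nonempty S ∧
      ∃ f : S → M, IsNegativePartialSection o X f

/-! ### Integrable regions, the slope function, and half-twisting -/

/-- The thickened plane `ℝ² × [0, 1]`, the universal cover of `T² × [0, 1]` with `T² = ℝ² / ℤ²`. -/
def slab : Set (ℝ × ℝ × ℝ) := {q | q.2.2 ∈ Icc (0 : ℝ) 1}

/-- The coordinate vectors `∂x`, `∂y`, `∂r` (and their combinations) at `q`, mapped to `M` by `Φ`. -/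
def push (Φ : ℝ × ℝ × ℝ → M) (q v : ℝ × ℝ × ℝ) : TangentSpace (𝓡 3) (Φ q) :=
  mfderivWithin 𝓘(ℝ, ℝ × ℝ × ℝ) (𝓡 3) Φ slab q v

/-- `Φ` is a positively oriented diffeomorphism of `T² × [0, 1]` onto an integrable region of `X`.
It is given by its lift to `ℝ² × [0, 1]`: smooth, `ℤ²`-periodic in `(x, y)`, injective up to these
periods, with invertible derivative, and `X` is tangent to the images of the tori `r = const`.
Here `M` is oriented by `o`, and `T² × [0, 1]` by the coordinates `(x, y, r)`. -/
structure IsIntegrableRegion (o : DiffForm (𝓡 3) M 3) (X : ∀ x : M, TangentSpace (𝓡 3) x)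
    (Φ : ℝ × ℝ × ℝ → M) : Prop where
  smooth : ContMDiffOn 𝓘(ℝ, ℝ × ℝ × ℝ) (𝓡 3) ∞ Φ slab
  periodic : ∀ x y r, (x, y, r) ∈ slab →
    Φ (x + 1, y, r) = Φ (x, y, r) ∧ Φ (x, y + 1, r) = Φ (x, y, r)
  injective : ∀ x y r x' y' r', (x, y, r) ∈ slab → (x', y', r') ∈ slab →
    Φ (x, y, r) = Φ (x', y', r') → r = r' ∧ ∃ m n : ℤ, x' = x + m ∧ y' = y + n
  oriented : ∀ q ∈ slab, 0 < o (Φ q) ![push Φ q (1, 0, 0), push Φ q (0, 1, 0), push Φ q (0, 0, 1)]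
  tangent : ∀ q ∈ slab, ∃ c₁ c₂ : ℝ, X (Φ q) = push Φ q (c₁, c₂, 0)

/-- Write `μ = dr ∧ σ_r`, so that `σ_r` is the restriction of `ι_{∂r} μ` to the torus `T² × {r}`.
This is the cohomology class of the closed one-form `ι_X σ_r` on that torus, as an element of
`H¹(T²; ℝ)`. The latter is identified with `ℝ² = ℂ` by the basis `[dx], [dy]`, that is, by the
integrals over the two circles `y = 0` and `x = 0`. -/
def fluxClass (μ : DiffForm (𝓡 3) M 3) (X : ∀ x : M, TangentSpace (𝓡 3) x)
    (Φ : ℝ × ℝ × ℝ → M) (r : ℝ) : ℂ :=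
  ⟨∫ s in (0 : ℝ)..1, μ (Φ (s, 0, r))
      ![push Φ (s, 0, r) (0, 0, 1), X (Φ (s, 0, r)), push Φ (s, 0, r) (1, 0, 0)],
    ∫ s in (0 : ℝ)..1, μ (Φ (0, s, r))
      ![push Φ (0, s, r) (0, 0, 1), X (Φ (0, s, r)), push Φ (0, s, r) (0, 1, 0)]⟩

/-- The slope function, with values in the unit circle, i.e. in the space of oriented lines of
`H¹(T²; ℝ)`. -/
def slope (μ : DiffForm (𝓡 3) M 3) (X : ∀ x : M, TangentSpace (𝓡 3) x)
    (Φ : ℝ × ℝ × ℝ → M) (r : ℝ) : ℂ :=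
  fluxClass μ X Φ r / (‖fluxClass μ X Φ r‖ : ℂ)

/-- The open arc of the unit circle that starts at `p`, rotates clockwise, and ends at `q`. -/
def clockwiseArc (p q : ℂ) : Set ℂ :=
  {z | ∃ s t : ℝ, 0 < s ∧ s < t ∧ t < 2 * Real.pi ∧
    z = Complex.exp (-(s : ℂ) * Complex.I) * p ∧ q = Complex.exp (-(t : ℂ) * Complex.I) * p}

/-- A rational point of the circle of directions: the direction of a nonzero integral class. -/
def IsRationalDirection (z : ℂ) : Prop :=
  z ≠ 0 ∧ ∃ (t : ℝ) (m n : ℤ), 0 < t ∧ z = (t : ℂ) * ((m : ℂ) + (n : ℂ) * Complex.I)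

/-- `X`, which preserves `μ`, admits a rational positive half-twisting integrable region. -/
def AdmitsPositiveRationalHalfTwist (o μ : DiffForm (𝓡 3) M 3)
    (X : ∀ x : M, TangentSpace (𝓡 3) x) : Prop :=
  ∃ Φ : ℝ × ℝ × ℝ → M, IsIntegrableRegion o X Φ ∧ ∃ a b : ℝ, 0 ≤ a ∧ a < b ∧ b ≤ 1 ∧
    slope μ X Φ b = -slope μ X Φ a ∧
    (∀ r ∈ Ioo a b, slope μ X Φ r ∈ clockwiseArc (slope μ X Φ a) (slope μ X Φ b)) ∧
    IsRationalDirection (slope μ X Φ a) ∧ IsRationalDirection (slope μ X Φ b)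

/-- `X`, which preserves `μ`, admits a rational negative half-twisting integrable region. -/
def AdmitsNegativeRationalHalfTwist (o μ : DiffForm (𝓡 3) M 3)
    (X : ∀ x : M, TangentSpace (𝓡 3) x) : Prop :=
  ∃ Φ : ℝ × ℝ × ℝ → M, IsIntegrableRegion o X Φ ∧ ∃ a b : ℝ, 0 ≤ a ∧ a < b ∧ b ≤ 1 ∧
    slope μ X Φ b = -slope μ X Φ a ∧
    (∀ r ∈ Ioo a b, slope μ X Φ r ∈ clockwiseArc (slope μ X Φ b) (slope μ X Φ a)) ∧
    IsRationalDirection (slope μ X Φ a) ∧ IsRationalDirection (slope μ X Φ b)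

end Fields

end PartialSections

end

/-! Obstruction. Let α be a contact form with α(X) > 0 and ι_X dα = 0. Both dα and ι_X o are nowhere
zero two-forms with kernel spanned by X, so they are proportional, and on a connected manifold the
factor has a constant sign (`extD_sign_of_reeb`). If it is positive, dα pulls back to a positive
area form on the interior of a negative partial section, while α is negative on positive boundary
vectors; Stokes' theorem gives 0 < ∫ dα = ∫ α ≤ 0, which also rules out an empty boundary. If it is
negative, the same argument applies to -α and a positive section. Stokes' theorem is needed only as
the inequality `not_exact_of_boundary_nonpos`, obtained from Green's formula in the half-plane and a
partition of unity.

Construction. In an integrable region write ι_X σ_r = P dx + Q dy. Preservation of μ and tangency of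
X to the tori make this form closed on each torus, and X is a nonvanishing multiple of (Q, -P). On
the universal cover it is thus, up to that factor, the Hamiltonian field of a potential F without
critical points, which gains the components A(r), B(r) of the flux class under the two generators of
ℤ². The orbits are the level curves of F. To straighten them one needs a second function G that
grows along the Hamiltonian field and also has constant gains c(r), d(r) under ℤ². Then (F, G, r)
are global coordinates (`IsCoordinateFamily.exists_inverse`) in which the orbits are the lines F =
const, ℤ² acts by translations, and B c - A d > 0 (`det_periods_pos`).

To find G at one height: each level of F is a single, nonclosed trajectory (`exists_flow_eq`,
`flow_ne_self`), and trajectories leave bounded sets in a uniform time (`exists_escape_time`). Hence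
some linear function increases by a definite amount over a fixed time (`exists_linear_drift`).
Averaging it over that time and mollifying gives G (`exists_transverse`); a partition of unity in r
gives a smooth family (`exists_transverse_family`).

The section. Let (p, q) be the primitive integral vector annihilated by the flux class at height a.
In the straight coordinates take the points s (w(r), k(r)) at height r, a ≤ r ≤ b, with w = A p + B
q and k = c p + d q. This band has period (p, q) in s and descends to an embedded annulus. The
number w is the pairing of the flux class with (p, q). It vanishes at both ends, so the boundary
circles are closed orbits; in between the class stays in an open half-circle, so w has a constant
sign and the annulus is transverse to X. By B c - A d > 0 and the reversal of the flux class, k has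
opposite signs at a and b: X runs against (p, q) at one end and along it at the other, up to a
common sign. This compensates the opposite boundary orientations of the two circles, so both have
the same sign, determined by the sense of rotation (`exists_isSectionLift`,
`exists_isSectionLift_of_twist`).

The last claim combines the construction with the obstruction. -/

/-! ### Global flows of bounded Lipschitz vector fields -/

section Flow

variable {E : Type*} [NormedAddCommGroup E] [NormedSpace ℝ E]

/-- `ψ` is a global flow of the vector field `W`. -/
structure IsGlobalFlow (W : E → E) (ψ : ℝ → E → E) : Prop where
  zero : ∀ x, ψ 0 x = x
  deriv : ∀ x t, HasDerivAt (fun s => ψ s x) (W (ψ t x)) t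

theorem exists_isGlobalFlow [CompleteSpace E] {W : E → E} {K L : NNReal} (hK : LipschitzWith K W)
    (hL : ∀ x, ‖W x‖ ≤ L) : ∃ ψ : ℝ → E → E, IsGlobalFlow W ψ := by
  have sol : ∀ (x : E) (T : ℝ), 0 < T → ∃ α : ℝ → E, α 0 = x ∧
      ∀ t ∈ Ioo (-T) T, HasDerivAt α (W (α t)) t := by
    intro x T hT
    have h0 : (0 : ℝ) ∈ Icc (-T) T := ⟨by linarith, hT.le⟩
    -- Since the speed is at most `L`, a solution stays in the ball of radius `L * T` up to time
    -- `T`, so no smallness of `T` is needed.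
    have hp : IsPicardLindelof (fun _ : ℝ => W) (⟨0, h0⟩ : Icc (-T) T) x
        (L * ⟨T, hT.le⟩) 0 L K := by
      refine ⟨fun t _ => hK.lipschitzOnWith, fun x _ => continuousOn_const, fun t _ x _ => hL x, ?_⟩
      simp only [sub_zero, zero_sub, neg_neg, max_self, NNReal.coe_zero]
      exact le_rfl
    obtain ⟨α, h1, h2⟩ := hp.exists_eq_forall_mem_Icc_hasDerivWithinAt₀
    exact ⟨α, h1, fun t ht => (h2 t (Ioo_subset_Icc_self ht)).hasDerivAt (Icc_mem_nhds ht.1 ht.2)⟩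
  choose! α h0 hα using sol
  have agree : ∀ x T T' t, 0 < T → T ≤ T' → t ∈ Ioo (-T) T → α x T t = α x T' t := by
    intro x T T' t hT hTT' ht
    refine ODE_solution_unique_of_mem_Ioo (v := fun _ => W) (s := fun _ => univ) (K := K)
      (fun t _ => hK.lipschitzOnWith) (t₀ := 0) ⟨by linarith, hT⟩
      (fun s hs => ⟨hα x T hT s hs, trivial⟩)
      (fun s hs => ⟨hα x T' (by linarith) s ⟨by linarith [hs.1], by linarith [hs.2]⟩, trivial⟩)
      ?_ ht
    rw [h0 x T hT, h0 x T' (by linarith)]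
  -- The time horizon varies with `t`, but for times within 1 of `t` it is at most `|t| + 2`, so
  -- locally one sees the single solution with that horizon.
  refine ⟨fun t x => α x (|t| + 1) t, fun x => h0 x _ (by positivity), fun x t => ?_⟩
  have hev : (fun s => α x (|s| + 1) s) =ᶠ[𝓝 t] α x (|t| + 2) := by
    filter_upwards [Metric.ball_mem_nhds t one_pos] with s hs
    rw [Metric.mem_ball, Real.dist_eq] at hs
    refine agree x _ _ s (by positivity) ?_ ?_
    · have := abs_sub_abs_le_abs_sub s t
      linarith
    · constructor <;> linarith [neg_abs_le s, le_abs_self s]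
  have h := hα x (|t| + 2) (by positivity) t ⟨by linarith [neg_abs_le t], by linarith [le_abs_self t]⟩
  have heq := hev.eq_of_nhds
  beta_reduce at heq
  rw [heq]
  exact h.congr_of_eventuallyEq hev

namespace IsGlobalFlow

variable {W : E → E} {ψ : ℝ → E → E} {K L : NNReal}

theorem unique (h : IsGlobalFlow W ψ) (hK : LipschitzWith K W) {f : ℝ → E}
    (hf : ∀ t, HasDerivAt f (W (f t)) t) (t : ℝ) : f t = ψ t (f 0) := by
  have := ODE_solution_unique_univ (v := fun _ => W) (s := fun _ => univ) (K := K) (t₀ := 0)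
    (fun _ => hK.lipschitzOnWith) (fun t => ⟨hf t, trivial⟩)
    (fun t => ⟨h.deriv (f 0) t, trivial⟩) (h.zero _).symm
  exact congrFun this t

theorem add (h : IsGlobalFlow W ψ) (hK : LipschitzWith K W) (s t : ℝ) (x : E) :
    ψ (s + t) x = ψ s (ψ t x) := by
  have := h.unique hK (f := fun u => ψ (u + t) x)
    (fun u => by simpa using (h.deriv x (u + t)).comp_add_const u t) s
  simpa using this

theorem neg_apply (h : IsGlobalFlow W ψ) (hK : LipschitzWith K W) (t : ℝ) (x : E) :
    ψ (-t) (ψ t x) = x := by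
  rw [← h.add hK, neg_add_cancel, h.zero]

/-- A trajectory translated by a period of the field is again a trajectory; uniqueness concludes.
This makes the flow commute with ℤ² later on. -/
theorem translate (h : IsGlobalFlow W ψ) (hK : LipschitzWith K W) {e : E}
    (he : ∀ x, W (x + e) = W x) (t : ℝ) (x : E) : ψ t (x + e) = ψ t x + e := by
  have := h.unique hK (f := fun u => ψ u x + e)
    (fun u => by rw [he]; exact (h.deriv x u).add_const e) t
  simpa [h.zero] using this.symm

theorem continuous_time (h : IsGlobalFlow W ψ) (x : E) : Continuous fun t => ψ t x :=
  continuous_iff_continuousAt.2 fun t => (h.deriv x t).continuousAt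

theorem reverse (h : IsGlobalFlow W ψ) : IsGlobalFlow (fun x => -W x) (fun t x => ψ (-t) x) where
  zero x := by simpa using h.zero x
  deriv x t := by
    have := (h.deriv x (-t)).scomp t (hasDerivAt_neg t)
    simpa [Function.comp_def] using this

theorem dist_le_of_nonneg (h : IsGlobalFlow W ψ) (hK : LipschitzWith K W) {t : ℝ} (ht : 0 ≤ t)
    (x y : E) : dist (ψ t x) (ψ t y) ≤ dist x y * Real.exp (K * t) := by
  have := dist_le_of_trajectories_ODE (v := fun _ => W) (K := K) (a := 0) (b := t)
    (f := fun s => ψ s x) (g := fun s => ψ s y) (δ := dist x y)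
    (fun _ => hK) (h.continuous_time x).continuousOn
    (fun s _ => (h.deriv x s).hasDerivWithinAt) (h.continuous_time y).continuousOn
    (fun s _ => (h.deriv y s).hasDerivWithinAt) (by simp [h.zero]) t ⟨ht, le_rfl⟩
  simpa using this

/-- Grönwall's inequality, applied to the reversed flow for negative times. -/
theorem dist_le (h : IsGlobalFlow W ψ) (hK : LipschitzWith K W) (t : ℝ) (x y : E) :
    dist (ψ t x) (ψ t y) ≤ dist x y * Real.exp (K * |t|) := by
  rcases le_total 0 t with ht | ht
  · rw [abs_of_nonneg ht]; exact h.dist_le_of_nonneg hK ht x y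
  · have := h.reverse.dist_le_of_nonneg (K := K) (LipschitzWith.of_dist_le_mul fun x y => by
      simpa [dist_neg_neg] using hK.dist_le_mul x y) (neg_nonneg.2 ht) x y
    rw [abs_of_nonpos ht]; simpa using this

theorem dist_time_le (h : IsGlobalFlow W ψ) (hL : ∀ x, ‖W x‖ ≤ L) (s t : ℝ) (x : E) :
    dist (ψ s x) (ψ t x) ≤ L * dist s t := by
  have : LipschitzWith L (fun t => ψ t x) :=
    lipschitzWith_of_nnnorm_deriv_le (fun t => (h.deriv x t).differentiableAt)
      fun t => by rw [(h.deriv x t).deriv]; exact hL _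
  exact this.dist_le_mul s t

theorem continuous_uncurry (h : IsGlobalFlow W ψ) (hK : LipschitzWith K W) :
    Continuous fun p : ℝ × E => ψ p.1 p.2 := by
  rw [continuous_iff_continuousAt]
  rintro ⟨t, x⟩
  rw [ContinuousAt, tendsto_iff_dist_tendsto_zero]
  have hb : ∀ p : ℝ × E, dist (ψ p.1 p.2) (ψ t x) ≤
      dist p.2 x * Real.exp (K * |p.1|) + dist (ψ p.1 x) (ψ t x) := fun p =>
    (dist_triangle _ (ψ p.1 x) _).trans (by gcongr; exact h.dist_le hK _ _ _)
  refine squeeze_zero (fun _ => dist_nonneg) hb ?_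
  have hc : Continuous fun p : ℝ × E =>
      dist p.2 x * Real.exp (K * |p.1|) + dist (ψ p.1 x) (ψ t x) := by
    have := (h.continuous_time x).comp (continuous_fst (X := ℝ) (Y := E))
    exact ((continuous_snd.dist continuous_const).mul
      (Real.continuous_exp.comp (continuous_const.mul continuous_fst.abs))).add
      (this.dist continuous_const)
  have := hc.tendsto (t, x)
  simpa using this

end IsGlobalFlow

end Flow

/-! ### Functions on the plane with doubly periodic differential -/

section Periodic

/-- `F` gains `a` under the translation by `(1, 0)` and `b` under the translation by `(0, 1)`. -/
structure IsQuasiPeriodic (F : ℝ × ℝ → ℝ) (a b : ℝ) : Prop where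
  fst : ∀ z, F (z + (1, 0)) = F z + a
  snd : ∀ z, F (z + (0, 1)) = F z + b

/-- `f` is invariant under translations by `ℤ²`. -/
structure IsDoublyPeriodic {Y : Type*} (f : ℝ × ℝ → Y) : Prop where
  fst : Function.Periodic f (1, 0)
  snd : Function.Periodic f (0, 1)

theorem IsDoublyPeriodic.int {Y : Type*} {f : ℝ × ℝ → Y} (h : IsDoublyPeriodic f) (z : ℝ × ℝ)
    (m n : ℤ) : f (z + ((m : ℝ), (n : ℝ))) = f z := by
  have h1 := h.fst.zsmul m z
  have h2 := h.snd.zsmul n (z + m • (1, 0))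
  rw [h1] at h2
  rw [← h2]
  congr 1
  ext <;> simp

theorem exists_mem_unitSquare (z : ℝ × ℝ) : ∃ w ∈ Icc (0 : ℝ × ℝ) 1, ∃ m n : ℤ,
    z = w + ((m : ℝ), (n : ℝ)) := by
  refine ⟨(Int.fract z.1, Int.fract z.2), ⟨?_, ?_⟩, ⌊z.1⌋, ⌊z.2⌋, ?_⟩
  · exact ⟨Int.fract_nonneg _, Int.fract_nonneg _⟩
  · exact ⟨(Int.fract_lt_one _).le, (Int.fract_lt_one _).le⟩
  · ext <;> simp [Int.fract_add_floor]

theorem norm_le_one_of_mem_unitSquare {w : ℝ × ℝ} (hw : w ∈ Icc (0 : ℝ × ℝ) 1) : ‖w‖ ≤ 1 := by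
  obtain ⟨⟨h1, h2⟩, h3, h4⟩ := hw
  simp only [Prod.fst_zero, Prod.snd_zero, Prod.fst_one, Prod.snd_one] at h1 h2 h3 h4
  rw [Prod.norm_def, max_le_iff, Real.norm_eq_abs, Real.norm_eq_abs, abs_of_nonneg h1,
    abs_of_nonneg h2]
  exact ⟨h3, h4⟩

theorem IsDoublyPeriodic.exists_bound {Y : Type*} [SeminormedAddCommGroup Y] {f : ℝ × ℝ → Y}
    (h : IsDoublyPeriodic f) (hc : Continuous f) : ∃ C : NNReal, ∀ z, ‖f z‖ ≤ C := by
  obtain ⟨C, hC⟩ := (isCompact_Icc (a := (0 : ℝ × ℝ)) (b := 1)).exists_bound_of_continuousOn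
    hc.continuousOn
  refine ⟨C.toNNReal, fun z => ?_⟩
  obtain ⟨w, hw, m, n, rfl⟩ := exists_mem_unitSquare z
  rw [h.int]
  exact (hC w hw).trans (Real.le_coe_toNNReal C)

theorem IsDoublyPeriodic.exists_pos_le {f : ℝ × ℝ → ℝ} (h : IsDoublyPeriodic f)
    (hc : Continuous f) (hpos : ∀ z, 0 < f z) : ∃ δ > 0, ∀ z, δ ≤ f z := by
  obtain ⟨w, hw, hmin⟩ := (isCompact_Icc (a := (0 : ℝ × ℝ)) (b := 1)).exists_isMinOn
    ⟨0, le_rfl, zero_le_one⟩ hc.continuousOn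
  refine ⟨f w, hpos w, fun z => ?_⟩
  obtain ⟨w', hw', m, n, rfl⟩ := exists_mem_unitSquare z
  rw [h.int]
  exact hmin hw'

theorem IsDoublyPeriodic.fderiv {Y : Type*} [NormedAddCommGroup Y] [NormedSpace ℝ Y]
    {f : ℝ × ℝ → Y} (h : IsDoublyPeriodic f) : IsDoublyPeriodic (fderiv ℝ f) where
  fst z := by
    rw [← fderiv_comp_add_right]
    exact congrFun (congrArg _ (funext h.fst)) z
  snd z := by
    rw [← fderiv_comp_add_right]
    exact congrFun (congrArg _ (funext h.snd)) z

theorem IsDoublyPeriodic.exists_lipschitzWith {Y : Type*} [NormedAddCommGroup Y] [NormedSpace ℝ Y]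
    {f : ℝ × ℝ → Y} (h : IsDoublyPeriodic f) (hf : ContDiff ℝ ∞ f) :
    ∃ K : NNReal, LipschitzWith K f := by
  obtain ⟨K, hK⟩ := h.fderiv.exists_bound (hf.continuous_fderiv (by simp))
  exact ⟨K, lipschitzWith_of_nnnorm_fderiv_le (hf.differentiable (by simp)) hK⟩

namespace IsQuasiPeriodic

variable {F G : ℝ × ℝ → ℝ} {a b c d : ℝ}

theorem sub_linear (h : IsQuasiPeriodic F a b) :
    IsDoublyPeriodic fun z => F z - (a * z.1 + b * z.2) where
  fst z := by simp only [h.fst, Prod.fst_add, Prod.snd_add]; ring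
  snd z := by simp only [h.snd, Prod.fst_add, Prod.snd_add]; ring

theorem int (h : IsQuasiPeriodic F a b) (z : ℝ × ℝ) (m n : ℤ) :
    F (z + ((m : ℝ), (n : ℝ))) = F z + (a * m + b * n) := by
  have := h.sub_linear.int z m n
  simp only [Prod.fst_add, Prod.snd_add] at this
  linarith

theorem fderiv (h : IsQuasiPeriodic F a b) : IsDoublyPeriodic (fderiv ℝ F) where
  fst z := by
    rw [← fderiv_comp_add_right, funext h.fst, fderiv_add_const]
  snd z := by
    rw [← fderiv_comp_add_right, funext h.snd, fderiv_add_const]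

theorem exists_abs_sub_linear_le (h : IsQuasiPeriodic F a b) (hc : Continuous F) :
    ∃ C, 0 ≤ C ∧ ∀ z, |F z - (a * z.1 + b * z.2)| ≤ C := by
  obtain ⟨C, hC⟩ := h.sub_linear.exists_bound (by fun_prop)
  exact ⟨C, C.2, hC⟩

end IsQuasiPeriodic

theorem ContinuousLinearMap.apply_pair (L : ℝ × ℝ →L[ℝ] ℝ) (z : ℝ × ℝ) :
    L z = z.1 * L (1, 0) + z.2 * L (0, 1) := by
  rw [← smul_eq_mul, ← smul_eq_mul, ← map_smul, ← map_smul, ← map_add]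
  congr 1
  ext <;> simp

end Periodic

/-! ### The Hamiltonian and the normalized gradient field of a function on the plane -/

section Planar

/-- The Hamiltonian field `(∂F/∂y, -∂F/∂x)`. -/
noncomputable def hamField (F : ℝ × ℝ → ℝ) (z : ℝ × ℝ) : ℝ × ℝ :=
  (fderiv ℝ F z (0, 1), -fderiv ℝ F z (1, 0))

/-- The gradient field, normalized so that `F` grows at unit speed. -/
noncomputable def unitGradField (F : ℝ × ℝ → ℝ) (z : ℝ × ℝ) : ℝ × ℝ :=
  ((fderiv ℝ F z (1, 0)) ^ 2 + (fderiv ℝ F z (0, 1)) ^ 2)⁻¹ •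
    (fderiv ℝ F z (1, 0), fderiv ℝ F z (0, 1))

/-- A smooth function on the plane without critical points whose differential is doubly periodic. -/
structure IsRegularPotential (F : ℝ × ℝ → ℝ) (a b : ℝ) : Prop where
  smooth : ContDiff ℝ ∞ F
  quasi : IsQuasiPeriodic F a b
  regular : ∀ z, fderiv ℝ F z ≠ 0

namespace IsRegularPotential

variable {F : ℝ × ℝ → ℝ} {a b : ℝ}

theorem grad_sq_pos (h : IsRegularPotential F a b) (z : ℝ × ℝ) :
    0 < (fderiv ℝ F z (1, 0)) ^ 2 + (fderiv ℝ F z (0, 1)) ^ 2 := by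
  by_contra! hle
  have h1 : fderiv ℝ F z (1, 0) = 0 := by nlinarith [sq_nonneg (fderiv ℝ F z (1, 0)), sq_nonneg (fderiv ℝ F z (0, 1))]
  have h2 : fderiv ℝ F z (0, 1) = 0 := by nlinarith [sq_nonneg (fderiv ℝ F z (1, 0)), sq_nonneg (fderiv ℝ F z (0, 1))]
  apply h.regular z
  ext <;> simp [h1, h2]

theorem fderiv_hamField (F : ℝ × ℝ → ℝ) (z : ℝ × ℝ) : fderiv ℝ F z (hamField F z) = 0 := by
  rw [ContinuousLinearMap.apply_pair]
  simp only [hamField]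
  ring

theorem fderiv_unitGradField (h : IsRegularPotential F a b) (z : ℝ × ℝ) :
    fderiv ℝ F z (unitGradField F z) = 1 := by
  have := (h.grad_sq_pos z).ne'
  rw [unitGradField, map_smul, ContinuousLinearMap.apply_pair _
    (fderiv ℝ F z (1, 0), fderiv ℝ F z (0, 1))]
  simp only [smul_eq_mul]
  field_simp

theorem contDiff_fderiv_apply (h : ContDiff ℝ ∞ F) (v : ℝ × ℝ) :
    ContDiff ℝ ∞ fun z => fderiv ℝ F z v :=
  (h.fderiv_right (m := ∞) (by simp)).clm_apply contDiff_const

theorem contDiff_hamField (h : IsRegularPotential F a b) : ContDiff ℝ ∞ (hamField F) :=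
  (contDiff_fderiv_apply h.smooth _).prodMk (contDiff_fderiv_apply h.smooth _).neg

theorem contDiff_unitGradField (h : IsRegularPotential F a b) :
    ContDiff ℝ ∞ (unitGradField F) :=
  ((((contDiff_fderiv_apply h.smooth _).pow 2).add
    ((contDiff_fderiv_apply h.smooth _).pow 2)).inv fun z => (h.grad_sq_pos z).ne').smul
    ((contDiff_fderiv_apply h.smooth _).prodMk (contDiff_fderiv_apply h.smooth _))

theorem periodic_hamField (h : IsRegularPotential F a b) : IsDoublyPeriodic (hamField F) where
  fst z := by simp only [hamField, h.quasi.fderiv.fst z]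
  snd z := by simp only [hamField, h.quasi.fderiv.snd z]

theorem periodic_unitGradField (h : IsRegularPotential F a b) :
    IsDoublyPeriodic (unitGradField F) where
  fst z := by simp only [unitGradField, h.quasi.fderiv.fst z]
  snd z := by simp only [unitGradField, h.quasi.fderiv.snd z]

theorem hasDerivAt_comp_flow (hF : ContDiff ℝ ∞ F) {G : ℝ × ℝ → ℝ × ℝ}
    {ψ : ℝ → ℝ × ℝ → ℝ × ℝ} (hψ : IsGlobalFlow G ψ) (t : ℝ) (z : ℝ × ℝ) :
    HasDerivAt (fun s => F (ψ s z)) (fderiv ℝ F (ψ t z) (G (ψ t z))) t :=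
  ((hF.differentiable (by simp)).differentiableAt.hasFDerivAt).comp_hasDerivAt t (hψ.deriv z t)

theorem apply_hamFlow (h : IsRegularPotential F a b) {ψ : ℝ → ℝ × ℝ → ℝ × ℝ}
    (hψ : IsGlobalFlow (hamField F) ψ) (t : ℝ) (z : ℝ × ℝ) : F (ψ t z) = F z := by
  have := is_const_of_deriv_eq_zero
    (fun t => (hasDerivAt_comp_flow h.smooth hψ t z).differentiableAt)
    (fun t => by rw [(hasDerivAt_comp_flow h.smooth hψ t z).deriv, fderiv_hamField]) t 0
  simpa [hψ.zero] using this

theorem apply_gradFlow (h : IsRegularPotential F a b) {φ : ℝ → ℝ × ℝ → ℝ × ℝ}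
    (hφ : IsGlobalFlow (unitGradField F) φ) (t : ℝ) (z : ℝ × ℝ) : F (φ t z) = F z + t := by
  have hd : ∀ t, HasDerivAt (fun s => F (φ s z) - s) 0 t := fun t => by
    have := (hasDerivAt_comp_flow h.smooth hφ t z).sub (hasDerivAt_id t)
    rw [h.fderiv_unitGradField, sub_self] at this
    exact this
  have := is_const_of_deriv_eq_zero (fun t => (hd t).differentiableAt)
    (fun t => (hd t).deriv) t 0
  simp only [hφ.zero] at this
  linarith

theorem exists_hamFlow (h : IsRegularPotential F a b) : ∃ ψ : ℝ → ℝ × ℝ → ℝ × ℝ, ∃ K L : NNReal,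
    IsGlobalFlow (hamField F) ψ ∧ LipschitzWith K (hamField F) ∧ ∀ z, ‖hamField F z‖ ≤ L := by
  obtain ⟨K, hK⟩ := h.periodic_hamField.exists_lipschitzWith h.contDiff_hamField
  obtain ⟨L, hL⟩ := h.periodic_hamField.exists_bound hK.continuous
  obtain ⟨ψ, hψ⟩ := exists_isGlobalFlow hK hL
  exact ⟨ψ, K, L, hψ, hK, hL⟩

theorem exists_gradFlow (h : IsRegularPotential F a b) : ∃ φ : ℝ → ℝ × ℝ → ℝ × ℝ, ∃ K : NNReal,
    IsGlobalFlow (unitGradField F) φ ∧ LipschitzWith K (unitGradField F) := by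
  obtain ⟨K, hK⟩ := h.periodic_unitGradField.exists_lipschitzWith h.contDiff_unitGradField
  obtain ⟨L, hL⟩ := h.periodic_unitGradField.exists_bound hK.continuous
  obtain ⟨ψ, hψ⟩ := exists_isGlobalFlow hK hL
  exact ⟨ψ, K, hψ, hK⟩

theorem surjective (h : IsRegularPotential F a b) (f : ℝ) : ∃ z, F z = f := by
  obtain ⟨φ, K, hφ, hK⟩ := h.exists_gradFlow
  exact ⟨φ (f - F 0) 0, by rw [h.apply_gradFlow hφ]; ring⟩

/-- With both periods zero the potential would be doubly periodic, hence bounded, whereas it is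
unbounded along the normalized gradient flow. -/
theorem period_sq_pos (h : IsRegularPotential F a b) : 0 < a ^ 2 + b ^ 2 := by
  by_contra! hle
  have ha : a = 0 := by nlinarith [sq_nonneg a, sq_nonneg b]
  have hb : b = 0 := by nlinarith [sq_nonneg a, sq_nonneg b]
  obtain ⟨C, hC0, hC⟩ := h.quasi.exists_abs_sub_linear_le h.smooth.continuous
  obtain ⟨z, hz⟩ := h.surjective (C + 1)
  have := hC z
  rw [ha, hb, hz] at this
  simp only [zero_mul, add_zero, sub_zero] at this
  linarith [le_abs_self (C + 1)]

/-- Near any point, points on the same level are joined by short trajectories. -/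
theorem exists_flowBox (h : IsRegularPotential F a b) {ψ : ℝ → ℝ × ℝ → ℝ × ℝ} {L : NNReal}
    (hψ : IsGlobalFlow (hamField F) ψ) (hL : ∀ z, ‖hamField F z‖ ≤ L) (z₀ : ℝ × ℝ) :
    ∃ U ∈ 𝓝 z₀, ∀ p ∈ U, ∀ q ∈ U, F p = F q → ∃ u, |u| ≤ 1 ∧ ψ u p = q := by
  set α := fderiv ℝ F z₀ (0, 1) with hα
  set β := fderiv ℝ F z₀ (1, 0) with hβ
  have hαβ : 0 < β ^ 2 + α ^ 2 := h.grad_sq_pos z₀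
  -- This linear function increases along the Hamiltonian field at rate `β ^ 2 + α ^ 2` at `z₀`;
  -- together with `F` it is a local coordinate system there.
  let N : ℝ × ℝ →L[ℝ] ℝ := α • ContinuousLinearMap.fst ℝ ℝ ℝ - β • ContinuousLinearMap.snd ℝ ℝ ℝ
  have hN : ∀ z, N z = α * z.1 - β * z.2 := fun z => by simp [N]
  have hinj : Function.Injective ((fderiv ℝ F z₀).prod N).toLinearMap := by
    rw [← LinearMap.ker_eq_bot, LinearMap.ker_eq_bot']
    intro v hv
    have hv1 : fderiv ℝ F z₀ v = 0 := congrArg Prod.fst hv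
    have hv2 : N v = 0 := congrArg Prod.snd hv
    rw [ContinuousLinearMap.apply_pair, ← hα, ← hβ] at hv1
    rw [hN] at hv2
    have e1 : v.1 * (β ^ 2 + α ^ 2) = 0 := by linear_combination β * hv1 + α * hv2
    have e2 : v.2 * (β ^ 2 + α ^ 2) = 0 := by linear_combination α * hv1 - β * hv2
    ext
    · exact (mul_eq_zero.1 e1).resolve_right hαβ.ne'
    · exact (mul_eq_zero.1 e2).resolve_right hαβ.ne'
  let Q' := (LinearEquiv.ofInjectiveEndo _ hinj).toContinuousLinearEquiv
  have hQ : HasStrictFDerivAt (fun z => (F z, N z)) (Q' : ℝ × ℝ →L[ℝ] ℝ × ℝ) z₀ :=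
    ((h.smooth.contDiffAt.hasStrictFDerivAt (by simp)).prodMk N.hasStrictFDerivAt).congr_fderiv
      (by ext <;> rfl)
  have hsrc : (hQ.toOpenPartialHomeomorph _).source ∈ 𝓝 z₀ :=
    (hQ.toOpenPartialHomeomorph _).open_source.mem_nhds hQ.mem_toOpenPartialHomeomorph_source
  have hinjQ : InjOn (fun z => (F z, N z)) (hQ.toOpenPartialHomeomorph _).source :=
    (hQ.toOpenPartialHomeomorph _).injOn
  set c := (β ^ 2 + α ^ 2) / 2 with hc
  have hcpos : 0 < c := by positivity
  have hspeed : {z | c < N (hamField F z)} ∈ 𝓝 z₀ := by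
    refine (N.continuous.comp h.contDiff_hamField.continuous).continuousAt.eventually_const_lt ?_
    simp only [Function.comp, hN, hamField]
    rw [← hα, ← hβ]
    nlinarith
  obtain ⟨ε, hε, hball⟩ := Metric.mem_nhds_iff.1 (Filter.inter_mem hsrc hspeed)
  -- At speed at most `L`, a trajectory that starts in the half-size ball stays in the full ball for
  -- times up to `η`.
  set η := min 1 (ε / (2 * (L + 1))) with hη
  have hLpos : (0 : ℝ) < L + 1 := by positivity
  have hηpos : 0 < η := lt_min one_pos (by positivity)
  have hηL : L * η < ε / 2 := by
    have h1 : η ≤ ε / (2 * (L + 1)) := min_le_right _ _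
    rw [le_div_iff₀ (by positivity)] at h1
    nlinarith
  have hstay : ∀ p ∈ Metric.ball z₀ (ε / 2), ∀ u, |u| ≤ η → ψ u p ∈ Metric.ball z₀ ε := by
    intro p hp u hu
    have h1 := hψ.dist_time_le hL u 0 p
    rw [hψ.zero, Real.dist_eq, sub_zero] at h1
    have h2 : (L : ℝ) * |u| ≤ L * η := by gcongr
    rw [Metric.mem_ball] at hp ⊢
    linarith [dist_triangle (ψ u p) p z₀]
  have hNnear : {p | |N p - N z₀| < c * η / 2} ∈ 𝓝 z₀ := by
    have : Filter.Tendsto (fun p => |N p - N z₀|) (𝓝 z₀) (𝓝 |N z₀ - N z₀|) :=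
      ((N.continuous.sub continuous_const).abs).tendsto z₀
    rw [sub_self, abs_zero] at this
    exact this.eventually_lt_const (by positivity)
  refine ⟨_, Filter.inter_mem (Metric.ball_mem_nhds z₀ (half_pos hε)) hNnear, ?_⟩
  rintro p ⟨hp, hpN⟩ q ⟨hq, hqN⟩ hpq
  have hderiv : ∀ u, HasDerivAt (fun s => N (ψ s p)) (N (hamField F (ψ u p))) u := fun u =>
    N.hasFDerivAt.comp_hasDerivAt u (hψ.deriv p u)
  have hcont : Continuous fun s => N (ψ s p) := N.continuous.comp (hψ.continuous_time p)
  have hmono : ∀ s ∈ Icc (-η) η, ∀ t ∈ Icc (-η) η, s ≤ t →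
      c * (t - s) ≤ N (ψ t p) - N (ψ s p) := by
    refine (convex_Icc (-η) η).mul_sub_le_image_sub_of_le_deriv hcont.continuousOn
      (fun u _ => (hderiv u).differentiableAt.differentiableWithinAt) fun u hu => ?_
    rw [(hderiv u).deriv]
    rw [interior_Icc] at hu
    exact (hball (hstay p hp u (abs_le.2 ⟨hu.1.le, hu.2.le⟩))).2.le
  have m1 := hmono 0 ⟨by linarith, hηpos.le⟩ η ⟨by linarith, le_rfl⟩ hηpos.le
  have m2 := hmono (-η) ⟨le_rfl, by linarith⟩ 0 ⟨by linarith, hηpos.le⟩ (by linarith)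
  rw [hψ.zero] at m1 m2
  have hpN' := abs_lt.1 (show |N p - N z₀| < c * η / 2 from hpN)
  have hqN' := abs_lt.1 (show |N q - N z₀| < c * η / 2 from hqN)
  -- For times up to `η` the trajectory of `p` sweeps the values of `N` at least `c * η` to either
  -- side of `N p`; the value `N q` is nearer, both being within `c * η / 2` of `N z₀`. Equal values
  -- of `F` and `N` then identify the points.
  obtain ⟨u, hu, hup⟩ := intermediate_value_Icc (show -η ≤ η by linarith) hcont.continuousOn
    (show N q ∈ Icc (N (ψ (-η) p)) (N (ψ η p)) by constructor <;> nlinarith)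
  refine ⟨u, (abs_le.2 hu).trans (min_le_left _ _), ?_⟩
  refine hinjQ (hball (hstay p hp u (abs_le.2 hu))).1
    (hball (Metric.ball_subset_ball (by linarith) hq)).1 ?_
  simp only [Prod.mk.injEq]
  exact ⟨by rw [h.apply_hamFlow hψ, hpq], hup⟩

/-- Every level set of `F` is a single trajectory of the Hamiltonian field. -/
theorem exists_flow_eq (h : IsRegularPotential F a b) {ψ : ℝ → ℝ × ℝ → ℝ × ℝ} {K L : NNReal}
    (hψ : IsGlobalFlow (hamField F) ψ) (hK : LipschitzWith K (hamField F))
    (hL : ∀ z, ‖hamField F z‖ ≤ L) {z w : ℝ × ℝ} (hzw : F z = F w) : ∃ t, ψ t z = w := by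
  obtain ⟨φ, K', hφ, hK'⟩ := h.exists_gradFlow
  -- Every point is slid along the normalized gradient flow to the level of `z`. By the flow box,
  -- whether the result lies on the trajectory of `z` is locally constant, and the plane is
  -- connected.
  let ρ : ℝ × ℝ → ℝ × ℝ := fun v => φ (F z - F v) v
  have hρc : Continuous ρ := (hφ.continuous_uncurry hK').comp
    ((continuous_const.sub h.smooth.continuous).prodMk continuous_id)
  have hρF : ∀ v, F (ρ v) = F z := fun v => by
    simp only [ρ]; rw [h.apply_gradFlow hφ]; ring
  have hρ : ∀ v, F v = F z → ρ v = v := fun v hv => by simp [ρ, hv, hφ.zero]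
  have hloc : IsLocallyConstant fun v => ∃ t, ψ t z = ρ v := by
    rw [IsLocallyConstant.iff_eventually_eq]
    intro v₀
    obtain ⟨U, hU, hbox⟩ := h.exists_flowBox hψ hL (ρ v₀)
    filter_upwards [hρc.continuousAt hU] with v hv
    obtain ⟨u, -, hu⟩ := hbox (ρ v₀) (mem_of_mem_nhds hU) (ρ v) hv (by rw [hρF, hρF])
    refine propext ⟨fun ⟨t, ht⟩ => ⟨-u + t, ?_⟩, fun ⟨t, ht⟩ => ⟨u + t, ?_⟩⟩
    · rw [hψ.add hK, ht, ← hu, hψ.neg_apply hK]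
    · rw [hψ.add hK, ht, hu]
  have := hloc.apply_eq_of_preconnectedSpace z w
  rw [hρ z rfl, hρ w hzw.symm] at this
  exact this.mp ⟨0, hψ.zero z⟩

/-- The Hamiltonian field has no periodic trajectories in the plane. -/
theorem flow_ne_self (h : IsRegularPotential F a b) {ψ : ℝ → ℝ × ℝ → ℝ × ℝ} {K L : NNReal}
    (hψ : IsGlobalFlow (hamField F) ψ) (hK : LipschitzWith K (hamField F))
    (hL : ∀ z, ‖hamField F z‖ ≤ L) {T : ℝ} (hT : T ≠ 0) (z : ℝ × ℝ) : ψ T z ≠ z := by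
  wlog hTpos : 0 < T generalizing T
  · intro heq
    refine this (neg_ne_zero.2 hT) (by rcases hT.lt_or_gt with h | h <;> [linarith; exact absurd h hTpos]) ?_
    conv_lhs => rw [← heq]
    exact hψ.neg_apply hK T z
  intro heq
  obtain ⟨φ, K', hφ, hK'⟩ := h.exists_gradFlow
  have hper : Function.Periodic (fun t => ψ t z) T := fun t => by
    simp only; rw [hψ.add hK, heq]
  obtain ⟨C₀, hC₀, hC⟩ := h.quasi.exists_abs_sub_linear_le h.smooth.continuous
  set C := C₀ + |F z| with hCdef
  -- If the trajectory closed up, the whole level of `z` would be compact, and so would be the band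
  -- of nearby levels swept out by the gradient flow.
  have hcomp : IsCompact ((fun p : ℝ × ℝ × ℝ => φ p.1 p.2) ''
      (Icc (-C) C ×ˢ ((fun t => ψ t z) '' Icc 0 T))) :=
    (isCompact_Icc.prod (isCompact_Icc.image (hψ.continuous_time z))).image
      (hφ.continuous_uncurry hK')
  have hsub : {w | |F w - F z| ≤ C} ⊆ ((fun p : ℝ × ℝ × ℝ => φ p.1 p.2) ''
      (Icc (-C) C ×ˢ ((fun t => ψ t z) '' Icc 0 T))) := by
    intro w hw
    obtain ⟨t, ht⟩ := h.exists_flow_eq hψ hK hL (z := z) (w := φ (F z - F w) w)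
      (by rw [h.apply_gradFlow hφ]; ring)
    obtain ⟨s, hs, hst⟩ := hper.exists_mem_Ico₀ hTpos t
    refine ⟨(F w - F z, φ (F z - F w) w), ⟨abs_le.1 hw, s, Ico_subset_Icc_self hs, ?_⟩, ?_⟩
    · simp only at hst ⊢; rw [← hst, ht]
    · simp only
      rw [← hφ.add hK']
      simp [hφ.zero]
  obtain ⟨R, hR⟩ := (hcomp.isBounded.subset hsub).exists_norm_le
  have hab := h.period_sq_pos
  -- The multiples of `(-b, a)` lie in that band, because the linear part of `F` vanishes on them;
  -- they are unbounded as the periods do not both vanish.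
  have hmem : ∀ t : ℝ, |t * b| ≤ R ∧ |t * a| ≤ R := by
    intro t
    have h1 := hC (-(t * b), t * a)
    have h2 : |F (-(t * b), t * a)| ≤ C₀ := by
      convert h1 using 2
      ring
    have h3 := hR (-(t * b), t * a) (show |F (-(t * b), t * a) - F z| ≤ C from
      (abs_sub _ _).trans (by linarith))
    rw [Prod.norm_def, max_le_iff, Real.norm_eq_abs, Real.norm_eq_abs] at h3
    simpa using h3
  obtain ⟨t, ht⟩ : ∃ t : ℝ, (2 * R + 1) = t * (a ^ 2 + b ^ 2) :=
    ⟨(2 * R + 1) / (a ^ 2 + b ^ 2), by field_simp⟩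
  have hRa := hmem (t * a)
  have hRb := hmem (t * b)
  nlinarith [le_abs_self (t * a * a), le_abs_self (t * b * b)]

/-- Trajectories of the Hamiltonian field leave bounded sets, uniformly. -/
theorem exists_escape_time (h : IsRegularPotential F a b) {ψ : ℝ → ℝ × ℝ → ℝ × ℝ} {K L : NNReal}
    (hψ : IsGlobalFlow (hamField F) ψ) (hK : LipschitzWith K (hamField F))
    (hL : ∀ z, ‖hamField F z‖ ≤ L) (R : ℝ) :
    ∃ T > 0, ∀ z, ‖z‖ ≤ R → R < ‖ψ T z‖ := by
  by_contra! hcon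
  choose! z hz hψz using fun n : ℕ => hcon (n + 1) (by positivity)
  have hcomp := (isCompact_closedBall (0 : ℝ × ℝ) R).prod (isCompact_closedBall (0 : ℝ × ℝ) R)
  obtain ⟨⟨p, q⟩, -, n, hn, hlim⟩ := hcomp.tendsto_subseq
    (x := fun k => (z k, ψ (k + 1) (z k))) fun k => by simpa using ⟨hz k, hψz k⟩
  have hp : Filter.Tendsto (fun k => z (n k)) Filter.atTop (𝓝 p) :=
    (continuous_fst.tendsto _).comp hlim
  have hq : Filter.Tendsto (fun k => ψ (n k + 1) (z (n k))) Filter.atTop (𝓝 q) :=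
    (continuous_snd.tendsto _).comp hlim
  have hF : F p = F q := by
    refine tendsto_nhds_unique ((h.smooth.continuous.tendsto _).comp hp) ?_
    refine ((h.smooth.continuous.tendsto _).comp hq).congr fun k => ?_
    simp only [Function.comp_apply, h.apply_hamFlow hψ]
  obtain ⟨t, ht⟩ := h.exists_flow_eq hψ hK hL hF
  -- Moved back by `t`, the endpoints converge to `p` like the starting points, so both eventually
  -- lie in one flow box. A correction of at most 1 in time then closes up the trajectory, and `n k
  -- > |t| + 1` keeps the resulting period positive.
  have hq' : Filter.Tendsto (fun k => ψ (-t) (ψ (n k + 1) (z (n k)))) Filter.atTop (𝓝 p) := by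
    have hc : Continuous (ψ (-t)) := (hψ.continuous_uncurry hK).comp (by fun_prop : Continuous fun x => (-t, x))
    have := (hc.tendsto q).comp hq
    rwa [← ht, hψ.neg_apply hK] at this
  obtain ⟨U, hU, hbox⟩ := h.exists_flowBox hψ hL p
  obtain ⟨N, hN⟩ := exists_nat_gt (|t| + 1)
  obtain ⟨k, hk1, hk2, hk3⟩ := ((hp.eventually hU).and ((hq'.eventually hU).and
    (Filter.eventually_ge_atTop N))).exists
  obtain ⟨u, hu, hu'⟩ := hbox _ hk1 _ hk2 (by simp only [h.apply_hamFlow hψ])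
  have hnk : (N : ℝ) ≤ n k := by exact_mod_cast hk3.trans (hn.id_le k)
  refine h.flow_ne_self hψ hK hL (T := -u + (-t + (n k + 1))) ?_ (z (n k)) ?_
  · have := abs_le.1 hu
    have := le_abs_self t
    exact (by linarith : 0 < -u + (-t + ((n k : ℝ) + 1))).ne'
  · rw [hψ.add hK, hψ.add hK (-t), ← hu', hψ.neg_apply hK]

/-- After some fixed time, all trajectories have moved in the same direction along the levels. -/
theorem exists_linear_drift (h : IsRegularPotential F a b) {ψ : ℝ → ℝ × ℝ → ℝ × ℝ} {K L : NNReal}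
    (hψ : IsGlobalFlow (hamField F) ψ) (hK : LipschitzWith K (hamField F))
    (hL : ∀ z, ‖hamField F z‖ ≤ L) :
    ∃ (N : ℝ × ℝ →L[ℝ] ℝ) (T δ : ℝ), 0 < T ∧ 0 < δ ∧ ∀ z, δ ≤ N (ψ T z) - N z := by
  -- The linear coordinate transverse to the linear part `a x + b y` of `F`, hence one that measures
  -- progress along the levels.
  let N : ℝ × ℝ →L[ℝ] ℝ := a • ContinuousLinearMap.snd ℝ ℝ ℝ - b • ContinuousLinearMap.fst ℝ ℝ ℝ
  have hN : ∀ z, N z = a * z.2 - b * z.1 := fun z => by simp [N]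
  have hab := h.period_sq_pos
  obtain ⟨C, hC0, hC⟩ := h.quasi.exists_abs_sub_linear_le h.smooth.continuous
  set D := (|a| + |b|) * (2 * C) / (a ^ 2 + b ^ 2) with hD
  -- On a level, `a x + b y` is determined up to `2 * C`; if `N` is fixed too, the point is
  -- determined up to the distance `D`.
  have hclose : ∀ z w, F z = F w → N z = N w → ‖w - z‖ ≤ D := by
    intro z w hF hNzw
    have h1 := abs_le.1 (hC z)
    have h2 := abs_le.1 (hC w)
    rw [hN, hN] at hNzw
    set e := a * (w.1 - z.1) + b * (w.2 - z.2) with he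
    have hee : |e| ≤ 2 * C := abs_le.2 ⟨by rw [he]; linarith, by rw [he]; linarith⟩
    have e1 : (w.1 - z.1) * (a ^ 2 + b ^ 2) = a * e := by rw [he]; linear_combination b * hNzw
    have e2 : (w.2 - z.2) * (a ^ 2 + b ^ 2) = b * e := by rw [he]; linear_combination (-a) * hNzw
    have key : ∀ x y : ℝ, x * (a ^ 2 + b ^ 2) = y * e → |y| ≤ |a| + |b| → |x| ≤ D := by
      intro x y hxy hy
      rw [hD, le_div_iff₀ hab, ← abs_of_pos hab, ← abs_mul, hxy, abs_mul]
      gcongr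
    rw [Prod.norm_def, max_le_iff]
    exact ⟨key _ _ e1 (by linarith [abs_nonneg b]), key _ _ e2 (by linarith [abs_nonneg a])⟩
  -- Points of the unit square have norm at most 1. A trajectory from there that has left the ball
  -- of radius `1 + D` cannot have returned to its initial value of `N`.
  obtain ⟨T, hT, hesc⟩ := h.exists_escape_time hψ hK hL (1 + D)
  have hD0 : 0 ≤ D := by positivity
  have hper : IsDoublyPeriodic fun z => N (ψ T z) - N z := by
    constructor
    · intro z
      simp only [hψ.translate hK h.periodic_hamField.fst, map_add]
      ring
    · intro z
      simp only [hψ.translate hK h.periodic_hamField.snd, map_add]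
      ring
  have hcont : Continuous fun z => N (ψ T z) - N z := by
    have hc : Continuous (ψ T) := (hψ.continuous_uncurry hK).comp (by fun_prop : Continuous fun x => (T, x))
    fun_prop
  have hne : ∀ z, N (ψ T z) - N z ≠ 0 := by
    intro z hz
    obtain ⟨w, hw, m, n, rfl⟩ := exists_mem_unitSquare z
    have hz' : N (ψ T w) - N w = 0 := by rw [← hz]; exact (hper.int w m n).symm
    have h1 := norm_le_one_of_mem_unitSquare hw
    have h2 := hclose w (ψ T w) (h.apply_hamFlow hψ T w).symm (sub_eq_zero.1 hz').symm
    have h3 := hesc w (by linarith)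
    have h4 : ‖ψ T w‖ ≤ ‖ψ T w - w‖ + ‖w‖ := by
      simpa using norm_add_le (ψ T w - w) w
    linarith
  by_cases hsign : ∀ z, 0 < N (ψ T z) - N z
  · obtain ⟨δ, hδ, hle⟩ := hper.exists_pos_le hcont hsign
    exact ⟨N, T, δ, hT, hδ, hle⟩
  -- The increment never vanishes, so by the intermediate value theorem it has one sign; if it is
  -- negative, `-N` serves.
  · push Not at hsign
    obtain ⟨z₀, hz₀⟩ := hsign
    have hneg : ∀ z, 0 < -(N (ψ T z) - N z) := by
      intro z
      by_contra! hle
      obtain ⟨w, hw⟩ := mem_range_of_exists_le_of_exists_ge hcont ⟨z₀, hz₀⟩ ⟨z, by linarith⟩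
      exact hne w hw
    obtain ⟨δ, hδ, hle⟩ := IsDoublyPeriodic.exists_pos_le (f := fun z => -(N (ψ T z) - N z))
      ⟨fun z => congrArg Neg.neg (hper.fst z), fun z => congrArg Neg.neg (hper.snd z)⟩ hcont.neg hneg
    refine ⟨-N, T, δ, hT, hδ, fun z => ?_⟩
    have := hle z
    simp only [neg_apply]
    linarith

end IsRegularPotential

end Planar

/-! ### A second potential that grows along the Hamiltonian field of the first -/

section Transverse

open MeasureTheory

/-- A Lipschitz function that grows along a flow can be mollified to a smooth one whose derivative
along the generating field is positive. -/
theorem exists_smooth_of_flow_growth {W : ℝ × ℝ → ℝ × ℝ} {ψ : ℝ → ℝ × ℝ → ℝ × ℝ} {K L Λ : NNReal}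
    (hψ : IsGlobalFlow W ψ) (hK : LipschitzWith K W) (hL : ∀ z, ‖W z‖ ≤ L) {G : ℝ × ℝ → ℝ}
    {c d δ : ℝ} (hG : LipschitzWith Λ G) (hq : IsQuasiPeriodic G c d) (hδ : 0 < δ)
    (hgrow : ∀ z t, 0 ≤ t → G z + δ * t ≤ G (ψ t z)) :
    ∃ H : ℝ × ℝ → ℝ, ContDiff ℝ ∞ H ∧ IsQuasiPeriodic H c d ∧ ∀ z, 0 < fderiv ℝ H z (W z) := by
  -- The radius of the mollifier. It and the time `h₀` below are chosen so that each accounts for an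
  -- error of at most `δ / 4` per unit of time.
  set ε : ℝ := δ / (4 * (Λ * K + 1)) with hε
  have hεpos : 0 < ε := by positivity
  have hεle : Λ * K * ε ≤ δ / 4 := by
    rw [hε, mul_div_assoc', div_le_div_iff₀ (by positivity) (by norm_num)]
    nlinarith [mul_nonneg Λ.2 K.2]
  let φ : ContDiffBump (0 : ℝ × ℝ) := ⟨ε / 2, ε, half_pos hεpos, half_lt_self hεpos⟩
  set ρ := φ.normed volume with hρ
  have hρc : Continuous ρ := φ.continuous_normed
  have hρs : HasCompactSupport ρ := φ.hasCompactSupport_normed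
  have hρ0 : ∀ y, 0 ≤ ρ y := φ.nonneg_normed
  have hρ1 : ∫ y, ρ y = 1 := φ.integral_normed
  have hρi : Integrable ρ := φ.integrable_normed
  have hint : ∀ g : ℝ × ℝ → ℝ, Continuous g → Integrable fun y => ρ y * g y := fun g hg =>
    (hρc.mul hg).integrable_of_hasCompactSupport hρs.mul_right
  have hρε : ∀ y, ρ y ≠ 0 → ‖y‖ < ε := fun y hy => by
    have : y ∈ Function.support (φ.normed volume) := hy
    rw [φ.support_normed_eq] at this
    simpa using this
  set H : ℝ × ℝ → ℝ := fun z => ∫ y, ρ y * G (z - y) with hH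
  have hGc := hG.continuous
  have hint' : ∀ z, Integrable fun y => ρ y * G (z - y) := fun z => hint _ (by fun_prop)
  have hHs : ContDiff ℝ ∞ H :=
    hρs.contDiff_convolution_left (ContinuousLinearMap.mul ℝ ℝ) φ.contDiff_normed
      hGc.locallyIntegrable
  have hshift : ∀ e k, (∀ z, G (z + e) = G z + k) → ∀ z, H (z + e) = H z + k := by
    intro e k he z
    have h1 : ∀ y, ρ y * G (z + e - y) = ρ y * G (z - y) + ρ y * k := fun y => by
      rw [show z + e - y = z - y + e by abel, he]; ring
    simp only [hH, h1]
    rw [integral_add (hint' z) (hρi.mul_const k), integral_mul_const, hρ1, one_mul]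
  refine ⟨H, hHs, ⟨hshift _ _ hq.fst, hshift _ _ hq.snd⟩, fun z => ?_⟩
  set h₀ : ℝ := δ / (4 * (Λ * K * L + 1)) with hh₀
  have hh₀pos : 0 < h₀ := by positivity
  have hh₀le : Λ * K * L * h₀ ≤ δ / 4 := by
    rw [hh₀, mul_div_assoc', div_le_div_iff₀ (by positivity) (by norm_num)]
    nlinarith [mul_nonneg (mul_nonneg Λ.2 K.2) L.2]
  -- Following the flow of `z - y` for time `h` and shifting straight by `h • W z` differ by at most
  -- `K * (L * h + ε) * h`; through the Lipschitz constant of `G` this costs at most half of the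
  -- growth `δ * h`.
  have hnear : ∀ h, 0 < h → h ≤ h₀ → ∀ y, ‖y‖ < ε →
      G (z - y) + δ / 2 * h ≤ G (z + h • W z - y) := by
    intro h hh hh' y hy
    have hd : ∀ t, HasDerivAt (fun s => ψ s (z - y) - s • W z) (W (ψ t (z - y)) - W z) t := fun t =>
      by simpa using (hψ.deriv (z - y) t).fun_sub ((hasDerivAt_id t).smul_const (W z))
    have hb : ∀ t ∈ Ico 0 h, ‖W (ψ t (z - y)) - W z‖ ≤ K * (L * h + ε) := by
      intro t ht
      rw [← dist_eq_norm]
      refine (hK.dist_le_mul _ _).trans ?_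
      gcongr
      refine (dist_triangle _ (z - y) z).trans ?_
      have h1 := hψ.dist_time_le hL t 0 (z - y)
      rw [hψ.zero, Real.dist_eq, sub_zero, abs_of_nonneg ht.1] at h1
      have h2 : dist (z - y) z = ‖y‖ := by simp
      have h3 : (L : ℝ) * t ≤ L * h := by gcongr; exact ht.2.le
      linarith
    have hmv := norm_image_sub_le_of_norm_deriv_le_segment'
      (fun t _ => (hd t).hasDerivWithinAt) hb h ⟨hh.le, le_rfl⟩
    simp only [hψ.zero, zero_smul, sub_zero] at hmv
    have h4 := hG.dist_le_mul (ψ h (z - y)) (z + h • W z - y)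
    rw [dist_eq_norm (ψ h (z - y)),
      show ψ h (z - y) - (z + h • W z - y) = ψ h (z - y) - h • W z - (z - y) by abel,
      Real.dist_eq] at h4
    have h5 := (le_abs_self _).trans (h4.trans (mul_le_mul_of_nonneg_left hmv Λ.2))
    have h6 := hgrow (z - y) h hh.le
    have h7 : Λ * K * L * h ≤ δ / 4 := le_trans (by gcongr) hh₀le
    have h8 : (Λ : ℝ) * (K * (L * h + ε) * h) ≤ δ / 2 * h := by
      have : (Λ : ℝ) * (K * (L * h + ε) * h) = (Λ * K * L * h + Λ * K * ε) * h := by ring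
      rw [this]
      gcongr
      linarith
    linarith
  have hinc : ∀ h, 0 < h → h ≤ h₀ → δ / 2 ≤ h⁻¹ * (H (z + h • W z) - H z) := by
    intro h hh hh'
    have h1 : H z + δ / 2 * h ≤ H (z + h • W z) := by
      have h2 : H z + δ / 2 * h = ∫ y, ρ y * (G (z - y) + δ / 2 * h) := by
        simp only [mul_add]
        rw [integral_add (hint' z) (hρi.mul_const _), integral_mul_const, hρ1, one_mul]
      rw [h2]
      refine integral_mono (hint _ (by fun_prop)) (hint' _) fun y => ?_
      by_cases hy : ρ y = 0
      · simp [hy]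
      · exact mul_le_mul_of_nonneg_left (hnear h hh hh' y (hρε y hy)) (hρ0 y)
    rw [inv_mul_eq_div, le_div_iff₀ hh]
    linarith
  have hder : HasDerivAt (fun t : ℝ => H (z + t • W z)) (fderiv ℝ H z (W z)) 0 := by
    have h1 : HasDerivAt (fun t : ℝ => z + t • W z) (W z) 0 := by
      simpa using ((hasDerivAt_id (0 : ℝ)).smul_const (W z)).const_add z
    have h2 : HasFDerivAt H (fderiv ℝ H z) (z + (0 : ℝ) • W z) := by
      simpa using ((hHs.differentiable (by simp)).differentiableAt (x := z)).hasFDerivAt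
    exact h2.comp_hasDerivAt 0 h1
  have hlim := hder.tendsto_slope_zero_right
  have : δ / 2 ≤ fderiv ℝ H z (W z) := by
    refine ge_of_tendsto hlim ?_
    filter_upwards [Ioc_mem_nhdsGT hh₀pos] with h hh
    simpa using hinc h hh.1 hh.2
  linarith

namespace IsRegularPotential

variable {F G : ℝ × ℝ → ℝ} {a b c d : ℝ}

/-- Integrate the drifting linear function `N` along trajectories over the time `T`. Along the flow
this average changes at the rate `N (ψ T z) - N z ≥ δ`, and it inherits constant gains from the
equivariance of the flow. Grönwall's inequality makes it Lipschitz, which is enough for the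
mollification. -/
theorem exists_transverse (h : IsRegularPotential F a b) :
    ∃ (G : ℝ × ℝ → ℝ) (c d : ℝ), ContDiff ℝ ∞ G ∧ IsQuasiPeriodic G c d ∧
      ∀ z, 0 < fderiv ℝ G z (hamField F z) := by
  obtain ⟨ψ, K, L, hψ, hK, hL⟩ := h.exists_hamFlow
  obtain ⟨N, T, δ, hT, hδ, hdrift⟩ := h.exists_linear_drift hψ hK hL
  have hcN : ∀ z, Continuous fun t => N (ψ t z) := fun z =>
    N.continuous.comp (hψ.continuous_time z)
  have hshift : ∀ e, (∀ z, hamField F (z + e) = hamField F z) → ∀ z,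
      (∫ t in (0 : ℝ)..T, N (ψ t (z + e))) = (∫ t in (0 : ℝ)..T, N (ψ t z)) + T * N e := by
    intro e he z
    simp only [hψ.translate hK he, map_add]
    rw [intervalIntegral.integral_add ((hcN z).intervalIntegrable _ _)
      (intervalIntegrable_const), intervalIntegral.integral_const]
    simp
  have hLip : LipschitzWith (‖N‖ * Real.exp (K * T) * T).toNNReal
      fun z => ∫ t in (0 : ℝ)..T, N (ψ t z) := by
    refine LipschitzWith.of_dist_le_mul fun z w => ?_
    rw [Real.coe_toNNReal _ (by positivity), Real.dist_eq,
      ← intervalIntegral.integral_sub ((hcN z).intervalIntegrable _ _)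
      ((hcN w).intervalIntegrable _ _), ← Real.norm_eq_abs]
    have := intervalIntegral.norm_integral_le_of_norm_le_const (a := 0) (b := T)
      (f := fun t => N (ψ t z) - N (ψ t w)) (C := ‖N‖ * (dist z w * Real.exp (K * T))) ?_
    · rw [sub_zero, abs_of_pos hT] at this
      exact this.trans (le_of_eq (by ring))
    · intro t ht
      rw [uIoc_of_le hT.le] at ht
      rw [← map_sub]
      refine (N.le_opNorm _).trans ?_
      rw [← dist_eq_norm]
      have h1 := hψ.dist_le_of_nonneg hK ht.1.le z w
      have h2 : (K : ℝ) * t ≤ K * T := by gcongr; exact ht.2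
      gcongr
      exact h1.trans (by gcongr)
  have hgrow : ∀ z t, 0 ≤ t → (∫ s in (0 : ℝ)..T, N (ψ s z)) + δ * t ≤
      ∫ s in (0 : ℝ)..T, N (ψ s (ψ t z)) := by
    intro z t ht
    have h1 : (∫ s in (0 : ℝ)..T, N (ψ s (ψ t z))) = ∫ s in t..T + t, N (ψ s z) := by
      simp only [← hψ.add hK]
      rw [intervalIntegral.integral_comp_add_right (fun s => N (ψ s z))]
      simp
    have hi : ∀ x y, IntervalIntegrable (fun s => N (ψ s z)) volume x y := fun x y =>
      (hcN z).intervalIntegrable _ _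
    have h2 : (∫ s in t..T + t, N (ψ s z)) - ∫ s in (0 : ℝ)..T, N (ψ s z)
        = ∫ s in (0 : ℝ)..t, (N (ψ (s + T) z) - N (ψ s z)) := by
      rw [intervalIntegral.integral_sub (by
        simp only [hψ.add hK]
        exact ((hcN z).comp (continuous_add_const T) |>.congr fun s => by
          simp only [Function.comp, hψ.add hK]).intervalIntegrable _ _) (hi _ _),
        intervalIntegral.integral_comp_add_right (fun s => N (ψ s z)), zero_add,
        add_comm t T]
      have e1 := intervalIntegral.integral_add_adjacent_intervals (hi 0 t) (hi t (T + t))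
      have e2 := intervalIntegral.integral_add_adjacent_intervals (hi 0 T) (hi T (T + t))
      linarith
    have h3 : δ * t ≤ ∫ s in (0 : ℝ)..t, (N (ψ (s + T) z) - N (ψ s z)) := by
      have := intervalIntegral.integral_mono_on (a := 0) (b := t) (f := fun _ => δ)
        (g := fun s => N (ψ (s + T) z) - N (ψ s z)) (μ := volume) ht intervalIntegrable_const
        ((((hcN z).comp (continuous_add_const T)).sub (hcN z)).intervalIntegrable _ _)
        (fun s _ => by rw [add_comm s T, hψ.add hK]; exact hdrift _)
      simpa [mul_comm] using this
    linarith
  obtain ⟨H, hH, hHq, hHpos⟩ := exists_smooth_of_flow_growth hψ hK hL hLip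
    ⟨hshift _ h.periodic_hamField.fst, hshift _ h.periodic_hamField.snd⟩ hδ hgrow
  exact ⟨H, _, _, hH, hHq, hHpos⟩

/-- A potential together with one that grows along its Hamiltonian field are global coordinates. -/
theorem existsUnique_coordinates (h : IsRegularPotential F a b) (hG : ContDiff ℝ ∞ G)
    (hq : IsQuasiPeriodic G c d) (hpos : ∀ z, 0 < fderiv ℝ G z (hamField F z)) (f g : ℝ) :
    ∃! z, F z = f ∧ G z = g := by
  obtain ⟨ψ, K, L, hψ, hK, hL⟩ := h.exists_hamFlow
  have hper : IsDoublyPeriodic fun z => fderiv ℝ G z (hamField F z) :=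
    ⟨fun z => by simp only [hq.fderiv.fst z, h.periodic_hamField.fst z],
      fun z => by simp only [hq.fderiv.snd z, h.periodic_hamField.snd z]⟩
  obtain ⟨δ, hδ, hle⟩ := hper.exists_pos_le
    ((hG.continuous_fderiv (by simp)).clm_apply h.contDiff_hamField.continuous) hpos
  have hinc : ∀ z s t, s ≤ t → δ * (t - s) ≤ G (ψ t z) - G (ψ s z) := by
    intro z s t hst
    refine mul_sub_le_image_sub_of_le_deriv
      (fun t => (hasDerivAt_comp_flow hG hψ t z).differentiableAt) (fun t => ?_) hst
    rw [(hasDerivAt_comp_flow hG hψ t z).deriv]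
    exact hle _
  obtain ⟨z₀, hz₀⟩ := h.surjective f
  have hcont : Continuous fun t => G (ψ t z₀) := hG.continuous.comp (hψ.continuous_time z₀)
  -- On the level `f`, which is one trajectory, `G` increases at a rate of at least `δ`, so it
  -- reaches `g` within time `|g - G z₀| / δ` in one direction or the other.
  obtain ⟨t, ht⟩ : ∃ t, G (ψ t z₀) = g := by
    refine mem_range_of_exists_le_of_exists_ge hcont
      ⟨-(|g - G z₀| / δ), ?_⟩ ⟨|g - G z₀| / δ, ?_⟩
    · have := hinc z₀ (-(|g - G z₀| / δ)) 0 (by simp; positivity)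
      rw [hψ.zero, zero_sub, neg_neg, mul_div_cancel₀ _ hδ.ne'] at this
      linarith [neg_abs_le (g - G z₀)]
    · have := hinc z₀ 0 (|g - G z₀| / δ) (by positivity)
      rw [hψ.zero, sub_zero, mul_div_cancel₀ _ hδ.ne'] at this
      linarith [le_abs_self (g - G z₀)]
  have hstrict : ∀ z s, G (ψ s z) = G z → s = 0 := by
    intro z s hs
    rcases le_total 0 s with h0 | h0
    · have := hinc z 0 s h0
      rw [hψ.zero] at this
      nlinarith
    · have := hinc z s 0 h0
      rw [hψ.zero] at this
      nlinarith
  refine ⟨ψ t z₀, ⟨by rw [h.apply_hamFlow hψ, hz₀], ht⟩, ?_⟩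
  rintro w ⟨hwF, hwG⟩
  obtain ⟨s, hs⟩ := h.exists_flow_eq hψ hK hL (z := ψ t z₀) (w := w)
    (by rw [h.apply_hamFlow hψ, hz₀, hwF])
  have := hstrict (ψ t z₀) s (by rw [hs, ht, hwG])
  rw [← hs, this, hψ.zero]

/-- The periods of a potential and of one growing along its Hamiltonian field are positively
oriented, by integration over the unit square. -/
theorem det_periods_pos (hF : ContDiff ℝ ∞ F) (hqF : IsQuasiPeriodic F a b) (hG : ContDiff ℝ ∞ G)
    (hq : IsQuasiPeriodic G c d) (hpos : ∀ z, 0 < fderiv ℝ G z (hamField F z)) :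
    0 < b * c - a * d := by
  have hFd : ∀ z, HasFDerivAt F (fderiv ℝ F z) z := fun z =>
    (hF.differentiable (by simp)).differentiableAt.hasFDerivAt
  have hdG : ∀ v, ContDiff ℝ ∞ fun z => fderiv ℝ G z v := fun v => contDiff_fderiv_apply hG v
  have hdF : ∀ v, ContDiff ℝ ∞ fun z => fderiv ℝ F z v := fun v => contDiff_fderiv_apply hF v
  have hGd : ∀ v z, HasFDerivAt (fun z => fderiv ℝ G z v) ((fderiv ℝ (fderiv ℝ G) z).flip v) z := by
    intro v z
    have h1 : HasFDerivAt (fderiv ℝ G) (fderiv ℝ (fderiv ℝ G) z) z :=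
      ((hG.fderiv_right (m := ∞) (by simp)).differentiable (by simp)).differentiableAt.hasFDerivAt
    exact (h1.clm_apply (hasFDerivAt_const v z)).congr_fderiv (by ext <;> simp)
  have hsymm : ∀ z, fderiv ℝ (fderiv ℝ G) z (1, 0) (0, 1) = fderiv ℝ (fderiv ℝ G) z (0, 1) (1, 0) :=
    fun z => ((contDiff_infty.1 hG 2).contDiffAt.isSymmSndFDerivAt (by simp)) _ _
  set J : ℝ × ℝ → ℝ := fun z => fderiv ℝ G z (hamField F z) with hJ
  have hJe : ∀ z, -J z = fderiv ℝ F z (1, 0) * fderiv ℝ G z (0, 1)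
      - fderiv ℝ F z (0, 1) * fderiv ℝ G z (1, 0) := by
    intro z
    simp only [hJ]
    rw [ContinuousLinearMap.apply_pair]
    simp only [hamField]
    ring
  have hJc : Continuous J := by
    have : J = fun z => -(fderiv ℝ F z (1, 0) * fderiv ℝ G z (0, 1)
      - fderiv ℝ F z (0, 1) * fderiv ℝ G z (1, 0)) := funext fun z => by rw [← hJe, neg_neg]
    rw [this]
    have := (hdG (1, 0)).continuous
    have := (hdG (0, 1)).continuous
    have := (hdF (1, 0)).continuous
    have := (hdF (0, 1)).continuous
    fun_prop
  -- This is Stokes' theorem for `F dG`: the second derivatives of `G` cancel in the divergence,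
  -- leaving `-J`, and opposite sides of the square differ by `a` or `b` times a period of `G`.
  have hdiv := integral2_divergence_prod_of_hasFDerivAt
    (fun z => F z * fderiv ℝ G z (0, 1)) (fun z => -(F z * fderiv ℝ G z (1, 0)))
    (fun z => F z • (fderiv ℝ (fderiv ℝ G) z).flip (0, 1) + fderiv ℝ G z (0, 1) • fderiv ℝ F z)
    (fun z => -(F z • (fderiv ℝ (fderiv ℝ G) z).flip (1, 0) + fderiv ℝ G z (1, 0) • fderiv ℝ F z))
    0 0 1 1
    (hF.continuous.mul (hdG _).continuous).continuousOn
    (hF.continuous.mul (hdG _).continuous).neg.continuousOn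
    (fun z _ => (hFd z).mul (hGd _ z)) (fun z _ => ((hFd z).mul (hGd _ z)).neg)
  have hint : ∀ z : ℝ × ℝ, (F z • (fderiv ℝ (fderiv ℝ G) z).flip (0, 1)
      + fderiv ℝ G z (0, 1) • fderiv ℝ F z) (1, 0)
      + (-(F z • (fderiv ℝ (fderiv ℝ G) z).flip (1, 0) + fderiv ℝ G z (1, 0) • fderiv ℝ F z)) (0, 1)
      = -J z := by
    intro z
    rw [hJe]
    simp only [add_apply, neg_apply, smul_apply, ContinuousLinearMap.flip_apply, smul_eq_mul, hsymm]
    ring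
  simp only [hint] at hdiv
  specialize hdiv (hJc.neg.continuousOn.integrableOn_compact (isCompact_uIcc.prod isCompact_uIcc))
  have hF1 : ∀ y, F (1, y) = F (0, y) + a := fun y => by simpa using hqF.fst (0, y)
  have hF2 : ∀ x, F (x, 1) = F (x, 0) + b := fun x => by simpa using hqF.snd (x, 0)
  have hG1 : ∀ y, fderiv ℝ G (1, y) = fderiv ℝ G (0, y) := fun y => by simpa using hq.fderiv.fst (0, y)
  have hG2 : ∀ x, fderiv ℝ G (x, 1) = fderiv ℝ G (x, 0) := fun x => by simpa using hq.fderiv.snd (x, 0)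
  have ic : ∀ f : ℝ → ℝ, Continuous f → IntervalIntegrable f volume 0 1 := fun f hf =>
    hf.intervalIntegrable _ _
  have cx : ∀ v, Continuous fun x : ℝ => fderiv ℝ G (x, 0) v := fun v =>
    (hdG v).continuous.comp (by fun_prop : Continuous fun x : ℝ => (x, (0 : ℝ)))
  have cy : ∀ v, Continuous fun y : ℝ => fderiv ℝ G (0, y) v := fun v =>
    (hdG v).continuous.comp (by fun_prop : Continuous fun y : ℝ => ((0 : ℝ), y))
  have fx : Continuous fun x : ℝ => F (x, 0) := hF.continuous.comp (by fun_prop)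
  have fy : Continuous fun y : ℝ => F (0, y) := hF.continuous.comp (by fun_prop)
  simp only [hF1, hF2, hG1, hG2, add_mul, neg_add] at hdiv
  have cx' := cx (1, 0)
  have cy' := cy (0, 1)
  rw [intervalIntegral.integral_add (ic _ (by fun_prop)) (ic _ (by fun_prop)),
    intervalIntegral.integral_add (ic _ (by fun_prop)) (ic _ (by fun_prop))] at hdiv
  have i1 : ∫ y in (0 : ℝ)..1, fderiv ℝ G (0, y) (0, 1) = d := by
    have hd : ∀ y ∈ uIcc (0 : ℝ) 1, HasDerivAt (fun y : ℝ => G (0, y)) (fderiv ℝ G (0, y) (0, 1)) y :=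
      fun y _ => ((hG.differentiable (by simp)).differentiableAt.hasFDerivAt).comp_hasDerivAt y
        ((hasDerivAt_const y (0 : ℝ)).prodMk (hasDerivAt_id y))
    rw [intervalIntegral.integral_eq_sub_of_hasDerivAt hd (ic _ (cy _))]
    have := hq.snd (0, 0)
    simp only [Prod.mk_add_mk, zero_add, add_zero] at this
    linarith
  have i2 : ∫ x in (0 : ℝ)..1, fderiv ℝ G (x, 0) (1, 0) = c := by
    have hd : ∀ x ∈ uIcc (0 : ℝ) 1, HasDerivAt (fun x : ℝ => G (x, 0)) (fderiv ℝ G (x, 0) (1, 0)) x :=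
      fun x _ => ((hG.differentiable (by simp)).differentiableAt.hasFDerivAt).comp_hasDerivAt x
        ((hasDerivAt_id x).prodMk (hasDerivAt_const x (0 : ℝ)))
    rw [intervalIntegral.integral_eq_sub_of_hasDerivAt hd (ic _ (cx _))]
    have := hq.fst (0, 0)
    simp only [Prod.mk_add_mk, zero_add, add_zero] at this
    linarith
  simp only [intervalIntegral.integral_neg, intervalIntegral.integral_const_mul, i1, i2] at hdiv
  have hJpos : 0 < ∫ x in (0 : ℝ)..1, ∫ y in (0 : ℝ)..1, J (x, y) := by
    refine intervalIntegral.intervalIntegral_pos_of_pos (ic _ ?_) (fun x => ?_) one_pos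
    · exact intervalIntegral.continuous_parametric_intervalIntegral_of_continuous' (by fun_prop) _ _
    · refine intervalIntegral.intervalIntegral_pos_of_pos (ic _ (by fun_prop)) (fun y => hpos _) one_pos
  linarith

end IsRegularPotential

end Transverse

/-! ### Smooth dependence of integrals on parameters in a convex set -/

section ParametricIntegral

variable {E : Type} [NormedAddCommGroup E]

theorem continuousOn_parametric_integral {G : Type} [NormedAddCommGroup G] [NormedSpace ℝ G]
    {s : Set E} {f : E × ℝ → G}
    (hf : ContinuousOn f (s ×ˢ Icc (0 : ℝ) 1)) :
    ContinuousOn (fun z => ∫ t in (0 : ℝ)..1, f (z, t)) s := by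
  have hslice : ∀ z ∈ s, ContinuousOn (fun t => f (z, t)) (uIcc 0 1) := fun z hz => by
    rw [uIcc_of_le zero_le_one]
    exact hf.comp (by fun_prop) fun t ht => ⟨hz, ht⟩
  intro z₀ hz₀
  rw [ContinuousWithinAt, Metric.tendsto_nhds]
  intro ε hε
  obtain ⟨v, hv, hvε⟩ := (isCompact_Icc (a := (0 : ℝ)) (b := 1)).mem_uniformity_of_prod
    (f := fun z t => f (z, t)) hf hz₀ (Metric.dist_mem_uniformity (half_pos hε))
  filter_upwards [hv, self_mem_nhdsWithin] with z hz hzs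
  rw [dist_eq_norm, ← intervalIntegral.integral_sub (hslice z hzs).intervalIntegrable
    (hslice z₀ hz₀).intervalIntegrable]
  refine (intervalIntegral.norm_integral_le_of_norm_le_const (C := ε / 2) fun t ht => ?_).trans_lt ?_
  · rw [uIoc_of_le zero_le_one] at ht
    rw [← dist_eq_norm]
    exact (hvε z hz t (Ioc_subset_Icc_self ht)).le
  · norm_num
    linarith

variable [NormedSpace ℝ E]

/-- Compactness of the interval makes the derivatives at nearby parameters close to those at `z₀`
uniformly in `t`. The mean value inequality on the convex set `s ∩ ball z₀ δ` turns this into a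
uniform first-order estimate, which is then integrated. -/
theorem hasFDerivWithinAt_parametric_integral {G : Type} [NormedAddCommGroup G] [NormedSpace ℝ G]
    [CompleteSpace G] {s : Set E} (hs : Convex ℝ s) {f : E × ℝ → G} {f' : E × ℝ → E →L[ℝ] G}
    (hf : ContinuousOn f (s ×ˢ Icc (0 : ℝ) 1)) (hf' : ContinuousOn f' (s ×ˢ Icc (0 : ℝ) 1))
    (hd : ∀ z ∈ s, ∀ t ∈ Icc (0 : ℝ) 1, HasFDerivWithinAt (fun z => f (z, t)) (f' (z, t)) s z)
    {z₀ : E} (hz₀ : z₀ ∈ s) :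
    HasFDerivWithinAt (fun z => ∫ t in (0 : ℝ)..1, f (z, t)) (∫ t in (0 : ℝ)..1, f' (z₀, t)) s z₀ := by
  have hslice : ∀ z ∈ s, ContinuousOn (fun t => f (z, t)) (uIcc 0 1) := fun z hz => by
    rw [uIcc_of_le zero_le_one]
    exact hf.comp (by fun_prop) fun t ht => ⟨hz, ht⟩
  have hslice' : ContinuousOn (fun t => f' (z₀, t)) (uIcc 0 1) := by
    rw [uIcc_of_le zero_le_one]
    exact hf'.comp (by fun_prop) fun t ht => ⟨hz₀, ht⟩
  rw [hasFDerivWithinAt_iff_isLittleO, Asymptotics.isLittleO_iff]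
  intro ε hε
  obtain ⟨v, hv, hvε⟩ := (isCompact_Icc (a := (0 : ℝ)) (b := 1)).mem_uniformity_of_prod
    (f := fun z t => f' (z, t)) hf' hz₀ (Metric.dist_mem_uniformity hε)
  obtain ⟨δ, hδ, hball⟩ := Metric.mem_nhdsWithin_iff.1 hv
  filter_upwards [inter_mem_nhdsWithin s (Metric.ball_mem_nhds z₀ hδ)] with z hz
  have happ : (∫ t in (0 : ℝ)..1, f' (z₀, t)) (z - z₀) = ∫ t in (0 : ℝ)..1, f' (z₀, t) (z - z₀) :=
    (ContinuousLinearMap.intervalIntegral_apply hslice'.intervalIntegrable _)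
  rw [happ, ← intervalIntegral.integral_sub (hslice z hz.1).intervalIntegrable
    (hslice z₀ hz₀).intervalIntegrable, ← intervalIntegral.integral_sub
    ((hslice z hz.1).fun_sub (hslice z₀ hz₀)).intervalIntegrable
    (hslice'.clm_apply continuousOn_const).intervalIntegrable]
  refine (intervalIntegral.norm_integral_le_of_norm_le_const (C := ε * ‖z - z₀‖) fun t ht => ?_).trans
    (by norm_num)
  rw [uIoc_of_le zero_le_one] at ht
  have ht' := Ioc_subset_Icc_self ht
  refine (hs.inter (convex_ball z₀ δ)).norm_image_sub_le_of_norm_hasFDerivWithin_le'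
    (fun w hw => (hd w hw.1 t ht').mono inter_subset_left) (fun w hw => ?_)
    ⟨hz₀, Metric.mem_ball_self hδ⟩ hz
  rw [← dist_eq_norm]
  exact (hvε w (hball ⟨hw.2, hw.1⟩) t ht').le

theorem hasFDerivWithinAt_slice {G : Type} [NormedAddCommGroup G] [NormedSpace ℝ G]
    {s : Set E} {f : E × ℝ → G} {z : E} {t : ℝ} (ht : t ∈ Icc (0 : ℝ) 1)
    (hf : DifferentiableWithinAt ℝ f (s ×ˢ Icc (0 : ℝ) 1) (z, t)) :
    HasFDerivWithinAt (fun z => f (z, t))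
      ((fderivWithin ℝ f (s ×ˢ Icc (0 : ℝ) 1) (z, t)).comp (ContinuousLinearMap.inl ℝ E ℝ)) s z :=
  hf.hasFDerivWithinAt.comp z
    (((hasFDerivAt_id z).prodMk (hasFDerivAt_const t z)).hasFDerivWithinAt.congr_fderiv
      (by ext <;> simp)) (fun _ hw => mk_mem_prod hw ht)

/-- Induction by differentiating under the integral. The target space is quantified inside the
induction, since the derivative takes values in another space. -/
theorem contDiffOn_nat_parametric_integral {s : Set E} (hs : Convex ℝ s) (hu : UniqueDiffOn ℝ s)
    (n : ℕ) : ∀ {G : Type} [NormedAddCommGroup G] [NormedSpace ℝ G] [CompleteSpace G]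
    {f : E × ℝ → G}, ContDiffOn ℝ n f (s ×ˢ Icc (0 : ℝ) 1) →
    ContDiffOn ℝ n (fun z => ∫ t in (0 : ℝ)..1, f (z, t)) s := by
  induction n with
  | zero =>
    intro G _ _ _ f hf
    exact contDiffOn_zero.2 (continuousOn_parametric_integral hf.continuousOn)
  | succ n ih =>
    intro G _ _ _ f hf
    have hu' : UniqueDiffOn ℝ (s ×ˢ Icc (0 : ℝ) 1) := hu.prod (uniqueDiffOn_Icc zero_lt_one)
    have hf1 : ContDiffOn ℝ n (fun p => (fderivWithin ℝ f (s ×ˢ Icc (0 : ℝ) 1) p).comp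
        (ContinuousLinearMap.inl ℝ E ℝ)) (s ×ˢ Icc (0 : ℝ) 1) :=
      (hf.fderivWithin hu' (by push_cast; rfl)).clm_comp contDiffOn_const
    push_cast
    rw [contDiffOn_succ_iff_hasFDerivWithinAt_of_uniqueDiffOn hu]
    refine ⟨by simp, _, ih hf1, fun z hz => ?_⟩
    refine hasFDerivWithinAt_parametric_integral hs hf.continuousOn hf1.continuousOn
      (fun z hz t ht => ?_) hz
    exact hasFDerivWithinAt_slice ht (hf.differentiableOn (by simp) _ ⟨hz, ht⟩)

theorem contDiffOn_parametric_integral {s : Set E} (hs : Convex ℝ s) (hu : UniqueDiffOn ℝ s)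
    {G : Type} [NormedAddCommGroup G] [NormedSpace ℝ G] [CompleteSpace G]
    {f : E × ℝ → G} (hf : ContDiffOn ℝ ∞ f (s ×ˢ Icc (0 : ℝ) 1)) :
    ContDiffOn ℝ ∞ (fun z => ∫ t in (0 : ℝ)..1, f (z, t)) s := by
  rw [contDiffOn_infty] at hf ⊢
  exact fun n => contDiffOn_nat_parametric_integral hs hu n (hf n)

end ParametricIntegral

/-! ### Potentials of families of closed one-forms on the torus -/

section Family

open PartialSections

theorem convex_slab : Convex ℝ slab := by
  have : slab = univ ×ˢ (univ ×ˢ Icc (0 : ℝ) 1) := by ext ⟨x, y, r⟩; simp [slab]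
  rw [this]
  exact convex_univ.prod (convex_univ.prod (convex_Icc 0 1))

theorem interior_slab : interior slab = {q : ℝ × ℝ × ℝ | q.2.2 ∈ Ioo (0 : ℝ) 1} := by
  have h1 : slab = univ ×ˢ (univ ×ˢ Icc (0 : ℝ) 1) := by ext ⟨x, y, r⟩; simp [slab]
  rw [h1, interior_prod_eq, interior_prod_eq, interior_univ, interior_Icc]
  ext ⟨x, y, r⟩
  simp

theorem uniqueDiffOn_slab : UniqueDiffOn ℝ slab :=
  uniqueDiffOn_convex convex_slab ⟨(0, 0, 1 / 2), by rw [interior_slab]; norm_num⟩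

theorem isClosed_slab : IsClosed slab :=
  isClosed_Icc.preimage (by fun_prop : Continuous fun q : ℝ × ℝ × ℝ => q.2.2)

/-- The inclusion of the plane at height `r`. -/
def atHeight (r : ℝ) (z : ℝ × ℝ) : ℝ × ℝ × ℝ := (z.1, z.2, r)

/-- The differential of `atHeight`. -/
def horizontal : ℝ × ℝ →L[ℝ] ℝ × ℝ × ℝ :=
  (ContinuousLinearMap.fst ℝ ℝ ℝ).prod ((ContinuousLinearMap.snd ℝ ℝ ℝ).prod 0)

theorem horizontal_apply (v : ℝ × ℝ) : horizontal v = (v.1, v.2, 0) := rfl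

theorem hasFDerivAt_atHeight (r : ℝ) (z : ℝ × ℝ) : HasFDerivAt (atHeight r) horizontal z :=
  hasFDerivAt_fst.prodMk (hasFDerivAt_snd.prodMk (hasFDerivAt_const r z))

theorem contDiff_atHeight (r : ℝ) : ContDiff ℝ ∞ (atHeight r) :=
  contDiff_fst.prodMk (contDiff_snd.prodMk contDiff_const)

theorem atHeight_mem {r : ℝ} (hr : r ∈ Icc (0 : ℝ) 1) (z : ℝ × ℝ) : atHeight r z ∈ slab := hr

theorem contDiff_comp_atHeight {f : ℝ × ℝ × ℝ → ℝ} (hf : ContDiffOn ℝ ∞ f slab) {r : ℝ}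
    (hr : r ∈ Icc (0 : ℝ) 1) : ContDiff ℝ ∞ (f ∘ atHeight r) :=
  hf.comp_contDiff (contDiff_atHeight r) (atHeight_mem hr)

theorem fderiv_comp_atHeight {f : ℝ × ℝ × ℝ → ℝ} (hf : ContDiffOn ℝ ∞ f slab) {r : ℝ}
    (hr : r ∈ Icc (0 : ℝ) 1) (z : ℝ × ℝ) :
    fderiv ℝ (f ∘ atHeight r) z = (fderivWithin ℝ f slab (atHeight r z)).comp horizontal := by
  have h1 := (hf.differentiableOn (by simp) _ (atHeight_mem hr z)).hasFDerivWithinAt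
  exact (h1.comp_hasFDerivAt z (hasFDerivAt_atHeight r z)
    (Filter.Eventually.of_forall (atHeight_mem hr))).fderiv

/-- Families `P dx + Q dy`, parametrized by the height `r`, of nowhere vanishing closed one-forms
on the torus. -/
structure IsClosedFamily (P Q : ℝ × ℝ × ℝ → ℝ) : Prop where
  smooth_fst : ContDiffOn ℝ ∞ P slab
  smooth_snd : ContDiffOn ℝ ∞ Q slab
  periodic_fst : ∀ r ∈ Icc (0 : ℝ) 1, IsDoublyPeriodic (P ∘ atHeight r)
  periodic_snd : ∀ r ∈ Icc (0 : ℝ) 1, IsDoublyPeriodic (Q ∘ atHeight r)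
  closed : ∀ q ∈ slab, fderivWithin ℝ P slab q (0, 1, 0) = fderivWithin ℝ Q slab q (1, 0, 0)
  ne_zero : ∀ q ∈ slab, P q ≠ 0 ∨ Q q ≠ 0

namespace IsClosedFamily

variable {P Q : ℝ × ℝ × ℝ → ℝ}

/-- The points of the slab over the segment from the vertical axis. -/
def shrink (p : (ℝ × ℝ × ℝ) × ℝ) : ℝ × ℝ × ℝ := (p.2 * p.1.1, p.2 * p.1.2.1, p.1.2.2)

theorem contDiff_shrink : ContDiff ℝ ∞ shrink := by unfold shrink; fun_prop

/-- The Poincaré lemma along horizontal rays: `F` is the integral over `t` in `[0, 1]` of `x P + y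
Q` at `(t x, t y, r)`. The height is a mere parameter, so `F` is smooth on the slab up to its
boundary. -/
theorem exists_primitive (h : IsClosedFamily P Q) : ∃ F : ℝ × ℝ × ℝ → ℝ, ContDiffOn ℝ ∞ F slab ∧
    ∀ r ∈ Icc (0 : ℝ) 1, ∀ z, fderiv ℝ (F ∘ atHeight r) z (1, 0) = P (atHeight r z) ∧
      fderiv ℝ (F ∘ atHeight r) z (0, 1) = Q (atHeight r z) := by
  set f : (ℝ × ℝ × ℝ) × ℝ → ℝ := fun p => p.1.1 * P (shrink p) + p.1.2.1 * Q (shrink p) with hf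
  have hmaps : MapsTo shrink (slab ×ˢ Icc (0 : ℝ) 1) slab := fun p hp => hp.1
  have hfs : ContDiffOn ℝ ∞ f (slab ×ˢ Icc (0 : ℝ) 1) := by
    have h1 := h.smooth_fst.comp contDiff_shrink.contDiffOn hmaps
    have h2 := h.smooth_snd.comp contDiff_shrink.contDiffOn hmaps
    have e1 : ContDiff ℝ ∞ fun p : (ℝ × ℝ × ℝ) × ℝ => p.1.1 := by fun_prop
    have e2 : ContDiff ℝ ∞ fun p : (ℝ × ℝ × ℝ) × ℝ => p.1.2.1 := by fun_prop
    exact (e1.contDiffOn.mul h1).add (e2.contDiffOn.mul h2)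
  have hFs := contDiffOn_parametric_integral convex_slab uniqueDiffOn_slab hfs
  refine ⟨_, hFs, fun r hr => ?_⟩
  set F : ℝ × ℝ × ℝ → ℝ := fun q => ∫ t in (0 : ℝ)..1, f (q, t) with hF
  set p : ℝ × ℝ → ℝ := P ∘ atHeight r with hp
  set q : ℝ × ℝ → ℝ := Q ∘ atHeight r with hq
  have hps : ContDiff ℝ ∞ p := contDiff_comp_atHeight h.smooth_fst hr
  have hqs : ContDiff ℝ ∞ q := contDiff_comp_atHeight h.smooth_snd hr
  have hpd : ∀ z, HasFDerivAt p (fderiv ℝ p z) z := fun z =>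
    (hps.differentiable (by simp)).differentiableAt.hasFDerivAt
  have hqd : ∀ z, HasFDerivAt q (fderiv ℝ q z) z := fun z =>
    (hqs.differentiable (by simp)).differentiableAt.hasFDerivAt
  have hclosed : ∀ z, fderiv ℝ p z (0, 1) = fderiv ℝ q z (1, 0) := fun z => by
    rw [hp, hq, fderiv_comp_atHeight h.smooth_fst hr, fderiv_comp_atHeight h.smooth_snd hr]
    exact h.closed _ (atHeight_mem hr z)
  let g : (ℝ × ℝ) × ℝ → ℝ := fun w => w.1.1 * p (w.2 • w.1) + w.1.2 * q (w.2 • w.1)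
  let g' : (ℝ × ℝ) × ℝ → ℝ × ℝ →L[ℝ] ℝ := fun w =>
    (w.1.1 • (w.2 • fderiv ℝ p (w.2 • w.1)) + p (w.2 • w.1) • ContinuousLinearMap.fst ℝ ℝ ℝ) +
    (w.1.2 • (w.2 • fderiv ℝ q (w.2 • w.1)) + q (w.2 • w.1) • ContinuousLinearMap.snd ℝ ℝ ℝ)
  have hpc := hps.continuous
  have hqc := hqs.continuous
  have hpc' := hps.continuous_fderiv (by simp)
  have hqc' := hqs.continuous_fderiv (by simp)
  have hg : Continuous g := by fun_prop
  have hg' : Continuous g' := by fun_prop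
  have hgd : ∀ z t, HasFDerivAt (fun z => g (z, t)) (g' (z, t)) z := by
    intro z t
    have hsc : HasFDerivAt (fun z : ℝ × ℝ => t • z) (t • ContinuousLinearMap.id ℝ (ℝ × ℝ)) z :=
      (hasFDerivAt_id z).const_smul t
    have h1 := (hpd (t • z)).comp z hsc
    have h2 := (hqd (t • z)).comp z hsc
    refine ((hasFDerivAt_fst.fun_mul h1).fun_add (hasFDerivAt_snd.fun_mul h2)).congr_fderiv ?_
    simp only [g', Function.comp_apply]
    ext <;> simp
  have hFr : F ∘ atHeight r = fun z => ∫ t in (0 : ℝ)..1, g (z, t) := by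
    ext z
    simp only [hF, Function.comp_apply, hf, g, hp, hq, shrink, atHeight, Prod.smul_fst,
      Prod.smul_snd, smul_eq_mul]
  have hd : ∀ z, HasFDerivAt (F ∘ atHeight r) (∫ t in (0 : ℝ)..1, g' (z, t)) z := by
    intro z
    rw [hFr, ← hasFDerivWithinAt_univ]
    exact hasFDerivWithinAt_parametric_integral convex_univ hg.continuousOn hg'.continuousOn
      (fun z _ t _ => (hgd z t).hasFDerivWithinAt) (mem_univ z)
  -- Closedness turns each partial derivative of the integrand into a derivative of `t * k (t • z)`
  -- with respect to `t`, to which the fundamental theorem of calculus applies.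
  have hrad : ∀ (k : ℝ × ℝ → ℝ), ContDiff ℝ ∞ k → ∀ z t : _,
      HasDerivAt (fun t : ℝ => t * k (t • z)) (k (t • z) + t * fderiv ℝ k (t • z) z) t := by
    intro k hk z t
    have h1 : HasDerivAt (fun t : ℝ => k (t • z)) (fderiv ℝ k (t • z) z) t := by
      have h2 : HasDerivAt (fun t : ℝ => t • z) z t := by
        simpa using (hasDerivAt_id t).smul_const z
      exact ((hk.differentiable (by simp)).differentiableAt.hasFDerivAt).comp_hasDerivAt t h2
    simpa using (hasDerivAt_id t).fun_mul h1
  have hint : ∀ (k : ℝ × ℝ → ℝ), ContDiff ℝ ∞ k → ∀ z,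
      ∫ t in (0 : ℝ)..1, (k (t • z) + t * fderiv ℝ k (t • z) z) = k z := by
    intro k hk z
    have hkc := hk.continuous
    have hkc' := hk.continuous_fderiv (by simp)
    rw [intervalIntegral.integral_eq_sub_of_hasDerivAt (fun t _ => hrad k hk z t)
      (Continuous.intervalIntegrable (by fun_prop) _ _)]
    simp
  intro z
  have hgi : IntervalIntegrable (fun t => g' (z, t)) MeasureTheory.volume 0 1 :=
    (hg'.comp (by fun_prop : Continuous fun t : ℝ => (z, t))).intervalIntegrable _ _
  rw [(hd z).fderiv, ContinuousLinearMap.intervalIntegral_apply hgi,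
    ContinuousLinearMap.intervalIntegral_apply hgi]
  constructor
  · rw [← show p z = P (atHeight r z) from rfl, ← hint p hps z]
    congr 1
    ext t
    rw [ContinuousLinearMap.apply_pair (fderiv ℝ p (t • z)) z, hclosed]
    simp [g']
    ring
  · rw [← show q z = Q (atHeight r z) from rfl, ← hint q hqs z]
    congr 1
    ext t
    rw [ContinuousLinearMap.apply_pair (fderiv ℝ q (t • z)) z, ← hclosed]
    simp [g']
    ring

end IsClosedFamily

/-- A smooth family of potentials for a closed family. -/
structure IsPotentialFamily (P Q F : ℝ × ℝ × ℝ → ℝ) (a b : ℝ → ℝ) : Prop where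
  smooth : ContDiffOn ℝ ∞ F slab
  regular : ∀ r ∈ Icc (0 : ℝ) 1, IsRegularPotential (F ∘ atHeight r) (a r) (b r)
  deriv_fst : ∀ r ∈ Icc (0 : ℝ) 1, ∀ z, fderiv ℝ (F ∘ atHeight r) z (1, 0) = P (atHeight r z)
  deriv_snd : ∀ r ∈ Icc (0 : ℝ) 1, ∀ z, fderiv ℝ (F ∘ atHeight r) z (0, 1) = Q (atHeight r z)

/-- The increment of a primitive under a lattice translation has zero differential, because `P` and
`Q` are periodic, hence is constant on each plane. Its values for the two generators are integrals
over the two basic circles. -/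
theorem IsClosedFamily.exists_potentialFamily {P Q : ℝ × ℝ × ℝ → ℝ} (h : IsClosedFamily P Q) :
    ∃ F, IsPotentialFamily P Q F (fun r => ∫ s in (0 : ℝ)..1, P (s, 0, r))
      (fun r => ∫ s in (0 : ℝ)..1, Q (0, s, r)) := by
  obtain ⟨F, hF, hd⟩ := h.exists_primitive
  refine ⟨F, hF, fun r hr => ?_, fun r hr z => (hd r hr z).1, fun r hr z => (hd r hr z).2⟩
  set f := F ∘ atHeight r with hf
  have hfs : ContDiff ℝ ∞ f := contDiff_comp_atHeight hF hr
  have hfd : ∀ z, HasFDerivAt f (fderiv ℝ f z) z := fun z =>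
    (hfs.differentiable (by simp)).differentiableAt.hasFDerivAt
  have hper : ∀ e, (∀ z, P (atHeight r (z + e)) = P (atHeight r z)) →
      (∀ z, Q (atHeight r (z + e)) = Q (atHeight r z)) → ∀ z, f (z + e) = f z + (f e - f 0) := by
    intro e hP hQ z
    have hconst := is_const_of_fderiv_eq_zero (𝕜 := ℝ) (f := fun z => f (z + e) - f z)
      (by have := hfs.differentiable (by simp); fun_prop) (fun w => by
        have h1 : HasFDerivAt (fun z => f (z + e)) (fderiv ℝ f (w + e)) w :=
          (hfd (w + e)).comp w ((hasFDerivAt_id w).add_const e)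
        rw [(h1.fun_sub (hfd w)).fderiv, sub_eq_zero]
        refine ContinuousLinearMap.ext fun v => ?_
        rw [ContinuousLinearMap.apply_pair, ContinuousLinearMap.apply_pair (fderiv ℝ f w) v,
          (hd r hr _).1, (hd r hr _).1, (hd r hr _).2, (hd r hr _).2, hP, hQ]) z 0
    simp only [zero_add] at hconst
    linarith
  refine ⟨hfs, ⟨fun z => ?_, fun z => ?_⟩, fun z hz => ?_⟩
  · rw [hper (1, 0) (h.periodic_fst r hr).fst (h.periodic_snd r hr).fst z]
    congr 1
    have hder : ∀ s ∈ uIcc (0 : ℝ) 1, HasDerivAt (fun s => f (s, 0)) (P (s, 0, r)) s := fun s _ => by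
      have := (hfd (s, 0)).comp_hasDerivAt s ((hasDerivAt_id s).prodMk (hasDerivAt_const s (0 : ℝ)))
      rw [(hd r hr _).1] at this
      exact this
    rw [intervalIntegral.integral_eq_sub_of_hasDerivAt hder
      (((contDiff_comp_atHeight h.smooth_fst hr).continuous.comp
        (by fun_prop : Continuous fun s : ℝ => (s, (0 : ℝ)))).intervalIntegrable _ _)]
    rfl
  · rw [hper (0, 1) (h.periodic_fst r hr).snd (h.periodic_snd r hr).snd z]
    congr 1
    have hder : ∀ s ∈ uIcc (0 : ℝ) 1, HasDerivAt (fun s => f (0, s)) (Q (0, s, r)) s := fun s _ => by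
      have := (hfd (0, s)).comp_hasDerivAt s ((hasDerivAt_const s (0 : ℝ)).prodMk (hasDerivAt_id s))
      rw [(hd r hr _).2] at this
      exact this
    rw [intervalIntegral.integral_eq_sub_of_hasDerivAt hder
      (((contDiff_comp_atHeight h.smooth_snd hr).continuous.comp
        (by fun_prop : Continuous fun s : ℝ => ((0 : ℝ), s))).intervalIntegrable _ _)]
    rfl
  · have h1 := (hd r hr z).1
    have h2 := (hd r hr z).2
    rw [hz] at h1 h2
    exact (h.ne_zero _ (atHeight_mem hr z)).elim (fun h => h h1.symm) (fun h => h h2.symm)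

namespace IsPotentialFamily

variable {P Q F : ℝ × ℝ × ℝ → ℝ} {a b : ℝ → ℝ}

theorem hamField_eq (h : IsPotentialFamily P Q F a b) {r : ℝ} (hr : r ∈ Icc (0 : ℝ) 1)
    (z : ℝ × ℝ) : hamField (F ∘ atHeight r) z = (Q (atHeight r z), -P (atHeight r z)) := by
  rw [hamField, h.deriv_fst r hr, h.deriv_snd r hr]

/-- The function found at one height works at nearby heights, since positivity has to be checked
only on the compact unit square. The functions are glued with a partition of unity in `r`; its
weights are constant on each plane, so horizontal derivatives and gains are convex combinations. -/
theorem exists_transverse_family (h : IsPotentialFamily P Q F a b) (hc : IsClosedFamily P Q) :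
    ∃ (G : ℝ × ℝ × ℝ → ℝ) (c d : ℝ → ℝ), ContDiff ℝ ∞ G ∧ ∀ r ∈ Icc (0 : ℝ) 1,
      IsQuasiPeriodic (G ∘ atHeight r) (c r) (d r) ∧
      ∀ z, 0 < fderiv ℝ (G ∘ atHeight r) z (hamField (F ∘ atHeight r) z) := by
  have hex : ∀ r₀ : Icc (0 : ℝ) 1, ∃ (G : ℝ × ℝ → ℝ) (c d : ℝ) (U : Set ℝ), ContDiff ℝ ∞ G ∧
      IsQuasiPeriodic G c d ∧ IsOpen U ∧ (r₀ : ℝ) ∈ U ∧ ∀ r ∈ U ∩ Icc (0 : ℝ) 1, ∀ z,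
      0 < fderiv ℝ G z (hamField (F ∘ atHeight r) z) := by
    rintro ⟨r₀, hr₀⟩
    obtain ⟨G, c, d, hG, hq, hpos⟩ := (h.regular r₀ hr₀).exists_transverse
    have hper : ∀ r ∈ Icc (0 : ℝ) 1,
        IsDoublyPeriodic fun z => fderiv ℝ G z (hamField (F ∘ atHeight r) z) := fun r hr =>
      ⟨fun z => by simp only [hq.fderiv.fst z, (h.regular r hr).periodic_hamField.fst z],
        fun z => by simp only [hq.fderiv.snd z, (h.regular r hr).periodic_hamField.snd z]⟩
    have hGc := hG.continuous_fderiv (by simp)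
    obtain ⟨δ, hδ, hle⟩ := (hper r₀ hr₀).exists_pos_le
      (hGc.clm_apply (h.regular r₀ hr₀).contDiff_hamField.continuous) hpos
    have hcont : ContinuousOn (fun p : ℝ × (ℝ × ℝ) => fderiv ℝ G p.2 (hamField (F ∘ atHeight p.1) p.2))
        (Icc (0 : ℝ) 1 ×ˢ Icc (0 : ℝ × ℝ) 1) := by
      have e : ContinuousOn (fun p : ℝ × (ℝ × ℝ) =>
          fderiv ℝ G p.2 (Q (atHeight p.1 p.2), -P (atHeight p.1 p.2)))
          (Icc (0 : ℝ) 1 ×ˢ Icc (0 : ℝ × ℝ) 1) := by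
        have hm : MapsTo (fun p : ℝ × (ℝ × ℝ) => atHeight p.1 p.2)
          (Icc (0 : ℝ) 1 ×ˢ Icc (0 : ℝ × ℝ) 1) slab := fun p hp => hp.1
        have hcm : ContinuousOn (fun p : ℝ × (ℝ × ℝ) => atHeight p.1 p.2)
          (Icc (0 : ℝ) 1 ×ˢ Icc (0 : ℝ × ℝ) 1) := by unfold atHeight; fun_prop
        exact (hGc.comp continuous_snd).continuousOn.clm_apply
          ((hc.smooth_snd.continuousOn.comp hcm hm).prodMk
            (hc.smooth_fst.continuousOn.comp hcm hm).neg)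
      refine e.congr fun p hp => ?_
      simp only [h.hamField_eq hp.1]
    obtain ⟨v, hv, hvδ⟩ := (isCompact_Icc (a := (0 : ℝ × ℝ)) (b := 1)).mem_uniformity_of_prod
      (f := fun r z => fderiv ℝ G z (hamField (F ∘ atHeight r) z)) hcont hr₀
      (Metric.dist_mem_uniformity hδ)
    obtain ⟨U, hU, hr₀U, hUv⟩ := mem_nhdsWithin.1 hv
    refine ⟨G, c, d, U, hG, hq, hU, hr₀U, fun r hr z => ?_⟩
    obtain ⟨w, hw, m, n, rfl⟩ := exists_mem_unitSquare z
    have e1 := (hper r hr.2).int w m n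
    have e2 := hvδ r (hUv hr) w hw
    simp only [mem_ofPred_eq, Real.dist_eq] at e1 e2
    rw [e1]
    linarith [hle w, (abs_lt.1 e2).1]
  choose g c d U hg hq hUo hU hpos using hex
  obtain ⟨t, ht⟩ := (isCompact_Icc (a := (0 : ℝ)) (b := 1)).elim_finite_subcover U hUo
    fun r hr => mem_iUnion.2 ⟨⟨r, hr⟩, hU ⟨r, hr⟩⟩
  obtain ⟨ρ, hρ⟩ := SmoothPartitionOfUnity.exists_isSubordinate 𝓘(ℝ, ℝ) (isClosed_Icc (a := (0 : ℝ)) (b := 1))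
    (fun i : t => U i) (fun i => hUo i) (by simpa [iUnion_subtype] using ht)
  have hρs : ∀ i, ContDiff ℝ ∞ (ρ i) := fun i => (ρ i).contMDiff.contDiff
  have hsum : ∀ r ∈ Icc (0 : ℝ) 1, ∑ i, ρ i r = 1 := fun r hr =>
    (finsum_eq_sum_of_fintype _).symm.trans (ρ.sum_eq_one hr)
  refine ⟨fun q => ∑ i, ρ i q.2.2 * g i (q.1, q.2.1), fun r => ∑ i, ρ i r * c i,
    fun r => ∑ i, ρ i r * d i, ?_, fun r hr => ⟨⟨fun z => ?_, fun z => ?_⟩, fun z => ?_⟩⟩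
  · refine ContDiff.sum fun i _ => ContDiff.mul ((hρs i).comp (by fun_prop)) ((hg i).comp (by fun_prop))
  · simp only [Function.comp_apply, atHeight, ← Finset.sum_add_distrib, ← mul_add]
    exact Finset.sum_congr rfl fun i _ => by rw [← (hq i).fst z]
  · simp only [Function.comp_apply, atHeight, ← Finset.sum_add_distrib, ← mul_add]
    exact Finset.sum_congr rfl fun i _ => by rw [← (hq i).snd z]
  · have hder : HasFDerivAt ((fun q : ℝ × ℝ × ℝ => ∑ i, ρ i q.2.2 * g i (q.1, q.2.1)) ∘ atHeight r)
        (∑ i, ρ i r • fderiv ℝ (g i) z) z := by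
      have : ((fun q : ℝ × ℝ × ℝ => ∑ i, ρ i q.2.2 * g i (q.1, q.2.1)) ∘ atHeight r) =
        fun z => ∑ i, ρ i r * g i z := rfl
      rw [this]
      exact HasFDerivAt.fun_sum fun i _ =>
        ((((hg i).differentiable (by simp)).differentiableAt.hasFDerivAt).const_mul (ρ i r))
    rw [hder.fderiv, sum_apply]
    simp only [smul_apply, smul_eq_mul]
    have hnn : ∀ i, 0 ≤ ρ i r * fderiv ℝ (g i) z (hamField (F ∘ atHeight r) z) ∧
        (ρ i r ≠ 0 → 0 < fderiv ℝ (g i) z (hamField (F ∘ atHeight r) z)) := by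
      intro i
      by_cases hi : ρ i r = 0
      · simp [hi]
      · have := hpos i r ⟨hρ i (subset_tsupport _ hi), hr⟩ z
        exact ⟨mul_nonneg (ρ.nonneg i r) this.le, fun _ => this⟩
    obtain ⟨i, hi⟩ : ∃ i, ρ i r ≠ 0 := by
      by_contra! hcon
      have := hsum r hr
      simp [hcon] at this
    exact Finset.sum_pos' (fun i _ => (hnn i).1) ⟨i, Finset.mem_univ i,
      mul_pos (lt_of_le_of_ne (ρ.nonneg i r) (Ne.symm hi)) ((hnn i).2 hi)⟩

end IsPotentialFamily

end Family

/-! ### Smooth inverses up to the boundary -/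

section Inverse

/-- The derivative of `g` is the inverse of the derivative of `f` at `g p`. As inversion of linear
maps is smooth, `g` gains one order of differentiability at each step of the induction, boundary
points included. -/
theorem contDiffOn_of_inverse {V : Type*} [NormedAddCommGroup V] [NormedSpace ℝ V]
    [CompleteSpace V] {s t : Set V} (hs : UniqueDiffOn ℝ s) (ht : UniqueDiffOn ℝ t) {f g : V → V}
    (hf : ContDiffOn ℝ ∞ f s) (hg : ContinuousOn g t) (hm : MapsTo g t s)
    (hfg : ∀ p ∈ t, f (g p) = p)
    (hinv : ∀ q ∈ s, ∃ e : V ≃L[ℝ] V, (e : V →L[ℝ] V) = fderivWithin ℝ f s q) :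
    ContDiffOn ℝ ∞ g t := by
  have hd : ∀ p ∈ t, HasFDerivWithinAt g
      (ContinuousLinearMap.inverse (fderivWithin ℝ f s (g p))) t p := by
    intro p hp
    obtain ⟨e, he⟩ := hinv (g p) (hm hp)
    have h1 : HasFDerivWithinAt f (e : V →L[ℝ] V) s (g p) := by
      rw [he]; exact (hf.differentiableOn (by simp) _ (hm hp)).hasFDerivWithinAt
    rw [← he, ContinuousLinearMap.inverse_equiv]
    refine HasFDerivWithinAt.of_local_left_inverse ?_ h1 hp
      (Filter.eventually_of_mem self_mem_nhdsWithin hfg)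
    exact tendsto_nhdsWithin_iff.2 ⟨hg p hp, Filter.eventually_of_mem self_mem_nhdsWithin hm⟩
  have hn : ∀ n : ℕ, ContDiffOn ℝ n g t := by
    intro n
    induction n with
    | zero => exact contDiffOn_zero.2 hg
    | succ n ih =>
      push_cast
      rw [contDiffOn_succ_iff_hasFDerivWithinAt_of_uniqueDiffOn ht]
      refine ⟨by simp, _, fun p hp => ?_, hd⟩
      obtain ⟨e, he⟩ := hinv (g p) (hm hp)
      have h1 : ContDiffOn ℝ n (fderivWithin ℝ f s) s :=
        (hf.fderivWithin hs (m := ∞) (by simp)).of_le (by exact_mod_cast le_top)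
      have h2 := contDiffAt_map_inverse (n := n) e
      rw [he] at h2
      exact h2.comp_contDiffWithinAt p ((h1.comp ih hm) p hp)
  exact contDiffOn_infty.2 hn

/-- A cluster point `y` of `g` at `p` in the compact set satisfies `f y = p = f (g p)`, so it is `g
p` by injectivity. -/
theorem continuousWithinAt_of_inverse {V : Type*} [TopologicalSpace V] [T2Space V] {s t k : Set V}
    {f g : V → V} (hf : ContinuousOn f s) (hfinj : InjOn f s) (hk : IsCompact k) (hks : k ⊆ s)
    {p : V} (hp : p ∈ t) (hfg : ∀ p ∈ t, f (g p) = p)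
    (hm : MapsTo g t s) (hgk : ∀ᶠ x in 𝓝[t] p, g x ∈ k) : ContinuousWithinAt g t p := by
  refine hk.tendsto_nhds_of_unique_mapClusterPt hgk fun y hy hcl => hfinj (hks hy) (hm hp) ?_
  rw [hfg p hp]
  have h1 : Filter.Tendsto f (𝓝 y ⊓ Filter.map g (𝓝[t] p)) (𝓝 (f y)) := by
    refine (hf y (hks hy)).mono_left (inf_le_inf_left _ ?_)
    rw [Filter.le_principal_iff]
    exact Filter.mem_map.2 (Filter.mem_of_superset self_mem_nhdsWithin hm)
  have h2 := hcl.tendsto_comp' h1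
  have h3 : Filter.Tendsto (f ∘ g) (𝓝[t] p) (𝓝 p) :=
    (Filter.tendsto_id.mono_left nhdsWithin_le_nhds).congr'
      (Filter.eventuallyEq_of_mem self_mem_nhdsWithin fun x hx => (hfg x hx).symm)
  have h4 : (𝓝 (f y) ⊓ 𝓝 p).NeBot := (show (𝓝 (f y) ⊓ Filter.map (f ∘ g) (𝓝[t] p)).NeBot from h2).mono
    (inf_le_inf_left _ h3)
  exact eq_of_nhds_neBot h4

end Inverse

/-! ### Global coordinates in which the orbits on the tori are straight -/

section Coordinates

open PartialSections

variable {P Q F G : ℝ × ℝ × ℝ → ℝ} {a b c d : ℝ → ℝ}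

/-- A potential family of a closed family, together with a smooth family of functions that grow
along its Hamiltonian fields. -/
structure IsCoordinateFamily (P Q F G : ℝ × ℝ × ℝ → ℝ) (a b c d : ℝ → ℝ) : Prop where
  closed : IsClosedFamily P Q
  potential : IsPotentialFamily P Q F a b
  smooth : ContDiff ℝ ∞ G
  quasi : ∀ r ∈ Icc (0 : ℝ) 1, IsQuasiPeriodic (G ∘ atHeight r) (c r) (d r)
  growth : ∀ r ∈ Icc (0 : ℝ) 1, ∀ z,
    0 < fderiv ℝ (G ∘ atHeight r) z (hamField (F ∘ atHeight r) z)

/-- The coordinates given by two functions, with the height. -/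
def coordMap (F G : ℝ × ℝ × ℝ → ℝ) (q : ℝ × ℝ × ℝ) : ℝ × ℝ × ℝ := (F q, G q, q.2.2)

namespace IsCoordinateFamily

theorem contDiff_comp (h : IsCoordinateFamily P Q F G a b c d) {r : ℝ} :
    ContDiff ℝ ∞ (G ∘ atHeight r) := h.smooth.comp (contDiff_atHeight r)

theorem det_pos (h : IsCoordinateFamily P Q F G a b c d) {r : ℝ} (hr : r ∈ Icc (0 : ℝ) 1) :
    0 < b r * c r - a r * d r :=
  IsRegularPotential.det_periods_pos (h.potential.regular r hr).smooth
    (h.potential.regular r hr).quasi h.contDiff_comp (h.quasi r hr) (h.growth r hr)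

theorem contDiffOn_coordMap (h : IsCoordinateFamily P Q F G a b c d) :
    ContDiffOn ℝ ∞ (coordMap F G) slab :=
  h.potential.smooth.prodMk (h.smooth.contDiffOn.prodMk (by fun_prop))

theorem exists_eq (h : IsCoordinateFamily P Q F G a b c d) {p : ℝ × ℝ × ℝ} (hp : p ∈ slab) :
    ∃ q ∈ slab, coordMap F G q = p := by
  obtain ⟨z, ⟨hz1, hz2⟩, -⟩ := (h.potential.regular _ hp).existsUnique_coordinates h.contDiff_comp
    (h.quasi _ hp) (h.growth _ hp) p.1 p.2.1
  exact ⟨atHeight p.2.2 z, hp, Prod.ext hz1 (Prod.ext hz2 rfl)⟩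

theorem injOn (h : IsCoordinateFamily P Q F G a b c d) : InjOn (coordMap F G) slab := by
  rintro ⟨x, y, r⟩ hq ⟨x', y', r'⟩ hq' heq
  simp only [coordMap, Prod.mk.injEq] at heq
  obtain ⟨h1, h2, rfl⟩ := heq
  have := ((h.potential.regular r hq).existsUnique_coordinates h.contDiff_comp
    (h.quasi r hq) (h.growth r hq) (F (x, y, r)) (G (x, y, r))).unique
    (y₁ := (x, y)) (y₂ := (x', y')) ⟨rfl, rfl⟩ ⟨h1.symm, h2.symm⟩
  simp only [Prod.mk.injEq] at this
  rw [this.1, this.2]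

theorem fderiv_coord (h : IsCoordinateFamily P Q F G a b c d) {q : ℝ × ℝ × ℝ} (hq : q ∈ slab)
    (v : ℝ × ℝ × ℝ) : fderivWithin ℝ (coordMap F G) slab q v =
      (fderivWithin ℝ F slab q v, fderivWithin ℝ G slab q v, v.2.2) := by
  have h1 := (h.potential.smooth.differentiableOn (by simp) q hq).hasFDerivWithinAt
  have h2 := (h.smooth.contDiffOn (s := slab).differentiableOn (by simp) q hq).hasFDerivWithinAt
  have h3 : HasFDerivWithinAt (fun q : ℝ × ℝ × ℝ => q.2.2)
    ((ContinuousLinearMap.snd ℝ ℝ ℝ).comp (ContinuousLinearMap.snd ℝ ℝ (ℝ × ℝ))) slab q :=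
    (hasFDerivAt_snd.comp q hasFDerivAt_snd).hasFDerivWithinAt
  rw [show coordMap F G = fun q => (F q, G q, q.2.2) from rfl,
    (h1.prodMk (h2.prodMk h3)).fderivWithin (uniqueDiffOn_slab q hq)]
  rfl

theorem fderivWithin_fst (h : IsCoordinateFamily P Q F G a b c d) {q : ℝ × ℝ × ℝ} (hq : q ∈ slab)
    (v : ℝ × ℝ) : fderivWithin ℝ F slab q (horizontal v) = v.1 * P q + v.2 * Q q := by
  have h1 := fderiv_comp_atHeight h.potential.smooth hq (q.1, q.2.1)
  have h2 := h.potential.deriv_fst q.2.2 hq (q.1, q.2.1)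
  have h3 := h.potential.deriv_snd q.2.2 hq (q.1, q.2.1)
  have h4 : fderivWithin ℝ F slab q (horizontal v) = fderiv ℝ (F ∘ atHeight q.2.2) (q.1, q.2.1) v := by
    rw [h1]; rfl
  rw [h4, ContinuousLinearMap.apply_pair, h2, h3]
  rfl

theorem fderivWithin_snd (h : IsCoordinateFamily P Q F G a b c d) {q : ℝ × ℝ × ℝ} (hq : q ∈ slab) :
    0 < fderivWithin ℝ G slab q (horizontal (Q q, -P q)) := by
  have h1 := fderiv_comp_atHeight (h.smooth.contDiffOn (s := slab)) hq (q.1, q.2.1)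
  have h2 := h.growth q.2.2 hq (q.1, q.2.1)
  rw [h.potential.hamField_eq hq, h1] at h2
  exact h2

/-- A kernel vector is horizontal because of the third coordinate. On horizontal vectors the
Jacobian determinant is, up to sign, the derivative of `G` along the Hamiltonian field `(Q, -P)`,
which is positive. -/
theorem exists_equiv (h : IsCoordinateFamily P Q F G a b c d) {q : ℝ × ℝ × ℝ} (hq : q ∈ slab) :
    ∃ e : (ℝ × ℝ × ℝ) ≃L[ℝ] ℝ × ℝ × ℝ,
      (e : (ℝ × ℝ × ℝ) →L[ℝ] ℝ × ℝ × ℝ) = fderivWithin ℝ (coordMap F G) slab q := by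
  have hinj : Function.Injective (fderivWithin ℝ (coordMap F G) slab q).toLinearMap := by
    rw [← LinearMap.ker_eq_bot, LinearMap.ker_eq_bot']
    rintro ⟨v₁, v₂, v₃⟩ hv
    have hv' : fderivWithin ℝ (coordMap F G) slab q (v₁, v₂, v₃) = 0 := hv
    rw [h.fderiv_coord hq, Prod.mk_eq_zero, Prod.mk_eq_zero] at hv'
    obtain ⟨e1, e2, e3⟩ := hv'
    simp only at e3
    subst e3
    have e1' := h.fderivWithin_fst hq (v₁, v₂)
    have e2' := h.fderivWithin_snd hq
    rw [horizontal_apply] at e1'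
    rw [e1] at e1'
    have hlin : ∀ w : ℝ × ℝ, fderivWithin ℝ G slab q (horizontal w) =
        w.1 * fderivWithin ℝ G slab q (1, 0, 0) + w.2 * fderivWithin ℝ G slab q (0, 1, 0) := fun w => by
      have := ContinuousLinearMap.apply_pair ((fderivWithin ℝ G slab q).comp horizontal) w
      simpa [horizontal_apply] using this
    rw [hlin] at e2'
    have e3' := hlin (v₁, v₂)
    rw [horizontal_apply, e2] at e3'
    simp only at e1' e2' e3'
    set gx := fderivWithin ℝ G slab q (1, 0, 0)
    set gy := fderivWithin ℝ G slab q (0, 1, 0)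
    have k1 : v₁ * (Q q * gx + -P q * gy) = 0 := by linear_combination gy * e1' - Q q * e3'
    have k2 : v₂ * (Q q * gx + -P q * gy) = 0 := by linear_combination P q * e3' - gx * e1'
    rw [(mul_eq_zero.1 k1).resolve_right e2'.ne', (mul_eq_zero.1 k2).resolve_right e2'.ne']
    rfl
  exact ⟨(LinearEquiv.ofInjectiveEndo _ hinj).toContinuousLinearEquiv, by ext <;> rfl⟩

/-- Properness of the coordinates. After removing a lattice vector the point lies in a compact cell,
on which `F` and `G` are bounded; the lattice vector is bounded because its gains are and the period
matrix has an inverse bounded over all heights. -/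
theorem exists_bound (h : IsCoordinateFamily P Q F G a b c d) (R : ℝ) :
    ∃ R', ∀ q ∈ slab, ‖coordMap F G q‖ ≤ R → ‖q‖ ≤ R' := by
  have hsub : Icc (0 : ℝ × ℝ × ℝ) 1 ⊆ slab := fun q hq => ⟨hq.1.2.2, hq.2.2.2⟩
  obtain ⟨C₁, hC₁⟩ := (isCompact_Icc (a := (0 : ℝ × ℝ × ℝ)) (b := 1)).exists_bound_of_continuousOn
    (h.potential.smooth.continuousOn.mono hsub)
  obtain ⟨C₂, hC₂⟩ := (isCompact_Icc (a := (0 : ℝ × ℝ × ℝ)) (b := 1)).exists_bound_of_continuousOn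
    h.smooth.continuous.continuousOn
  have hm : ∀ z : ℝ × ℝ, ContinuousOn (fun r => F (atHeight r z)) (Icc 0 1) := fun z =>
    h.potential.smooth.continuousOn.comp (by unfold atHeight; fun_prop) fun r hr => hr
  have hm' : ∀ z : ℝ × ℝ, ContinuousOn (fun r => G (atHeight r z)) (Icc 0 1) := fun z =>
    h.smooth.continuous.continuousOn.comp (t := univ) (by unfold atHeight; fun_prop) fun r hr => trivial
  have ha : ContinuousOn a (Icc 0 1) := ((hm (0 + (1, 0))).sub (hm 0)).congr fun r hr => by
    have := (h.potential.regular r hr).quasi.fst 0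
    simp only [Function.comp_apply] at this
    simp only [Pi.sub_apply, this]; ring
  have hb : ContinuousOn b (Icc 0 1) := ((hm (0 + (0, 1))).sub (hm 0)).congr fun r hr => by
    have := (h.potential.regular r hr).quasi.snd 0
    simp only [Function.comp_apply] at this
    simp only [Pi.sub_apply, this]; ring
  have hc : ContinuousOn c (Icc 0 1) := ((hm' (0 + (1, 0))).sub (hm' 0)).congr fun r hr => by
    have := (h.quasi r hr).fst 0
    simp only [Function.comp_apply] at this
    simp only [Pi.sub_apply, this]; ring
  have hd : ContinuousOn d (Icc 0 1) := ((hm' (0 + (0, 1))).sub (hm' 0)).congr fun r hr => by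
    have := (h.quasi r hr).snd 0
    simp only [Function.comp_apply] at this
    simp only [Pi.sub_apply, this]; ring
  have hD : ContinuousOn (fun r => (b r * c r - a r * d r)⁻¹) (Icc 0 1) :=
    ((hb.mul hc).sub (ha.mul hd)).inv₀ fun r hr => (h.det_pos hr).ne'
  obtain ⟨C, hC⟩ := isCompact_Icc.exists_bound_of_continuousOn
    (f := fun r => (|a r| + |b r| + |c r| + |d r|) * (b r * c r - a r * d r)⁻¹)
    ((((ha.abs.add hb.abs).add hc.abs).add hd.abs).mul hD)
  set B := C * ((R + C₁) + (R + C₂)) with hB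
  refine ⟨B + 1, ?_⟩
  rintro ⟨x, y, r⟩ hq hR
  have hr : r ∈ Icc (0 : ℝ) 1 := hq
  obtain ⟨⟨w₁, w₂⟩, hw, m, n, hwmn⟩ := exists_mem_unitSquare (x, y)
  simp only [Prod.mk_add_mk, Prod.mk.injEq] at hwmn
  obtain ⟨rfl, rfl⟩ := hwmn
  have hwr : (w₁, w₂, r) ∈ Icc (0 : ℝ × ℝ × ℝ) 1 :=
    ⟨⟨hw.1.1, hw.1.2, hr.1⟩, hw.2.1, hw.2.2, hr.2⟩
  have e1 := (h.potential.regular r hr).quasi.int (w₁, w₂) m n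
  have e2 := (h.quasi r hr).int (w₁, w₂) m n
  simp only [Function.comp_apply, atHeight, Prod.mk_add_mk] at e1 e2
  simp only [coordMap, Prod.norm_def, max_le_iff, Real.norm_eq_abs] at hR
  have b1 := hC₁ _ hwr
  have b2 := hC₂ _ hwr
  have hdet := h.det_pos hr
  have hCr := hC r hr
  rw [Real.norm_eq_abs, abs_of_nonneg (by positivity)] at hCr
  rw [Real.norm_eq_abs] at b1 b2
  set u := a r * m + b r * n with hu
  set v := c r * m + d r * n with hv
  have hub : |u| ≤ R + C₁ := by
    have : u = F (w₁ + m, w₂ + n, r) - F (w₁, w₂, r) := by rw [e1]; ring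
    rw [this]; exact (abs_sub _ _).trans (by linarith [hR.1])
  have hvb : |v| ≤ R + C₂ := by
    have : v = G (w₁ + m, w₂ + n, r) - G (w₁, w₂, r) := by rw [e2]; ring
    rw [this]; exact (abs_sub _ _).trans (by linarith [hR.2.1])
  -- Used for Cramer's rule: `m` and `n` times the determinant are combinations of the gains `u`,
  -- `v` with the periods as coefficients.
  have key : ∀ (k α β : ℝ), k * (b r * c r - a r * d r) = α * u + β * v →
      |α| ≤ |a r| + |b r| + |c r| + |d r| → |β| ≤ |a r| + |b r| + |c r| + |d r| → |k| ≤ B := by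
    intro k α β hk hα hβ
    have h1 : |k| * (b r * c r - a r * d r) ≤
        (|a r| + |b r| + |c r| + |d r|) * (|u| + |v|) := by
      rw [← abs_of_pos hdet, ← abs_mul, hk,
        mul_add (|a r| + |b r| + |c r| + |d r|) |u| |v|]
      refine (abs_add_le _ _).trans ?_
      rw [abs_mul, abs_mul]
      gcongr
    have h2 : |k| ≤ (|a r| + |b r| + |c r| + |d r|) * (b r * c r - a r * d r)⁻¹ * (|u| + |v|) := by
      rw [mul_assoc, mul_comm _ (|u| + |v|), ← mul_assoc, ← div_eq_mul_inv, le_div_iff₀ hdet]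
      exact h1
    refine h2.trans ?_
    rw [hB]
    have := abs_nonneg u
    have := abs_nonneg v
    gcongr
    exact le_trans (by positivity) hCr
  have := abs_nonneg (a r)
  have := abs_nonneg (b r)
  have := abs_nonneg (c r)
  have := abs_nonneg (d r)
  have hmB := key m (-d r) (b r) (by rw [hu, hv]; ring) (by rw [abs_neg]; linarith) (by linarith)
  have hnB := key n (c r) (-a r) (by rw [hu, hv]; ring) (by linarith) (by rw [abs_neg]; linarith)
  have hB0 := (abs_nonneg _).trans hmB
  obtain ⟨⟨h1, h2⟩, h3, h4⟩ := hw
  simp only [Prod.fst_zero, Prod.snd_zero, Prod.fst_one, Prod.snd_one] at h1 h2 h3 h4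
  simp only [Prod.norm_def, max_le_iff, Real.norm_eq_abs]
  refine ⟨(abs_add_le _ _).trans ?_, (abs_add_le _ _).trans ?_, ?_⟩
  · rw [abs_of_nonneg h1]; linarith
  · rw [abs_of_nonneg h2]; linarith
  · rw [abs_of_nonneg hr.1]; linarith [hr.2]

/-- Bijectivity holds height by height. Properness gives continuity of the inverse, and
invertibility of the derivative then gives smoothness up to the boundary of the slab. -/
theorem exists_inverse (h : IsCoordinateFamily P Q F G a b c d) :
    ∃ Γ : ℝ × ℝ × ℝ → ℝ × ℝ × ℝ, ContDiffOn ℝ ∞ Γ slab ∧ MapsTo Γ slab slab ∧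
      (∀ p ∈ slab, coordMap F G (Γ p) = p) ∧ ∀ q ∈ slab, Γ (coordMap F G q) = q := by
  choose! Γ hΓ hFG using fun p (hp : p ∈ slab) => h.exists_eq hp
  refine ⟨Γ, ?_, hΓ, hFG, fun q hq => h.injOn (hΓ (coordMap F G q) hq) hq (hFG (coordMap F G q) hq)⟩
  refine contDiffOn_of_inverse uniqueDiffOn_slab uniqueDiffOn_slab h.contDiffOn_coordMap
    (fun p hp => ?_) hΓ hFG fun q hq => h.exists_equiv hq
  obtain ⟨R', hR'⟩ := h.exists_bound (‖p‖ + 1)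
  refine continuousWithinAt_of_inverse h.contDiffOn_coordMap.continuousOn h.injOn
    ((isCompact_closedBall (0 : ℝ × ℝ × ℝ) R').inter_right isClosed_slab) inter_subset_right hp
    hFG hΓ ?_
  filter_upwards [self_mem_nhdsWithin, mem_nhdsWithin_of_mem_nhds (Metric.ball_mem_nhds p one_pos)]
    with x hx hxp
  refine ⟨?_, hΓ x hx⟩
  rw [mem_closedBall_zero_iff]
  refine hR' _ (hΓ x hx) ?_
  rw [hFG x hx]
  have := norm_le_norm_add_norm_sub' x p
  rw [Metric.mem_ball, dist_eq_norm] at hxp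
  linarith

end IsCoordinateFamily

end Coordinates

/-! ### Evaluation of smooth families of alternating forms on smooth vectors -/

section Evaluation

variable {𝕜 : Type*} [NontriviallyNormedField 𝕜]
  {V : Type*} [NormedAddCommGroup V] [NormedSpace 𝕜 V]
  {F : Type*} [NormedAddCommGroup F] [NormedSpace 𝕜 F]
  {G : Type*} [NormedAddCommGroup G] [NormedSpace 𝕜 G]

/-- Induction on the degree: currying is linear and continuous, and applying the curried family to
the first vector is a smooth pairing. -/
theorem ContDiffWithinAt.continuousAlternatingMap_apply {n : WithTop ℕ∞} {s : Set V} {x : V} :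
    ∀ {k : ℕ} {f : V → F [⋀^Fin k]→L[𝕜] G} {v : Fin k → V → F},
      ContDiffWithinAt 𝕜 n f s x → (∀ i, ContDiffWithinAt 𝕜 n (v i) s x) →
        ContDiffWithinAt 𝕜 n (fun y => f y (fun i => v i y)) s x
  | 0, f, v, hf, _ => by
    have h := (ContinuousAlternatingMap.apply 𝕜 F G (0 : Fin 0 → F)).contDiff.comp_contDiffWithinAt
      hf
    refine h.congr (fun y _ => ?_) ?_ <;>
    · simp only [Function.comp_apply, ContinuousAlternatingMap.apply_apply]
      congr 1
      exact Subsingleton.elim _ _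
  | k + 1, f, v, hf, hv => by
    let L : (F [⋀^Fin (k + 1)]→L[𝕜] G) →L[𝕜] (F →L[𝕜] F [⋀^Fin k]→L[𝕜] G) :=
      ContinuousAlternatingMap.curryLeftLI.toContinuousLinearMap
    have hL : ContDiff 𝕜 n L := by fun_prop
    have h0 : ContDiffWithinAt 𝕜 n (fun y => L (f y)) s x := hL.comp_contDiffWithinAt hf
    have h1 : ContDiffWithinAt 𝕜 n (fun y => (f y).curryLeft (v 0 y)) s x :=
      h0.clm_apply (hv 0)
    have h2 := ContDiffWithinAt.continuousAlternatingMap_apply h1 (fun i => hv i.succ)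
    refine h2.congr (fun y _ => ?_) ?_ <;>
    · rw [ContinuousAlternatingMap.curryLeft_apply_apply]
      congr 1
      ext i
      refine Fin.cases rfl (fun j => rfl) i

end Evaluation

/-! ### Pullbacks of forms and naturality of the exterior derivative -/

namespace PartialSections

section Pullback

variable {E : Type*} [NormedAddCommGroup E] [NormedSpace ℝ E]
  {H : Type*} [TopologicalSpace H] {I : ModelWithCorners ℝ E H}
  {M : Type*} [TopologicalSpace M] [ChartedSpace H M]
  {V : Type*} [NormedAddCommGroup V] [NormedSpace ℝ V] {k : ℕ}

/-- The pullback of a form under a map that is defined on a subset of a vector space. -/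
noncomputable def pullbackWithin (η : DiffForm I M k) (g : V → M) (s : Set V) (z : V) :
    V [⋀^Fin k]→L[ℝ] ℝ :=
  (η (g z)).compContinuousLinearMap (mfderivWithin 𝓘(ℝ, V) I g s z)

theorem pullbackWithin_apply (η : DiffForm I M k) (g : V → M) (s : Set V) (z : V)
    (v : Fin k → V) :
    pullbackWithin η g s z v = η (g z) (fun i => mfderivWithin 𝓘(ℝ, V) I g s z (v i)) := rfl

theorem formInChart_eq_pullbackWithin (η : DiffForm I M k) (x₀ : M) :
    formInChart η x₀ = pullbackWithin η (extChartAt I x₀).symm (range I) := rfl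

theorem DiffForm.apply_congr (η : DiffForm I M k) {x x' : M} (h : x = x') (v : Fin k → E) :
    η x v = η x' v := by
  subst h; rfl

theorem extChartAt_mem_range (x₀ x : M) : extChartAt I x₀ x ∈ range I := by
  rw [extChartAt_coe]; exact mem_range_self _

variable [IsManifold I ∞ M]

theorem contMDiffWithinAt_extChartAt_comp {g : V → M} {s : Set V} {z : V} {x₀ : M}
    (hg : ContMDiffWithinAt 𝓘(ℝ, V) I ∞ g s z) (hx : g z ∈ (chartAt H x₀).source) :
    ContDiffWithinAt ℝ ∞ (fun z => extChartAt I x₀ (g z)) s z :=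
  contMDiffWithinAt_iff_contDiffWithinAt.1
    ((contMDiffAt_extChartAt' hx).comp_contMDiffWithinAt z hg)

/-- The chain rule through a chart at an arbitrary centre `x₀`. It reduces pullbacks from the
manifold to pullbacks between vector spaces. -/
theorem pullbackWithin_eq_formInChart (η : DiffForm I M k) {g : V → M} {s : Set V} {z : V}
    (hs : UniqueDiffWithinAt ℝ s z) {x₀ : M} (hg : MDifferentiableWithinAt 𝓘(ℝ, V) I g s z)
    (hx : g z ∈ (chartAt H x₀).source) :
    pullbackWithin η g s z = (formInChart η x₀ (extChartAt I x₀ (g z))).compContinuousLinearMap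
      (fderivWithin ℝ (fun z => extChartAt I x₀ (g z)) s z) := by
  have hsource : g z ∈ (extChartAt I x₀).source := by rwa [extChartAt_source]
  have hleft : (extChartAt I x₀).symm (extChartAt I x₀ (g z)) = g z :=
    (extChartAt I x₀).left_inv hsource
  have h1 : MDifferentiableWithinAt 𝓘(ℝ, V) 𝓘(ℝ, E) (fun z => extChartAt I x₀ (g z)) s z :=
    (mdifferentiableAt_extChartAt hx).comp_mdifferentiableWithinAt z hg
  have h2 : MDifferentiableWithinAt 𝓘(ℝ, E) I (extChartAt I x₀).symm (range I)
      (extChartAt I x₀ (g z)) :=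
    mdifferentiableWithinAt_extChartAt_symm ((extChartAt I x₀).map_source hsource)
  have h3 := mfderivWithin_comp (u := range I) z h2 h1 (fun z' _ => extChartAt_mem_range x₀ (g z'))
    hs.uniqueMDiffWithinAt
  have h4 : ((extChartAt I x₀).symm ∘ fun z => extChartAt I x₀ (g z)) =ᶠ[𝓝[s] z] g := by
    have : ∀ᶠ z' in 𝓝[s] z, g z' ∈ (extChartAt I x₀).source :=
      hg.continuousWithinAt.eventually (extChartAt_source_mem_nhds' hsource)
    filter_upwards [this] with z' hz'
    exact (extChartAt I x₀).left_inv hz'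
  have h5 := h4.mfderivWithin_eq (I := 𝓘(ℝ, V)) (I' := I) hleft
  rw [h5, mfderivWithin_eq_fderivWithin] at h3
  ext v
  refine (DiffForm.apply_congr η hleft.symm _).trans ?_
  simp only [formInChart, ContinuousAlternatingMap.compContinuousLinearMap_apply]
  exact congrArg (η ((extChartAt I x₀).symm (extChartAt I x₀ (g z))))
    (funext fun i => DFunLike.congr_fun h3 (v i))

theorem eventually_pullbackWithin_eq (η : DiffForm I M k) {g : V → M} {s : Set V} {z : V}
    (hs : UniqueDiffOn ℝ s) (hg : ContMDiffWithinAt 𝓘(ℝ, V) I ∞ g s z) (hz : z ∈ s) {x₀ : M}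
    (hx : g z ∈ (chartAt H x₀).source) :
    ∀ᶠ y in 𝓝[s] z, pullbackWithin η g s y =
      (formInChart η x₀ (extChartAt I x₀ (g y))).compContinuousLinearMap
        (fderivWithin ℝ (fun z => extChartAt I x₀ (g z)) s y) := by
  have h1 : ∀ᶠ y in 𝓝[s] z, g y ∈ (chartAt H x₀).source :=
    hg.continuousWithinAt.eventually ((chartAt H x₀).open_source.mem_nhds hx)
  have h2 : ∀ᶠ y in 𝓝[s] z, MDifferentiableWithinAt 𝓘(ℝ, V) I g s y := by
    have h := (contMDiffWithinAt_iff_contMDiffWithinAt_nhdsWithin (by simp)).1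
      (hg.of_le (show (1 : WithTop ℕ∞) ≤ ∞ by simp))
    rw [insert_eq_of_mem hz] at h
    filter_upwards [h] with y hy using hy.mdifferentiableWithinAt (by simp)
  filter_upwards [h1, h2, self_mem_nhdsWithin] with y hy1 hy2 hy3
  exact pullbackWithin_eq_formInChart η (hs y hy3) hy2 hy1

theorem contDiffWithinAt_formInChart_comp {η : DiffForm I M k} (hη : IsSmoothForm η) {g : V → M}
    {s : Set V} {z : V} (hg : ContMDiffWithinAt 𝓘(ℝ, V) I ∞ g s z) {x₀ : M}
    (hx : g z ∈ (chartAt H x₀).source) :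
    ContDiffWithinAt ℝ ∞ (fun y => formInChart η x₀ (extChartAt I x₀ (g y))) s z := by
  have hsource : g z ∈ (extChartAt I x₀).source := by rwa [extChartAt_source]
  have h := ((hη x₀) _ ((extChartAt I x₀).map_source hsource)).mono_of_mem_nhdsWithin
    (extChartAt_target_mem_nhdsWithin' hsource)
  exact h.comp z (contMDiffWithinAt_extChartAt_comp hg hx)
    (fun y _ => extChartAt_mem_range x₀ (g y))

theorem IsSmoothForm.contDiffWithinAt_pullbackWithin {η : DiffForm I M k} (hη : IsSmoothForm η)
    {g : V → M} {s : Set V} (hs : UniqueDiffOn ℝ s) {z : V} (hz : z ∈ s)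
    (hg : ContMDiffWithinAt 𝓘(ℝ, V) I ∞ g s z) (v : Fin k → V) :
    ContDiffWithinAt ℝ ∞ (fun z => pullbackWithin η g s z v) s z := by
  have hx := mem_chart_source H (g z)
  have h1 := contDiffWithinAt_formInChart_comp hη hg hx
  have h2 := (contMDiffWithinAt_extChartAt_comp hg hx).fderivWithin_right hs
    (m := ∞) (by simp) hz
  have h3 := h1.continuousAlternatingMap_apply
    (fun i => h2.clm_apply (contDiffWithinAt_const (c := v i)))
  refine h3.congr_of_eventuallyEq_of_mem ?_ hz
  filter_upwards [eventually_pullbackWithin_eq η hs hg hz hx] with y hy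
  rw [hy]; rfl

/-- Pullbacks of smooth one-forms are smooth. -/
theorem IsSmoothForm.contDiffWithinAt_pullbackWithin_one {η : DiffForm I M 1}
    (hη : IsSmoothForm η) {g : V → M} {s : Set V} (hs : UniqueDiffOn ℝ s) {z : V} (hz : z ∈ s)
    (hg : ContMDiffWithinAt 𝓘(ℝ, V) I ∞ g s z) :
    ContDiffWithinAt ℝ ∞ (pullbackWithin η g s) s z := by
  have hx := mem_chart_source H (g z)
  let L : (V →L[ℝ] ℝ) ≃ₗᵢ[ℝ] (V [⋀^Fin 1]→L[ℝ] ℝ) :=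
    ContinuousAlternatingMap.ofSubsingletonLIE (0 : Fin 1)
  let L' : (E →L[ℝ] ℝ) ≃ₗᵢ[ℝ] (E [⋀^Fin 1]→L[ℝ] ℝ) :=
    ContinuousAlternatingMap.ofSubsingletonLIE (0 : Fin 1)
  have hL : ContDiff ℝ ∞ L := L.contDiff
  have hL' : ContDiff ℝ ∞ L'.symm := L'.symm.contDiff
  have h1 := hL'.comp_contDiffWithinAt (contDiffWithinAt_formInChart_comp hη hg hx)
  have h2 := (contMDiffWithinAt_extChartAt_comp hg hx).fderivWithin_right hs
    (m := ∞) (by simp) hz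
  have h3 := hL.comp_contDiffWithinAt (h1.clm_comp h2)
  refine h3.congr_of_eventuallyEq_of_mem ?_ hz
  filter_upwards [eventually_pullbackWithin_eq η hs hg hz hx] with y hy
  rw [hy]
  ext v
  have h4 : ∀ (F : E [⋀^Fin 1]→L[ℝ] ℝ) (w : E), L'.symm F w = F (fun _ => w) := fun F w => rfl
  have h5 : ∀ (F : V →L[ℝ] ℝ) (w : Fin 1 → V), L F w = F (w 0) := fun F w => rfl
  simp only [Function.comp_apply, h5, ContinuousLinearMap.comp_apply, h4]
  refine congrArg _ (funext fun i => ?_)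
  rw [Subsingleton.elim i 0]

theorem IsSmoothForm.differentiableWithinAt_pullbackWithin {η : DiffForm I M k}
    (hη : IsSmoothForm η) {g : V → M} {s : Set V} (hs : UniqueDiffOn ℝ s) {z : V} (hz : z ∈ s)
    (hg : ContMDiffWithinAt 𝓘(ℝ, V) I ∞ g s z) :
    DifferentiableWithinAt ℝ (pullbackWithin η g s) s z := by
  have hx := mem_chart_source H (g z)
  have h1 := contDiffWithinAt_formInChart_comp hη hg hx
  have h2 := (contMDiffWithinAt_extChartAt_comp hg hx).fderivWithin_right hs
    (m := ∞) (by simp) hz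
  have h3 := (h1.differentiableWithinAt (by simp)).continuousAlternatingMapCompContinuousLinearMap
    (h2.differentiableWithinAt (by simp))
  exact h3.congr_of_eventuallyEq_of_mem (eventually_pullbackWithin_eq η hs hg hz hx) hz

/-- The exterior derivative commutes with pullbacks. -/
theorem IsSmoothForm.extDerivWithin_pullbackWithin {η : DiffForm I M k}
    (hη : IsSmoothForm η) {g : V → M} {s : Set V} (hs : UniqueDiffOn ℝ s) {z : V} (hz : z ∈ s)
    (hz' : z ∈ closure (interior s)) (hg : ContMDiffWithinAt 𝓘(ℝ, V) I ∞ g s z) :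
    extDerivWithin (pullbackWithin η g s) s z = pullbackWithin (extD η) g s z := by
  have hx := mem_chart_source H (g z)
  have hsource : g z ∈ (extChartAt I (g z)).source := mem_extChartAt_source _
  have h0 := (((hη (g z)) _ ((extChartAt I (g z)).map_source hsource)).mono_of_mem_nhdsWithin
    (extChartAt_target_mem_nhdsWithin' hsource)).differentiableWithinAt (by simp)
  rw [Filter.EventuallyEq.extDerivWithin_eq_of_mem
    (eventually_pullbackWithin_eq η hs hg hz hx) hz,
    extDerivWithin_pullback (r := ∞) (t := range I)
      (f := fun y => extChartAt I (g z) (g y)) h0 (contMDiffWithinAt_extChartAt_comp hg hx)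
      (by simpa using (show ((2 : ℕ∞) : WithTop ℕ∞) ≤ ∞ from mod_cast le_top)) hs hz' hz (fun y _ => extChartAt_mem_range _ _)]
  have h1 := mfderiv_comp_mfderivWithin z (mdifferentiableAt_extChartAt hx)
    (hg.mdifferentiableWithinAt (by simp)) (hs z hz).uniqueMDiffWithinAt
  rw [mfderivWithin_eq_fderivWithin] at h1
  ext v
  simp only [pullbackWithin, extD, ContinuousAlternatingMap.compContinuousLinearMap_apply]
  exact congrArg (extDerivWithin (formInChart η (g z)) (range I) (extChartAt I (g z) (g z)))
    (funext fun i => DFunLike.congr_fun h1 (v i))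

/-- The exterior derivative at each point is defined through the chart centred there. Naturality
under the inverse of a fixed chart shows that this chart computes it at all of its points, whence
smoothness. -/
theorem IsSmoothForm.formInChart_extD {η : DiffForm I M k} (hη : IsSmoothForm η) (x₀ : M) {y : E}
    (hy : y ∈ (extChartAt I x₀).target) :
    formInChart (extD η) x₀ y = extDerivWithin (formInChart η x₀) (range I) y := by
  have hr := extChartAt_target_subset_range x₀ hy
  have h : ContMDiffWithinAt 𝓘(ℝ, E) I ∞ (extChartAt I x₀).symm (range I) y := by
    exact contMDiffWithinAt_extChartAt_symm_range x₀ hy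
  rw [formInChart_eq_pullbackWithin, formInChart_eq_pullbackWithin,
    hη.extDerivWithin_pullbackWithin I.uniqueDiffOn hr (I.range_subset_closure_interior hr) h]

theorem IsSmoothForm.extD {η : DiffForm I M k} (hη : IsSmoothForm η) :
    IsSmoothForm (extD η) := by
  intro x₀ y hy
  have h1 : ContDiffWithinAt ℝ ∞ (formInChart η x₀) (range I) y :=
    ((hη x₀) y hy).mono_of_mem_nhdsWithin (extChartAt_target_mem_nhdsWithin_of_mem hy)
  have h2 := h1.fderivWithin_right (m := ∞) I.uniqueDiffOn (by simp)
    (extChartAt_target_subset_range x₀ hy)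
  have h3 := (ContinuousAlternatingMap.alternatizeUncurryFinCLM ℝ E
    ℝ (n := k)).contDiff.comp_contDiffWithinAt h2
  exact (h3.mono (extChartAt_target_subset_range x₀)).congr
    (fun z hz => hη.formInChart_extD x₀ hz) (hη.formInChart_extD x₀ hy)

end Pullback

end PartialSections

/-! ### Interior products and comparison of the signs of two forms -/

namespace PartialSections

section InteriorProduct

variable {E : Type*} [NormedAddCommGroup E] [NormedSpace ℝ E]
  {H : Type*} [TopologicalSpace H] {I : ModelWithCorners ℝ E H}
  {M : Type*} [TopologicalSpace M] [ChartedSpace H M] {k : ℕ}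

theorem IsSmoothForm.neg {η : DiffForm I M k} (hη : IsSmoothForm η) :
    IsSmoothForm (fun x => -η x) := fun x₀ => (hη x₀).neg.congr fun _ _ => rfl

theorem extD_neg (η : DiffForm I M k) (x : M) : extD (fun x => -η x) x = -extD η x := by
  have h : formInChart (fun x => -η x) x = -formInChart η x := rfl
  have h2 : extDerivWithin (-formInChart η x) (range I) (extChartAt I x x) =
      - extDerivWithin (formInChart η x) (range I) (extChartAt I x x) := by
    have := extDerivWithin_smul (-1 : ℝ) (formInChart η x)
      (I.uniqueDiffOn (extChartAt I x x) (extChartAt_mem_range x x))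
    simpa using this
  rw [extD, h, h2]
  rfl

theorem continuousAt_formInChart_apply {η : DiffForm I M k} (hη : IsSmoothForm η) (x₀ : M)
    (v : Fin k → E) :
    ContinuousAt (fun x => formInChart η x₀ (extChartAt I x₀ x) v) x₀ := by
  have h1 : ContMDiffWithinAt I 𝓘(ℝ, E) ∞ (extChartAt I x₀) univ x₀ := contMDiffAt_extChartAt
  have h2 : ContinuousWithinAt (fun y => formInChart η x₀ y v) (range I)
      (extChartAt I x₀ x₀) := by
    have h := (((hη x₀) _ (mem_extChartAt_target x₀)).mono_of_mem_nhdsWithin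
      (extChartAt_target_mem_nhdsWithin x₀))
    exact (h.continuousAlternatingMap_apply (v := fun i _ => v i)
      (fun i => contDiffWithinAt_const)).continuousWithinAt
  exact (continuousWithinAt_univ _ _).1
    (h2.comp h1.continuousWithinAt (fun x _ => extChartAt_mem_range x₀ x))

theorem formInChart_apply_extChartAt (η : DiffForm I M k) {x₀ x : M}
    (hx : x ∈ (extChartAt I x₀).source) (v : Fin k → E) :
    formInChart η x₀ (extChartAt I x₀ x) v = η x (fun i =>
      (mfderivWithin 𝓘(ℝ, E) I (extChartAt I x₀).symm (range I) (extChartAt I x₀ x) (v i) : E)) :=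
  DiffForm.apply_congr η ((extChartAt I x₀).left_inv hx) _

variable [IsManifold I ∞ M]

/-- Over a chart domain the trivialization of the tangent bundle is the derivative of the chart, so
smoothness as a section of the bundle is smoothness of the coordinate expression. -/
theorem contDiffOn_field_inChart {X : ∀ x : M, TangentSpace I x}
    (hX : ContMDiff I I.tangent ∞ (fun x => (⟨x, X x⟩ : TangentBundle I M))) (x₀ : M) :
    ContDiffOn ℝ ∞ (fun y => (mfderiv I 𝓘(ℝ, E) (extChartAt I x₀) ((extChartAt I x₀).symm y)
      (X ((extChartAt I x₀).symm y)) : E)) (extChartAt I x₀).target := by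
  have h1 : ContMDiffOn I 𝓘(ℝ, E) ∞
      (fun x => (mfderiv I 𝓘(ℝ, E) (extChartAt I x₀) x (X x) : E)) (extChartAt I x₀).source := by
    intro x hx
    rw [extChartAt_source] at hx
    have h2 : (⟨x, X x⟩ : TangentBundle I M) ∈
        (trivializationAt E (TangentSpace I) x₀).source := by
      rw [Bundle.Trivialization.mem_source, TangentBundle.trivializationAt_baseSet]
      exact hx
    have h3 := ((Bundle.Trivialization.contMDiffAt_iff (IB := I) (n := ∞)
      (f := fun x => (⟨x, X x⟩ : TangentBundle I M)) (x₀ := x) h2).1 (hX x)).2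
    refine h3.contMDiffWithinAt.congr_of_eventuallyEq_of_mem ?_ (by rwa [extChartAt_source])
    filter_upwards [self_mem_nhdsWithin] with y hy
    rw [extChartAt_source] at hy
    have h4 := DFunLike.congr_fun
      (TangentBundle.continuousLinearMapAt_trivializationAt (I := I) hy) (X y)
    refine h4.symm.trans ?_
    have h5 : y ∈ (trivializationAt E (TangentSpace I) x₀).baseSet := by
      rw [TangentBundle.trivializationAt_baseSet]; exact hy
    exact congrFun (Bundle.Trivialization.coe_linearMapAt_of_mem (R := ℝ) _ h5) (X y)
  exact contMDiffOn_iff_contDiffOn.1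
    (h1.comp (contMDiffOn_extChartAt_symm x₀) (fun y hy => (extChartAt I x₀).map_target hy))

theorem IsSmoothForm.interiorProd {X : ∀ x : M, TangentSpace I x}
    (hX : ContMDiff I I.tangent ∞ (fun x => (⟨x, X x⟩ : TangentBundle I M)))
    {η : DiffForm I M (k + 1)} (hη : IsSmoothForm η) : IsSmoothForm (interiorProd X η) := by
  intro x₀
  let L : (E [⋀^Fin (k + 1)]→L[ℝ] ℝ) →L[ℝ] (E →L[ℝ] E [⋀^Fin k]→L[ℝ] ℝ) :=
    ContinuousAlternatingMap.curryLeftLI.toContinuousLinearMap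
  have hL : ContDiff ℝ ∞ L := by fun_prop
  have h0 : ContDiffOn ℝ ∞ (fun y => L (formInChart η x₀ y)) (extChartAt I x₀).target :=
    hL.comp_contDiffOn (hη x₀)
  refine (h0.clm_apply (contDiffOn_field_inChart hX x₀)).congr fun y hy => ?_
  ext v
  have h1 := DFunLike.congr_fun
    (mfderivWithin_extChartAt_symm_comp_mfderiv_extChartAt (I := I) hy)
    (X ((extChartAt I x₀).symm y))
  refine congrArg (η ((extChartAt I x₀).symm y)) (funext fun i => ?_)
  refine Fin.cases ?_ (fun j => ?_) i
  · exact h1.symm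
  · rfl

theorem formInChart_apply_mfderiv (η : DiffForm I M k) {x₀ x : M}
    (hx : x ∈ (extChartAt I x₀).source) (v : Fin k → TangentSpace I x) :
    formInChart η x₀ (extChartAt I x₀ x)
      (fun i => mfderiv I 𝓘(ℝ, E) (extChartAt I x₀) x (v i)) = η x v := by
  refine (formInChart_apply_extChartAt η hx _).trans (congrArg (η x) (funext fun i => ?_))
  exact DFunLike.congr_fun (mfderivWithin_extChartAt_symm_comp_mfderiv_extChartAt' hx) (v i)

/-- The set where two smooth forms are somewhere of the same sign is open. -/
theorem isOpen_setOf_mul_pos {η₁ η₂ : DiffForm I M k} (h₁ : IsSmoothForm η₁)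
    (h₂ : IsSmoothForm η₂) :
    IsOpen {x : M | ∃ v : Fin k → TangentSpace I x, 0 < η₁ x v * η₂ x v} := by
  rw [isOpen_iff_mem_nhds]
  rintro x₀ ⟨v, hv⟩
  -- The frame is continued to nearby points with constant coordinates in the chart at `x₀`;
  -- positivity of the product then persists by continuity.
  set w : Fin k → E := fun i => mfderiv I 𝓘(ℝ, E) (extChartAt I x₀) x₀ (v i)
  have h := (continuousAt_formInChart_apply h₁ x₀ w).fun_mul (continuousAt_formInChart_apply h₂ x₀ w)
  have h0 : 0 < formInChart η₁ x₀ (extChartAt I x₀ x₀) w *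
      formInChart η₂ x₀ (extChartAt I x₀ x₀) w := by
    have e1 : formInChart η₁ x₀ (extChartAt I x₀ x₀) w = η₁ x₀ v :=
      formInChart_apply_mfderiv η₁ (mem_extChartAt_source x₀) v
    have e2 : formInChart η₂ x₀ (extChartAt I x₀ x₀) w = η₂ x₀ v :=
      formInChart_apply_mfderiv η₂ (mem_extChartAt_source x₀) v
    rw [e1, e2]
    exact hv
  filter_upwards [h.eventually (lt_mem_nhds h0), extChartAt_source_mem_nhds (I := I) x₀]
    with x hx hx'
  refine ⟨fun i =>
      (mfderivWithin 𝓘(ℝ, E) I (extChartAt I x₀).symm (range I) (extChartAt I x₀ x) (w i) : E), ?_⟩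
  rw [formInChart_apply_extChartAt η₁ hx', formInChart_apply_extChartAt η₂ hx'] at hx
  exact hx

end InteriorProduct

end PartialSections

/-! ### Pullbacks under maps between manifolds -/

namespace PartialSections

section PullbackForm

variable {E : Type*} [NormedAddCommGroup E] [NormedSpace ℝ E]
  {H : Type*} [TopologicalSpace H] {I : ModelWithCorners ℝ E H}
  {M : Type*} [TopologicalSpace M] [ChartedSpace H M] [IsManifold I ∞ M]
  {E' : Type*} [NormedAddCommGroup E'] [NormedSpace ℝ E']
  {H' : Type*} [TopologicalSpace H'] {J : ModelWithCorners ℝ E' H'}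
  {S : Type*} [TopologicalSpace S] [ChartedSpace H' S]
  {V : Type*} [NormedAddCommGroup V] [NormedSpace ℝ V] {k : ℕ}

/-- The pullback of a form under a map between manifolds. -/
noncomputable def pullbackForm (J : ModelWithCorners ℝ E' H') {S : Type*} [TopologicalSpace S]
    [ChartedSpace H' S] (η : DiffForm I M k) (f : S → M) : DiffForm J S k :=
  fun p => (η (f p)).compContinuousLinearMap (mfderiv J I f p)

omit [IsManifold I ∞ M] in
theorem pullbackWithin_pullbackForm (η : DiffForm I M k) {f : S → M} {g : V → S} {s : Set V}
    {z : V} (hs : UniqueDiffWithinAt ℝ s z) (hf : MDifferentiableAt J I f (g z))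
    (hg : MDifferentiableWithinAt 𝓘(ℝ, V) J g s z) :
    pullbackWithin (pullbackForm J η f) g s z = pullbackWithin η (f ∘ g) s z := by
  have h := mfderiv_comp_mfderivWithin z hf hg hs.uniqueMDiffWithinAt
  ext v
  exact congrArg (η (f (g z))) (funext fun i => (DFunLike.congr_fun h (v i)).symm)

theorem IsSmoothForm.pullbackForm_one [IsManifold J ∞ S] {η : DiffForm I M 1}
    (hη : IsSmoothForm η) {f : S → M} (hf : ContMDiff J I ∞ f) :
    IsSmoothForm (pullbackForm J η f) := by
  intro x₀ y hy
  have hr := extChartAt_target_subset_range x₀ hy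
  have hg : ∀ y ∈ (extChartAt J x₀).target,
      ContMDiffWithinAt 𝓘(ℝ, E') J ∞ (extChartAt J x₀).symm (range J) y :=
    fun y hy => contMDiffWithinAt_extChartAt_symm_range x₀ hy
  have h1 := hη.contDiffWithinAt_pullbackWithin_one J.uniqueDiffOn hr
    ((hf.contMDiffAt).comp_contMDiffWithinAt y (hg y hy))
  have h2 : ∀ z ∈ (extChartAt J x₀).target, formInChart (pullbackForm J η f) x₀ z =
      pullbackWithin η (f ∘ (extChartAt J x₀).symm) (range J) z := fun z hz =>
    pullbackWithin_pullbackForm η (J.uniqueDiffOn z (extChartAt_target_subset_range x₀ hz))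
      (hf.mdifferentiableAt (by simp)) ((hg z hz).mdifferentiableWithinAt (by simp))
  exact (h1.mono (extChartAt_target_subset_range x₀)).congr h2 (h2 y hy)

theorem IsSmoothForm.smul_fun [IsManifold J ∞ S] {η : DiffForm J S k} (hη : IsSmoothForm η)
    {ρ : S → ℝ} (hρ : ContMDiff J 𝓘(ℝ, ℝ) ∞ ρ) :
    IsSmoothForm (fun p => ρ p • η p) := by
  intro x₀
  have h1 : ContDiffOn ℝ ∞ (ρ ∘ (extChartAt J x₀).symm) (extChartAt J x₀).target :=
    contMDiffOn_iff_contDiffOn.1 (hρ.comp_contMDiffOn (contMDiffOn_extChartAt_symm x₀))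
  exact (h1.smul (hη x₀)).congr fun y _ => rfl

/-- In the chart of the source at `p`, the pulled back form is the pullback under `f` composed with
the inverse chart. This map is defined on a subset of a vector space, where naturality is known. -/
theorem IsSmoothForm.extD_pullbackForm_one [IsManifold J ∞ S] {η : DiffForm I M 1}
    (hη : IsSmoothForm η) {f : S → M} (hf : ContMDiff J I ∞ f) (p : S) :
    PartialSections.extD (pullbackForm J η f) p = pullbackForm J (PartialSections.extD η) f p := by
  have hp := mem_extChartAt_target (I := J) p
  have hr := extChartAt_target_subset_range p hp
  have hg : ∀ y ∈ (extChartAt J p).target,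
      ContMDiffWithinAt 𝓘(ℝ, E') J ∞ (extChartAt J p).symm (range J) y :=
    fun y hy => contMDiffWithinAt_extChartAt_symm_range p hy
  have h2 : ∀ z ∈ (extChartAt J p).target, formInChart (pullbackForm J η f) p z =
      pullbackWithin η (f ∘ (extChartAt J p).symm) (range J) z := fun z hz =>
    pullbackWithin_pullbackForm η (J.uniqueDiffOn z (extChartAt_target_subset_range p hz))
      (hf.mdifferentiableAt (by simp)) ((hg z hz).mdifferentiableWithinAt (by simp))
  have h3 : formInChart (pullbackForm J η f) p =ᶠ[𝓝[range J] (extChartAt J p p)]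
      pullbackWithin η (f ∘ (extChartAt J p).symm) (range J) := by
    filter_upwards [extChartAt_target_mem_nhdsWithin (I := J) p] with z hz using h2 z hz
  have h4 := hη.extDerivWithin_pullbackWithin J.uniqueDiffOn hr (J.range_subset_closure_interior hr)
    ((hf.contMDiffAt).comp_contMDiffWithinAt _ (hg _ hp))
  rw [← pullbackWithin_pullbackForm (PartialSections.extD η) (J.uniqueDiffOn _ hr)
    (hf.mdifferentiableAt (by simp)) ((hg _ hp).mdifferentiableWithinAt (by simp))] at h4
  rw [PartialSections.extD, h3.extDerivWithin_eq_of_mem hr, h4]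
  ext v
  refine Eq.trans ?_ (formInChart_apply_mfderiv _ (mem_extChartAt_source p) v)
  rfl

end PullbackForm

/-! ### Charts of a surface with values in the closed half-plane -/

section HalfPlane

/-- The closed half-plane. -/
def halfPlane : Set (ℝ × ℝ) := {q | 0 ≤ q.1}

/-- The plane, as a Euclidean space. -/
noncomputable def planeEquiv : (ℝ × ℝ) ≃L[ℝ] EuclideanSpace ℝ (Fin 2) :=
  (ContinuousLinearEquiv.finTwoArrow ℝ ℝ).symm.trans (EuclideanSpace.equiv (Fin 2) ℝ).symm

theorem interior_halfPlane : interior halfPlane = {q | 0 < q.1} := by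
  have : halfPlane = Prod.fst ⁻¹' Ici (0 : ℝ) := rfl
  rw [this, ← isOpenMap_fst.preimage_interior_eq_interior_preimage continuous_fst, interior_Ici]
  rfl

theorem isOpen_interior_halfPlane : IsOpen {q : ℝ × ℝ | 0 < q.1} :=
  isOpen_lt continuous_const continuous_fst

theorem convex_halfPlane : Convex ℝ halfPlane :=
  (convex_Ici (0 : ℝ)).is_linear_preimage (IsLinearMap.mk (fun _ _ => rfl) (fun _ _ => rfl))

theorem uniqueDiffOn_halfPlane : UniqueDiffOn ℝ halfPlane :=
  uniqueDiffOn_convex convex_halfPlane ⟨(1, 0), by rw [interior_halfPlane]; simp⟩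

theorem subset_closure_interior_halfPlane : halfPlane ⊆ closure (interior halfPlane) := by
  rw [convex_halfPlane.closure_interior_eq_closure_of_nonempty_interior
    ⟨(1, 0), by rw [interior_halfPlane]; simp⟩]
  exact subset_closure

theorem preimage_planeEquiv_range : planeEquiv ⁻¹' range (𝓡∂ 2) = halfPlane := by
  rw [range_modelWithCornersEuclideanHalfSpace]
  rfl

variable {S : Type*} [TopologicalSpace S] [ChartedSpace (EuclideanHalfSpace 2) S]

/-- The chart of a surface at `x`, with values in the plane. -/
noncomputable def halfChart (x p : S) : ℝ × ℝ := planeEquiv.symm (extChartAt (𝓡∂ 2) x p)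

/-- The inverse of the chart of a surface at `x`. -/
noncomputable def halfParam (x : S) (q : ℝ × ℝ) : S := (extChartAt (𝓡∂ 2) x).symm (planeEquiv q)

/-- The target of the chart of a surface at `x`. -/
def halfDomain (x : S) : Set (ℝ × ℝ) := planeEquiv ⁻¹' (extChartAt (𝓡∂ 2) x).target

theorem halfDomain_subset (x : S) : halfDomain x ⊆ halfPlane := by
  rw [← preimage_planeEquiv_range]
  exact preimage_mono (extChartAt_target_subset_range x)

theorem halfDomain_mem_nhdsWithin {x : S} {q : ℝ × ℝ} (hq : q ∈ halfDomain x) :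
    halfDomain x ∈ 𝓝[halfPlane] q := by
  rw [← preimage_planeEquiv_range]
  have h := extChartAt_target_mem_nhdsWithin_of_mem (I := 𝓡∂ 2) hq
  have h2 : Filter.Tendsto planeEquiv (𝓝[planeEquiv ⁻¹' range (𝓡∂ 2)] q)
      (𝓝[range (𝓡∂ 2)] (planeEquiv q)) :=
    planeEquiv.continuous.continuousWithinAt.tendsto_nhdsWithin (fun _ h => h)
  exact h2 h

theorem halfParam_mem_source {x : S} {q : ℝ × ℝ} (hq : q ∈ halfDomain x) :
    halfParam x q ∈ (chartAt (EuclideanHalfSpace 2) x).source := by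
  rw [← extChartAt_source (𝓡∂ 2)]
  exact (extChartAt (𝓡∂ 2) x).map_target hq

theorem halfChart_mem {x p : S} (hp : p ∈ (chartAt (EuclideanHalfSpace 2) x).source) :
    halfChart x p ∈ halfDomain x := by
  rw [← extChartAt_source (𝓡∂ 2)] at hp
  rw [halfDomain, mem_preimage, halfChart, planeEquiv.apply_symm_apply]
  exact (extChartAt (𝓡∂ 2) x).map_source hp

theorem halfParam_halfChart {x p : S} (hp : p ∈ (chartAt (EuclideanHalfSpace 2) x).source) :
    halfParam x (halfChart x p) = p := by
  rw [← extChartAt_source (𝓡∂ 2)] at hp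
  rw [halfParam, halfChart, planeEquiv.apply_symm_apply, (extChartAt (𝓡∂ 2) x).left_inv hp]

theorem halfChart_halfParam {x : S} {q : ℝ × ℝ} (hq : q ∈ halfDomain x) :
    halfChart x (halfParam x q) = q := by
  rw [halfParam, halfChart, (extChartAt (𝓡∂ 2) x).right_inv hq]
  exact planeEquiv.symm_apply_apply q

theorem halfChart_mem_halfPlane (x p : S) : halfChart x p ∈ halfPlane := by
  rw [← preimage_planeEquiv_range]
  rw [mem_preimage, halfChart, planeEquiv.apply_symm_apply]
  exact extChartAt_mem_range x p

theorem planeEquiv_halfChart (x p : S) : planeEquiv (halfChart x p) = extChartAt (𝓡∂ 2) x p :=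
  planeEquiv.apply_symm_apply _

theorem continuousOn_halfChart (x : S) :
    ContinuousOn (halfChart x) (chartAt (EuclideanHalfSpace 2) x).source := by
  rw [← extChartAt_source (𝓡∂ 2)]
  exact planeEquiv.symm.continuous.comp_continuousOn (continuousOn_extChartAt x)

variable [IsManifold (𝓡∂ 2) ∞ S]

/-- Being an interior point does not depend on the chart, so every chart detects the boundary as the
line where the first coordinate vanishes. -/
theorem halfParam_mem_interior_iff {x : S} {q : ℝ × ℝ} (hq : q ∈ halfDomain x) :
    halfParam x q ∈ (𝓡∂ 2).interior S ↔ 0 < q.1 := by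
  have h := (𝓡∂ 2).isInteriorPoint_iff_of_mem_atlas (M := S) (n := ∞) (by simp)
    (chart_mem_atlas _ x) (halfParam_mem_source hq)
  have h1 : (chartAt (EuclideanHalfSpace 2) x).extend (𝓡∂ 2) (halfParam x q) = planeEquiv q :=
    (extChartAt (𝓡∂ 2) x).right_inv hq
  have h2 : (chartAt (EuclideanHalfSpace 2) x).extend (𝓡∂ 2) = extChartAt (𝓡∂ 2) x := rfl
  rw [h1, h2] at h
  change (𝓡∂ 2).IsInteriorPoint _ ↔ _
  rw [h, mem_interior_iff_mem_nhds]
  constructor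
  · intro h3
    have h4 : range (𝓡∂ 2) ∈ 𝓝 (planeEquiv q) :=
      Filter.mem_of_superset h3 (extChartAt_target_subset_range x)
    rw [← mem_interior_iff_mem_nhds, interior_range_modelWithCornersEuclideanHalfSpace] at h4
    exact h4
  · intro h3
    have h4 : range (𝓡∂ 2) ∈ 𝓝 (planeEquiv q) := by
      rw [← mem_interior_iff_mem_nhds, interior_range_modelWithCornersEuclideanHalfSpace]
      exact h3
    have h5 := extChartAt_target_mem_nhdsWithin_of_mem (I := 𝓡∂ 2) hq
    rwa [nhdsWithin_eq_nhds.2 h4] at h5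

theorem contMDiffWithinAt_halfParam {x : S} {q : ℝ × ℝ} (hq : q ∈ halfDomain x) :
    ContMDiffWithinAt 𝓘(ℝ, ℝ × ℝ) (𝓡∂ 2) ∞ (halfParam x) halfPlane q := by
  have h1 : ContMDiffWithinAt 𝓘(ℝ, EuclideanSpace ℝ (Fin 2)) (𝓡∂ 2) ∞ (extChartAt (𝓡∂ 2) x).symm
      (range (𝓡∂ 2)) (planeEquiv q) := contMDiffWithinAt_extChartAt_symm_range x hq
  have h2 : ContMDiffWithinAt 𝓘(ℝ, ℝ × ℝ) 𝓘(ℝ, EuclideanSpace ℝ (Fin 2)) ∞ planeEquiv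
      halfPlane q := (planeEquiv.contDiff.contMDiff q).contMDiffWithinAt
  refine h1.comp q h2 ?_
  rw [← preimage_planeEquiv_range]
  exact fun _ h => h

theorem continuousOn_halfParam (x : S) : ContinuousOn (halfParam x) (halfDomain x) := fun _ hq =>
  ((contMDiffWithinAt_halfParam hq).continuousWithinAt).mono (halfDomain_subset x)

theorem contDiffWithinAt_halfChart_comp {V : Type*} [NormedAddCommGroup V] [NormedSpace ℝ V]
    {g : V → S} {s : Set V} {z : V} {x : S} (hg : ContMDiffWithinAt 𝓘(ℝ, V) (𝓡∂ 2) ∞ g s z)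
    (hx : g z ∈ (chartAt (EuclideanHalfSpace 2) x).source) :
    ContDiffWithinAt ℝ ∞ (fun z => halfChart x (g z)) s z :=
  planeEquiv.symm.contDiff.comp_contDiffWithinAt (contMDiffWithinAt_extChartAt_comp hg hx)

/-- The transition map from the chart at `x` to the chart at `y`. -/
noncomputable def halfTransition (x y : S) (q : ℝ × ℝ) : ℝ × ℝ := halfChart y (halfParam x q)

variable {k : ℕ}

theorem pullbackWithin_halfParam_eq_formInChart (η : DiffForm (𝓡∂ 2) S k) {x y : S} {q : ℝ × ℝ}
    (hq : q ∈ halfDomain x) (hy : halfParam x q ∈ (chartAt (EuclideanHalfSpace 2) y).source) :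
    pullbackWithin η (halfParam x) halfPlane q =
      (formInChart η y (planeEquiv (halfTransition x y q))).compContinuousLinearMap
        ((planeEquiv : ℝ × ℝ →L[ℝ] EuclideanSpace ℝ (Fin 2)).comp
          (fderivWithin ℝ (halfTransition x y) halfPlane q)) := by
  have hU := uniqueDiffOn_halfPlane q (halfDomain_subset x hq)
  rw [pullbackWithin_eq_formInChart η hU
    ((contMDiffWithinAt_halfParam hq).mdifferentiableWithinAt (by simp)) hy]
  have h1 : (fun z => extChartAt (𝓡∂ 2) y (halfParam x z)) =
      planeEquiv ∘ halfTransition x y := funext fun z => (planeEquiv_halfChart y _).symm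
  rw [h1, planeEquiv.comp_fderivWithin hU, ← planeEquiv_halfChart]
  rfl

theorem pullbackWithin_halfParam (η : DiffForm (𝓡∂ 2) S k) {x : S} {q : ℝ × ℝ}
    (hq : q ∈ halfDomain x) :
    pullbackWithin η (halfParam x) halfPlane q =
      (formInChart η x (planeEquiv q)).compContinuousLinearMap
        (planeEquiv : ℝ × ℝ →L[ℝ] EuclideanSpace ℝ (Fin 2)) := by
  have h2 : halfTransition x x q = q := halfChart_halfParam hq
  have h3 : fderivWithin ℝ (halfTransition x x) halfPlane q = ContinuousLinearMap.id ℝ _ := by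
    have h4 : halfTransition x x =ᶠ[𝓝[halfPlane] q] id := by
      filter_upwards [halfDomain_mem_nhdsWithin hq] with z hz
      exact halfChart_halfParam hz
    rw [h4.fderivWithin_eq h2]
    exact fderivWithin_id (uniqueDiffOn_halfPlane _ (halfDomain_subset x hq))
  rw [pullbackWithin_halfParam_eq_formInChart η hq (halfParam_mem_source hq), h2, h3]
  rfl

/-- The chain rule for a change of charts; all transformation rules for integrals come from it. -/
theorem pullbackWithin_halfParam_eq (η : DiffForm (𝓡∂ 2) S k) {x y : S} {q : ℝ × ℝ}
    (hq : q ∈ halfDomain x) (hy : halfParam x q ∈ (chartAt (EuclideanHalfSpace 2) y).source) :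
    pullbackWithin η (halfParam x) halfPlane q =
      (pullbackWithin η (halfParam y) halfPlane (halfTransition x y q)).compContinuousLinearMap
        (fderivWithin ℝ (halfTransition x y) halfPlane q) := by
  have h : halfTransition x y q ∈ halfDomain y := halfChart_mem hy
  rw [pullbackWithin_halfParam_eq_formInChart η hq hy, pullbackWithin_halfParam η h]
  rfl

theorem eq_zero_of_pullbackWithin_halfParam {η : DiffForm (𝓡∂ 2) S k} {x : S} {q : ℝ × ℝ}
    (hq : q ∈ halfDomain x) (h : pullbackWithin η (halfParam x) halfPlane q = 0) :
    η (halfParam x q) = 0 := by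
  rw [pullbackWithin_halfParam η hq] at h
  have hsource : halfParam x q ∈ (extChartAt (𝓡∂ 2) x).source := by
    rw [extChartAt_source]; exact halfParam_mem_source hq
  ext v
  refine (formInChart_apply_mfderiv η hsource v).symm.trans ?_
  set w : Fin k → EuclideanSpace ℝ (Fin 2) := fun i =>
    mfderiv (𝓡∂ 2) 𝓘(ℝ, EuclideanSpace ℝ (Fin 2)) (extChartAt (𝓡∂ 2) x) (halfParam x q) (v i)
  have h1 := DFunLike.congr_fun h (fun i => planeEquiv.symm (w i))
  have h2 : extChartAt (𝓡∂ 2) x (halfParam x q) = planeEquiv q :=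
    (extChartAt (𝓡∂ 2) x).right_inv hq
  rw [h2]
  simpa [Function.comp_def] using h1

end HalfPlane

end PartialSections

/-! ### Two-forms on the plane and Green's formula -/

section PlanarStokes

open MeasureTheory PartialSections

theorem ContinuousAlternatingMap.apply_plane (F : (ℝ × ℝ) [⋀^Fin 2]→L[ℝ] ℝ)
    (v : Fin 2 → ℝ × ℝ) :
    F v = F ![(1, 0), (0, 1)] * (Module.Basis.finTwoProd ℝ).det v := by
  have h := AlternatingMap.eq_smul_basis_det (Module.Basis.finTwoProd ℝ) F.toAlternatingMap
  have h1 : F v = F.toAlternatingMap (Module.Basis.finTwoProd ℝ) *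
      (Module.Basis.finTwoProd ℝ).det v := DFunLike.congr_fun h v
  have h2 : (⇑(Module.Basis.finTwoProd ℝ) : Fin 2 → ℝ × ℝ) = ![(1, 0), (0, 1)] := by
    ext i <;> fin_cases i <;> simp
  rw [h1, h2]
  rfl

theorem ContinuousAlternatingMap.map_comp_plane (F : (ℝ × ℝ) [⋀^Fin 2]→L[ℝ] ℝ)
    (L : (ℝ × ℝ) →L[ℝ] (ℝ × ℝ)) (v : Fin 2 → ℝ × ℝ) :
    F (fun i => L (v i)) = L.det * F v := by
  have h2 := Module.Basis.det_comp (Module.Basis.finTwoProd ℝ) (L : (ℝ × ℝ) →ₗ[ℝ] (ℝ × ℝ)) v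
  have h3 : (fun i => L (v i)) = (L : (ℝ × ℝ) →ₗ[ℝ] (ℝ × ℝ)) ∘ v := rfl
  rw [F.apply_plane, F.apply_plane v, h3, h2, ContinuousLinearMap.det]
  ring

theorem ContinuousAlternatingMap.eq_zero_of_plane {F : (ℝ × ℝ) [⋀^Fin 2]→L[ℝ] ℝ}
    (h : F ![(1, 0), (0, 1)] = 0) : F = 0 := by
  ext v
  rw [F.apply_plane, h, zero_mul]
  rfl

theorem measurableSet_halfPlane : MeasurableSet halfPlane :=
  (isClosed_le continuous_const continuous_fst).measurableSet

theorem setIntegral_interior_halfPlane (F : ℝ × ℝ → ℝ) :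
    ∫ q in {q : ℝ × ℝ | 0 < q.1}, F q = ∫ q in halfPlane, F q := by
  rw [← interior_halfPlane]
  exact setIntegral_congr_set (interior_ae_eq_of_null_frontier
    (convex_halfPlane.addHaar_frontier volume))

/-- Green's formula in the half-plane, as an inequality. -/
theorem integral_halfPlane_nonpos {b₀ b₁ : ℝ × ℝ → ℝ} (h₀ : ContDiffOn ℝ 1 b₀ halfPlane)
    (h₁ : ContDiffOn ℝ 1 b₁ halfPlane) {R : ℝ} (hR : 0 < R)
    (hb₀ : ∀ q ∈ halfPlane, R ≤ ‖q‖ → b₀ q = 0) (hb₁ : ∀ q ∈ halfPlane, R ≤ ‖q‖ → b₁ q = 0)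
    (hpos : ∀ y, 0 ≤ b₁ (0, y)) :
    ∫ q in {q : ℝ × ℝ | 0 < q.1},
      (fderivWithin ℝ b₁ halfPlane q (1, 0) - fderivWithin ℝ b₀ halfPlane q (0, 1)) ≤ 0 := by
  have hbox : Icc ((0 : ℝ), -R) (R, R) ⊆ halfPlane := fun q hq => hq.1.1
  have hcont : ∀ {b : ℝ × ℝ → ℝ}, ContDiffOn ℝ 1 b halfPlane → ∀ v,
      ContinuousOn (fun q => fderivWithin ℝ b halfPlane q v) halfPlane := fun hb v =>
    (hb.continuousOn_fderivWithin uniqueDiffOn_halfPlane le_rfl).clm_apply continuousOn_const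
  have hderiv : ∀ {b : ℝ × ℝ → ℝ}, ContDiffOn ℝ 1 b halfPlane →
      ∀ q ∈ Ioo (0 : ℝ) R ×ˢ Ioo (-R) R, HasFDerivAt b (fderivWithin ℝ b halfPlane q) q := by
    intro b hb q hq
    have hm : halfPlane ∈ 𝓝 q := by
      rw [← mem_interior_iff_mem_nhds, interior_halfPlane]; exact hq.1.1
    exact ((hb.differentiableOn one_ne_zero q hq.1.1.le).hasFDerivWithinAt).hasFDerivAt hm
  have hdiv := integral_divergence_prod_Icc_of_hasFDerivAt_of_le b₁ (fun q => -b₀ q)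
    (fderivWithin ℝ b₁ halfPlane) (fun q => -fderivWithin ℝ b₀ halfPlane q) ((0 : ℝ), -R) (R, R)
    ⟨hR.le, by simp; linarith⟩ (h₁.continuousOn.mono hbox) (h₀.continuousOn.mono hbox).neg
    (hderiv h₁) (fun q hq => (hderiv h₀ q hq).neg)
    (((hcont h₁ (1, 0)).add ((hcont h₀ (0, 1)).neg)).mono hbox |>.integrableOn_compact
      isCompact_Icc)
  have hzero : ∀ q ∈ halfPlane \ Icc ((0 : ℝ), -R) (R, R),
      fderivWithin ℝ b₁ halfPlane q (1, 0) - fderivWithin ℝ b₀ halfPlane q (0, 1) = 0 := by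
    rintro q ⟨hq, hq'⟩
    have hn : R < ‖q‖ := by
      by_contra! hle
      have h1 := (abs_le.1 ((norm_fst_le q).trans hle))
      have h2 := (abs_le.1 ((norm_snd_le q).trans hle))
      exact hq' ⟨⟨hq, h2.1⟩, ⟨h1.2, h2.2⟩⟩
    have hev : ∀ {b : ℝ × ℝ → ℝ}, (∀ q ∈ halfPlane, R ≤ ‖q‖ → b q = 0) →
        fderivWithin ℝ b halfPlane q = 0 := by
      intro b hb
      have h1 : b =ᶠ[𝓝[halfPlane] q] fun _ => 0 := by
        filter_upwards [self_mem_nhdsWithin,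
          mem_nhdsWithin_of_mem_nhds (continuous_norm.tendsto q |>.eventually (lt_mem_nhds hn))]
          with z hz hz'
        exact hb z hz hz'.le
      rw [h1.fderivWithin_eq (hb q hq hn.le)]
      simp
    rw [hev hb₀, hev hb₁]
    simp
  rw [setIntegral_interior_halfPlane, setIntegral_eq_of_subset_of_forall_sdiff_eq_zero
    measurableSet_halfPlane hbox hzero]
  have e1 : ∀ q : ℝ × ℝ, fderivWithin ℝ b₁ halfPlane q (1, 0) -
      fderivWithin ℝ b₀ halfPlane q (0, 1) = fderivWithin ℝ b₁ halfPlane q (1, 0) +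
        (-fderivWithin ℝ b₀ halfPlane q) (0, 1) := fun q => by
    rw [neg_apply]; ring
  simp_rw [e1]
  rw [hdiv]
  have hN1 : ∀ x ∈ uIcc 0 R, b₀ (x, R) = 0 ∧ b₀ (x, -R) = 0 := by
    intro x hx
    rw [uIcc_of_le hR.le] at hx
    refine ⟨hb₀ _ hx.1 ?_, hb₀ _ hx.1 ?_⟩
    · exact (le_abs_self R).trans (norm_snd_le (x, R))
    · exact (le_abs_self R).trans ((abs_neg R).symm.le.trans (norm_snd_le (x, -R)))
  have i1 : ∫ x in (0 : ℝ)..R, -b₀ (x, R) = 0 := by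
    rw [intervalIntegral.integral_congr (g := fun _ => (0 : ℝ)) (fun x hx => by simp [hN1 x hx])]
    simp
  have i2 : ∫ x in (0 : ℝ)..R, -b₀ (x, -R) = 0 := by
    rw [intervalIntegral.integral_congr (g := fun _ => (0 : ℝ)) (fun x hx => by simp [hN1 x hx])]
    simp
  have i3 : ∫ y in (-R)..R, b₁ (R, y) = 0 := by
    rw [intervalIntegral.integral_congr (g := fun _ => (0 : ℝ)) (fun y _ => ?_)]
    · simp
    · exact hb₁ (R, y) hR.le ((le_abs_self R).trans (norm_fst_le (R, y)))
  -- Of the four sides of the box only the one on the boundary line contributes, with a minus sign.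
  have i4 : 0 ≤ ∫ y in (-R)..R, b₁ (0, y) :=
    intervalIntegral.integral_nonneg (by linarith) (fun y _ => hpos y)
  simp only [i1, i2, i3]
  linarith

end PlanarStokes

/-! ### Integration of two-forms in charts, relative to an orienting area form -/

namespace PartialSections

section SurfaceIntegral

open MeasureTheory

variable {S : Type*} [TopologicalSpace S] [ChartedSpace (EuclideanHalfSpace 2) S]

/-- The interior of the domain of the parametrization at `x`. -/
def halfInterior (x : S) : Set (ℝ × ℝ) := halfDomain x ∩ {q | 0 < q.1}

/-- The coefficient of a two-form in the chart at `x`. -/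
noncomputable def density (η : DiffForm (𝓡∂ 2) S 2) (x : S) (q : ℝ × ℝ) : ℝ :=
  pullbackWithin η (halfParam x) halfPlane q ![(1, 0), (0, 1)]

/-- The coefficient of a two-form in the chart at `x`, up to the sign that makes it relative to
the orientation `θ`. -/
noncomputable def orientedDensity (θ η : DiffForm (𝓡∂ 2) S 2) (x : S) (q : ℝ × ℝ) : ℝ :=
  density θ x q / |density θ x q| * density η x q

/-- The integral of a two-form over the domain of the chart at `x`, for the orientation `θ`. -/
noncomputable def chartIntegral (θ η : DiffForm (𝓡∂ 2) S 2) (x : S) : ℝ :=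
  ∫ q in halfInterior x, orientedDensity θ η x q

theorem isOpen_halfInterior (x : S) : IsOpen (halfInterior x) := by
  rw [isOpen_iff_mem_nhds]
  rintro q ⟨hq, hq'⟩
  have h1 : halfPlane ∈ 𝓝 q := by
    rw [← mem_interior_iff_mem_nhds, interior_halfPlane]; exact hq'
  have h2 := halfDomain_mem_nhdsWithin hq
  rw [nhdsWithin_eq_nhds.2 h1] at h2
  exact Filter.inter_mem h2 (isOpen_interior_halfPlane.mem_nhds hq')

theorem density_eq_zero {η : DiffForm (𝓡∂ 2) S 2} {x : S} {q : ℝ × ℝ}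
    (h : η (halfParam x q) = 0) : density η x q = 0 := by
  rw [density, pullbackWithin, h]; rfl

theorem isCompact_halfChart_image {x : S} {C : Set S} (hC : IsCompact C)
    (hx : C ⊆ (chartAt (EuclideanHalfSpace 2) x).source) : IsCompact (halfChart x '' C) :=
  hC.image_of_continuousOn ((continuousOn_halfChart x).mono hx)

theorem halfChart_image_subset {x : S} {C : Set S}
    (hx : C ⊆ (chartAt (EuclideanHalfSpace 2) x).source) : halfChart x '' C ⊆ halfDomain x := by
  rintro _ ⟨p, hp, rfl⟩
  exact halfChart_mem (hx hp)

theorem notMem_of_notMem_halfChart_image {x : S} {C : Set S} {q : ℝ × ℝ} (hq : q ∈ halfDomain x)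
    (h : q ∉ halfChart x '' C) : halfParam x q ∉ C := fun hC =>
  h ⟨_, hC, halfChart_halfParam hq⟩

variable [IsManifold (𝓡∂ 2) ∞ S] {θ η : DiffForm (𝓡∂ 2) S 2} {x y : S}

theorem density_ne_zero (hθ : ∀ p, θ p ≠ 0) {q : ℝ × ℝ} (hq : q ∈ halfDomain x) :
    density θ x q ≠ 0 := fun h =>
  hθ _ (eq_zero_of_pullbackWithin_halfParam hq (ContinuousAlternatingMap.eq_zero_of_plane h))

theorem density_transition (η : DiffForm (𝓡∂ 2) S 2) {q : ℝ × ℝ} (hq : q ∈ halfDomain x)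
    (hy : halfParam x q ∈ (chartAt (EuclideanHalfSpace 2) y).source) :
    density η x q = (fderivWithin ℝ (halfTransition x y) halfPlane q).det *
      density η y (halfTransition x y q) := by
  rw [density, pullbackWithin_halfParam_eq η hq hy]
  exact ContinuousAlternatingMap.map_comp_plane
    (pullbackWithin η (halfParam y) halfPlane (halfTransition x y q))
    (fderivWithin ℝ (halfTransition x y) halfPlane q) ![(1, 0), (0, 1)]

/-- The sign of the density of `θ` absorbs the sign of the Jacobian, so that its absolute value
appears, as in the change of variables formula. No chart has to be adapted to the orientation. -/
theorem orientedDensity_transition (θ η : DiffForm (𝓡∂ 2) S 2) {q : ℝ × ℝ}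
    (hq : q ∈ halfDomain x)
    (hy : halfParam x q ∈ (chartAt (EuclideanHalfSpace 2) y).source) :
    orientedDensity θ η x q = |(fderivWithin ℝ (halfTransition x y) halfPlane q).det| *
      orientedDensity θ η y (halfTransition x y q) := by
  rw [orientedDensity, orientedDensity, density_transition θ hq hy, density_transition η hq hy,
    abs_mul]
  set d := (fderivWithin ℝ (halfTransition x y) halfPlane q).det
  set A := density θ y (halfTransition x y q)
  set B := density η y (halfTransition x y q)
  have hd : d / |d| * d = |d| := by
    rcases eq_or_ne d 0 with h | h
    · simp [h]
    · rw [div_mul_eq_mul_div, ← sq, ← sq_abs, sq, mul_div_assoc, div_self (abs_ne_zero.2 h),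
        mul_one]
  calc d * A / (|d| * |A|) * (d * B) = (d / |d| * d) * (A / |A| * B) := by
        rw [mul_div_mul_comm]; ring
    _ = |d| * (A / |A| * B) := by rw [hd]

theorem IsSmoothForm.contDiffWithinAt_density (hη : IsSmoothForm η) {q : ℝ × ℝ}
    (hq : q ∈ halfDomain x) : ContDiffWithinAt ℝ ∞ (density η x) halfPlane q :=
  hη.contDiffWithinAt_pullbackWithin uniqueDiffOn_halfPlane (halfDomain_subset x hq)
    (contMDiffWithinAt_halfParam hq) _

theorem continuousOn_orientedDensity (hθ : IsVolumeForm θ) (hη : IsSmoothForm η) (x : S) :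
    ContinuousOn (orientedDensity θ η x) (halfDomain x) := by
  intro q hq
  have h1 := ((hθ.1.contDiffWithinAt_density hq).continuousWithinAt).mono (halfDomain_subset x)
  have h2 := ((hη.contDiffWithinAt_density hq).continuousWithinAt).mono (halfDomain_subset x)
  exact (h1.div h1.abs (abs_ne_zero.2 (density_ne_zero hθ.2 hq))).mul h2

theorem integrableOn_orientedDensity (hθ : IsVolumeForm θ) (hη : IsSmoothForm η) {C : Set S}
    (hC : IsCompact C) (hx : C ⊆ (chartAt (EuclideanHalfSpace 2) x).source)
    (hzero : ∀ p ∉ C, η p = 0) : IntegrableOn (orientedDensity θ η x) (halfInterior x) := by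
  have h1 : IntegrableOn (orientedDensity θ η x) (halfChart x '' C) :=
    ((continuousOn_orientedDensity hθ hη x).mono (halfChart_image_subset hx)).integrableOn_compact
      (isCompact_halfChart_image hC hx)
  refine h1.of_forall_sdiff_eq_zero (isOpen_halfInterior x).measurableSet ?_
  rintro q ⟨hq, hq'⟩
  rw [orientedDensity, density_eq_zero (hzero _ (notMem_of_notMem_halfChart_image hq.1 hq')),
    mul_zero]

/-- The integral of a form that is supported in two charts is the same in both. -/
theorem chartIntegral_eq (θ : DiffForm (𝓡∂ 2) S 2)
    (hzero : ∀ p, η p ≠ 0 → p ∈ (chartAt (EuclideanHalfSpace 2) x).source ∧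
      p ∈ (chartAt (EuclideanHalfSpace 2) y).source) :
    chartIntegral θ η x = chartIntegral θ η y := by
  have hopen : ∀ x y : S, IsOpen (halfInterior x ∩
      halfParam x ⁻¹' (chartAt (EuclideanHalfSpace 2) y).source) := fun x y =>
    ((continuousOn_halfParam x).mono inter_subset_left).isOpen_inter_preimage
      (isOpen_halfInterior x) (chartAt (EuclideanHalfSpace 2) y).open_source
  have hrestrict : ∀ x y : S, (∀ p, η p ≠ 0 → p ∈ (chartAt (EuclideanHalfSpace 2) y).source) →
      chartIntegral θ η x = ∫ q in halfInterior x ∩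
        halfParam x ⁻¹' (chartAt (EuclideanHalfSpace 2) y).source, orientedDensity θ η x q := by
    intro x y h
    refine setIntegral_eq_of_subset_of_forall_sdiff_eq_zero (isOpen_halfInterior x).measurableSet
      inter_subset_left ?_
    rintro q ⟨hq, hq'⟩
    rw [orientedDensity, density_eq_zero (by_contra fun h0 => hq' ⟨hq, h _ h0⟩), mul_zero]
  rw [hrestrict x y fun p hp => (hzero p hp).2, hrestrict y x fun p hp => (hzero p hp).1]
  have himage : ∀ x y : S, halfTransition x y '' (halfInterior x ∩
      halfParam x ⁻¹' (chartAt (EuclideanHalfSpace 2) y).source) ⊆ halfInterior y ∩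
        halfParam y ⁻¹' (chartAt (EuclideanHalfSpace 2) x).source := by
    rintro x y _ ⟨q, ⟨hq, hq'⟩, rfl⟩
    have h1 : halfTransition x y q ∈ halfDomain y := halfChart_mem hq'
    have h2 : halfParam y (halfTransition x y q) = halfParam x q := halfParam_halfChart hq'
    refine ⟨⟨h1, ?_⟩, ?_⟩
    · change 0 < (halfTransition x y q).1
      rw [← halfParam_mem_interior_iff h1, h2, halfParam_mem_interior_iff hq.1]
      exact hq.2
    · rw [mem_preimage, h2]
      exact halfParam_mem_source hq.1
  have hinv : ∀ x y : S, ∀ q ∈ halfInterior x ∩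
      halfParam x ⁻¹' (chartAt (EuclideanHalfSpace 2) y).source,
        halfTransition y x (halfTransition x y q) = q := by
    rintro x y q ⟨hq, hq'⟩
    change halfChart x (halfParam y (halfChart y (halfParam x q))) = q
    rw [halfParam_halfChart hq', halfChart_halfParam hq.1]
  have himage' : halfTransition x y '' (halfInterior x ∩
      halfParam x ⁻¹' (chartAt (EuclideanHalfSpace 2) y).source) = halfInterior y ∩
        halfParam y ⁻¹' (chartAt (EuclideanHalfSpace 2) x).source := by
    refine (himage x y).antisymm fun q hq => ⟨halfTransition y x q, ?_, hinv y x q hq⟩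
    exact himage y x ⟨q, hq, rfl⟩
  have hderiv : ∀ q ∈ halfInterior x ∩
      halfParam x ⁻¹' (chartAt (EuclideanHalfSpace 2) y).source,
      HasFDerivWithinAt (halfTransition x y) (fderivWithin ℝ (halfTransition x y) halfPlane q)
        (halfInterior x ∩ halfParam x ⁻¹' (chartAt (EuclideanHalfSpace 2) y).source) q := by
    rintro q ⟨hq, hq'⟩
    exact ((contDiffWithinAt_halfChart_comp (contMDiffWithinAt_halfParam hq.1)
      hq').differentiableWithinAt (by simp)).hasFDerivWithinAt.mono
        (inter_subset_left.trans (inter_subset_left.trans (halfDomain_subset x)))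
  -- Change of variables by the transition map, which is a bijection between the parts of the two
  -- domains that lie over both charts.
  rw [← himage', integral_image_eq_integral_abs_det_fderiv_smul volume (hopen x y).measurableSet
    hderiv (fun q hq q' hq' h => by rw [← hinv x y q hq, h, hinv x y q' hq'])]
  refine setIntegral_congr_fun (hopen x y).measurableSet fun q hq => ?_
  rw [smul_eq_mul]
  exact orientedDensity_transition θ η hq.1.1 hq.2

end SurfaceIntegral

end PartialSections

/-! ### Stokes' theorem, as an inequality, on compact surfaces -/

namespace PartialSections

section ChartStokes

open MeasureTheory

variable {S : Type*} [TopologicalSpace S] [ChartedSpace (EuclideanHalfSpace 2) S]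
  [IsManifold (𝓡∂ 2) ∞ S] {θ : DiffForm (𝓡∂ 2) S 2} {β : DiffForm (𝓡∂ 2) S 1} {x : S}

/-- The coefficients of a one-form in the chart at `x`. -/
noncomputable def coefficient (β : DiffForm (𝓡∂ 2) S 1) (x : S) (v q : ℝ × ℝ) : ℝ :=
  pullbackWithin β (halfParam x) halfPlane q ![v]

omit [IsManifold (𝓡∂ 2) ∞ S] in
theorem coefficient_eq_zero {q : ℝ × ℝ} (h : β (halfParam x q) = 0) (v : ℝ × ℝ) :
    coefficient β x v q = 0 := by
  rw [coefficient, pullbackWithin, h]; rfl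

theorem IsSmoothForm.contDiffWithinAt_coefficient (hβ : IsSmoothForm β) {q : ℝ × ℝ}
    (hq : q ∈ halfDomain x) (v : ℝ × ℝ) :
    ContDiffWithinAt ℝ ∞ (coefficient β x v) halfPlane q :=
  hβ.contDiffWithinAt_pullbackWithin uniqueDiffOn_halfPlane (halfDomain_subset x hq)
    (contMDiffWithinAt_halfParam hq) _

theorem IsSmoothForm.density_extD (hβ : IsSmoothForm β) {q : ℝ × ℝ} (hq : q ∈ halfDomain x) :
    density (PartialSections.extD β) x q =
      fderivWithin ℝ (coefficient β x (0, 1)) halfPlane q (1, 0) -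
        fderivWithin ℝ (coefficient β x (1, 0)) halfPlane q (0, 1) := by
  have hq' := halfDomain_subset x hq
  rw [density, ← hβ.extDerivWithin_pullbackWithin uniqueDiffOn_halfPlane hq'
    (subset_closure_interior_halfPlane hq') (contMDiffWithinAt_halfParam hq),
    extDerivWithin_apply (hβ.differentiableWithinAt_pullbackWithin uniqueDiffOn_halfPlane hq'
      (contMDiffWithinAt_halfParam hq)) (uniqueDiffOn_halfPlane q hq'), Fin.sum_univ_two]
  have h0 : (fun z => pullbackWithin β (halfParam x) halfPlane z
      ((0 : Fin 2).removeNth ![((1 : ℝ), (0 : ℝ)), (0, 1)])) = coefficient β x (0, 1) := by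
    ext z
    exact congrArg _ (funext fun i => by fin_cases i; rfl)
  have h1 : (fun z => pullbackWithin β (halfParam x) halfPlane z
      ((1 : Fin 2).removeNth ![((1 : ℝ), (0 : ℝ)), (0, 1)])) = coefficient β x (1, 0) := by
    ext z
    exact congrArg _ (funext fun i => by fin_cases i; rfl)
  rw [h0, h1]
  simp [sub_eq_add_neg]

/-- The density of an area form does not vanish, so its sign is locally constant and can be treated
as a constant factor under differentiation. -/
theorem eventually_sign_density_eq (hθ : IsVolumeForm θ) {q : ℝ × ℝ} (hq : q ∈ halfDomain x) :
    ∀ᶠ z in 𝓝[halfPlane] q, density θ x z / |density θ x z| = density θ x q / |density θ x q| := by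
  have h1 := (hθ.1.contDiffWithinAt_density hq).continuousWithinAt
  have h2 := density_ne_zero hθ.2 hq
  rcases lt_or_gt_of_ne h2 with h | h
  · filter_upwards [h1.eventually (gt_mem_nhds h)] with z hz
    rw [abs_of_neg h, abs_of_neg hz, div_neg, div_neg, div_self h.ne, div_self hz.ne]
  · filter_upwards [h1.eventually (lt_mem_nhds h)] with z hz
    rw [abs_of_pos h, abs_of_pos hz, div_self h.ne', div_self hz.ne']

/-- Stokes' theorem, as an inequality, for a one-form that is supported in a chart. -/
theorem chartIntegral_extD_nonpos (hθ : IsVolumeForm θ) (hβ : IsSmoothForm β) {C : Set S}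
    (hC : IsCompact C) (hCx : C ⊆ (chartAt (EuclideanHalfSpace 2) x).source)
    (hzero : ∀ p ∉ C, β p = 0)
    (hbd : ∀ q ∈ halfDomain x, q.1 = 0 →
      0 ≤ density θ x q / |density θ x q| * coefficient β x (0, 1) q) :
    chartIntegral θ (PartialSections.extD β) x ≤ 0 := by
  set K := halfChart x '' C
  have hK : IsCompact K := isCompact_halfChart_image hC hCx
  -- The signed coefficients are extended by zero to the half-plane; they remain C¹ because their
  -- support lies in the compact set `K` inside the chart domain.
  set b : ℝ × ℝ → ℝ × ℝ → ℝ := fun v =>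
    (halfDomain x).indicator fun q => density θ x q / |density θ x q| * coefficient β x v q
    with hb
  have hb0 : ∀ v, ∀ q ∉ K, b v q = 0 := by
    intro v q hq
    by_cases h : q ∈ halfDomain x
    · rw [hb]
      simp only [indicator_of_mem h]
      rw [coefficient_eq_zero (hzero _ (notMem_of_notMem_halfChart_image h hq)), mul_zero]
    · exact indicator_of_notMem h _
  have hev0 : ∀ v, ∀ q ∉ halfDomain x, b v =ᶠ[𝓝[halfPlane] q] fun _ => 0 := by
    intro v q hq
    have hq' : q ∉ K := fun h => hq (halfChart_image_subset hCx h)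
    filter_upwards [mem_nhdsWithin_of_mem_nhds (hK.isClosed.isOpen_compl.mem_nhds hq')] with z hz
    exact hb0 v z hz
  have hev1 : ∀ v, ∀ q ∈ halfDomain x, b v =ᶠ[𝓝[halfPlane] q]
      fun z => density θ x q / |density θ x q| * coefficient β x v z := by
    intro v q hq
    filter_upwards [halfDomain_mem_nhdsWithin hq, eventually_sign_density_eq hθ hq] with z hz hz'
    rw [hb]
    simp only [indicator_of_mem hz, hz']
  have hsmooth : ∀ v, ContDiffOn ℝ 1 (b v) halfPlane := by
    intro v q hq
    by_cases h : q ∈ halfDomain x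
    · refine ContDiffWithinAt.congr_of_eventuallyEq_of_mem ?_ (hev1 v q h) hq
      exact contDiffWithinAt_const.mul
        ((hβ.contDiffWithinAt_coefficient h v).of_le (by simp))
    · exact contDiffWithinAt_const.congr_of_eventuallyEq_of_mem (hev0 v q h) hq
  obtain ⟨R, hR, hKR⟩ := hK.isBounded.subset_ball_lt 0 0
  have hfar : ∀ v, ∀ q ∈ halfPlane, R ≤ ‖q‖ → b v q = 0 := fun v q _ h =>
    hb0 v q fun hq => absurd (mem_ball_zero_iff.1 (hKR hq)) (not_lt.2 h)
  have hpos : ∀ y, 0 ≤ b (0, 1) (0, y) := by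
    intro y
    by_cases h : ((0 : ℝ), y) ∈ halfDomain x
    · rw [hb]
      simp only [indicator_of_mem h]
      exact hbd _ h rfl
    · exact (indicator_of_notMem h _).ge
  have hmain := integral_halfPlane_nonpos (hsmooth (1, 0)) (hsmooth (0, 1)) hR (hfar _) (hfar _)
    hpos
  refine le_trans (le_of_eq ?_) hmain
  rw [chartIntegral, setIntegral_eq_of_subset_of_forall_sdiff_eq_zero
    isOpen_interior_halfPlane.measurableSet (inter_subset_right : halfInterior x ⊆ _)]
  · refine setIntegral_congr_fun (isOpen_halfInterior x).measurableSet fun q hq => ?_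
    have hU := uniqueDiffOn_halfPlane q (halfDomain_subset x hq.1)
    have hd : ∀ v, fderivWithin ℝ (b v) halfPlane q = (density θ x q / |density θ x q|) •
        fderivWithin ℝ (coefficient β x v) halfPlane q := by
      intro v
      rw [(hev1 v q hq.1).fderivWithin_eq_of_mem (halfDomain_subset x hq.1)]
      exact fderivWithin_const_mul hU
        ((hβ.contDiffWithinAt_coefficient hq.1 v).differentiableWithinAt (by simp)) _
    simp only [hd, orientedDensity, hβ.density_extD hq.1, smul_apply, smul_eq_mul]
    ring
  · rintro q ⟨hq, hq'⟩
    have h : q ∉ halfDomain x := fun h => hq' ⟨h, hq⟩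
    have hz : ∀ v, fderivWithin ℝ (b v) halfPlane q = 0 := by
      intro v
      rw [(hev0 v q h).fderivWithin_eq_of_mem (show q ∈ halfPlane from le_of_lt (show 0 < q.1 from hq))]
      simp
    simp [hz]

/-- At the boundary, the inward coordinate increases in the direction of the first coordinate of
any chart, and it is constant in the direction of the second coordinate. -/
theorem inwardCoord_halfParam (hθ : IsVolumeForm θ) {q : ℝ × ℝ} (hq : q ∈ halfDomain x)
    (hq0 : q.1 = 0) :
    (∀ c : ℝ, inwardCoord (halfParam x q)
      (mfderivWithin 𝓘(ℝ, ℝ × ℝ) (𝓡∂ 2) (halfParam x) halfPlane q (0, c)) = 0) ∧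
    inwardCoord (halfParam x q)
      (mfderivWithin 𝓘(ℝ, ℝ × ℝ) (𝓡∂ 2) (halfParam x) halfPlane q (-1, 0)) < 0 := by
  set p := halfParam x q with hp
  have hqH := halfDomain_subset x hq
  have hU := uniqueDiffOn_halfPlane q hqH
  have hsource : halfParam x q ∈ (chartAt (EuclideanHalfSpace 2) p).source :=
    mem_chart_source _ _
  have hT : HasFDerivWithinAt (halfTransition x p)
      (fderivWithin ℝ (halfTransition x p) halfPlane q) halfPlane q :=
    ((contDiffWithinAt_halfChart_comp (contMDiffWithinAt_halfParam hq)
      hsource).differentiableWithinAt (by simp)).hasFDerivWithinAt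
  set L := fderivWithin ℝ (halfTransition x p) halfPlane q with hL
  have hcoord : ∀ v, inwardCoord p
      (mfderivWithin 𝓘(ℝ, ℝ × ℝ) (𝓡∂ 2) (halfParam x) halfPlane q v) = (L v).1 := by
    intro v
    have h1 := mfderiv_comp_mfderivWithin q (mdifferentiableAt_extChartAt hsource)
      ((contMDiffWithinAt_halfParam hq).mdifferentiableWithinAt (by simp))
      hU.uniqueMDiffWithinAt
    have h2 : extChartAt (𝓡∂ 2) p ∘ halfParam x = planeEquiv ∘ halfTransition x p :=
      funext fun z => (planeEquiv_halfChart p _).symm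
    rw [h2, mfderivWithin_eq_fderivWithin, planeEquiv.comp_fderivWithin hU] at h1
    have h3 := DFunLike.congr_fun h1 v
    exact (congrArg (fun w : EuclideanSpace ℝ (Fin 2) => w 0) h3).symm
  -- The transition map takes boundary to boundary and has values in the half-plane, so its first
  -- coordinate is minimal at a boundary point. Its derivative is then nonnegative on inward vectors
  -- and, applied to both signs, zero on tangent ones.
  have hmin : IsLocalMinOn (fun z => (halfTransition x p z).1) halfPlane q := by
    have h0 : (halfTransition x p q).1 = 0 := by
      have h1 : halfTransition x p q ∈ halfDomain p := halfChart_mem hsource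
      have h2 : halfParam p (halfTransition x p q) = p := halfParam_halfChart hsource
      have h3 := halfParam_mem_interior_iff h1
      rw [h2, hp, halfParam_mem_interior_iff hq, hq0] at h3
      exact le_antisymm (not_lt.1 fun h => lt_irrefl _ (h3.2 h)) (halfDomain_subset p h1)
    filter_upwards with z
    rw [h0]
    exact halfChart_mem_halfPlane p _
  have hF : HasFDerivWithinAt (fun z => (halfTransition x p z).1)
      ((ContinuousLinearMap.fst ℝ ℝ ℝ).comp L) halfPlane q := hT.fst
  have hnonneg : ∀ v : ℝ × ℝ, 0 ≤ v.1 → 0 ≤ (L v).1 := by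
    intro v hv
    refine hmin.hasFDerivWithinAt_nonneg hF ?_
    refine mem_posTangentConeAt_of_segment_subset (convex_halfPlane.segment_subset hqH ?_)
    change 0 ≤ q.1 + v.1
    rw [hq0]; linarith
  have hvert : ∀ c : ℝ, (L (0, c)).1 = 0 := by
    intro c
    have h1 := hnonneg (0, c) le_rfl
    have h2 := hnonneg (-(0, c)) (by simp)
    rw [map_neg] at h2
    exact le_antisymm (by simpa using h2) h1
  refine ⟨fun c => (hcoord (0, c)).trans (hvert c), ?_⟩
  have hneg : L (-1, 0) = -L (1, 0) := by rw [← map_neg]; simp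
  refine (hcoord (-1, 0)).trans_lt ?_
  rw [hneg]
  -- If the derivative vanished on the inward vector as well, the transition map would have a
  -- degenerate differential, and `θ` would have zero density in the chart at `x`.
  refine neg_lt_zero.2 (lt_of_le_of_ne (hnonneg (1, 0) zero_le_one) fun h => ?_)
  refine density_ne_zero hθ.2 hq ?_
  rw [density, pullbackWithin_halfParam_eq θ hq hsource]
  refine (ContinuousAlternatingMap.apply_plane
    (pullbackWithin θ (halfParam p) halfPlane (halfTransition x p q))
    (fun i => L (![((1 : ℝ), (0 : ℝ)), (0, 1)] i))).trans ?_
  rw [Module.Basis.det_apply, Matrix.det_fin_two]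
  simp [Module.Basis.toMatrix_apply, ← h, hvert]

/-- Translates the intrinsic boundary condition into the chart: with outward vector `(-1, 0)`, a
tangent vector `(0, c)` is positive for `θ` exactly when `c` and the density have opposite signs. -/
theorem sign_mul_coefficient_nonneg (hθ : IsVolumeForm θ)
    (hbd : ∀ p ∈ (𝓡∂ 2).boundary S, ∀ τ, IsBoundaryPositive θ p τ → β p ![τ] ≤ 0)
    {q : ℝ × ℝ} (hq : q ∈ halfDomain x) (hq0 : q.1 = 0) :
    0 ≤ density θ x q / |density θ x q| * coefficient β x (0, 1) q := by
  obtain ⟨h1, h2⟩ := inwardCoord_halfParam hθ hq hq0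
  set D := mfderivWithin 𝓘(ℝ, ℝ × ℝ) (𝓡∂ 2) (halfParam x) halfPlane q
  have hp : halfParam x q ∈ (𝓡∂ 2).boundary S := by
    rw [← (𝓡∂ 2).compl_interior, mem_compl_iff, halfParam_mem_interior_iff hq, hq0]
    exact lt_irrefl 0
  have hform : ∀ c : ℝ, θ (halfParam x q) ![D (-1, 0), D (0, c)] = -c * density θ x q := by
    intro c
    have e1 : θ (halfParam x q) ![D (-1, 0), D (0, c)] =
        pullbackWithin θ (halfParam x) halfPlane q ![(-1, 0), (0, c)] := by
      rw [pullbackWithin_apply]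
      exact congrArg _ (funext fun i => by fin_cases i <;> rfl)
    rw [e1, ContinuousAlternatingMap.apply_plane, Module.Basis.det_apply, Matrix.det_fin_two]
    simp [Module.Basis.toMatrix_apply, density]
    ring
  have hcoef : ∀ c : ℝ, β (halfParam x q) ![D (0, c)] = c * coefficient β x (0, 1) q := by
    intro c
    have e1 : β (halfParam x q) ![D (0, c)] =
        pullbackWithin β (halfParam x) halfPlane q (fun _ => c • (0, 1)) := by
      rw [pullbackWithin_apply]
      refine congrArg _ (funext fun i => ?_)
      fin_cases i
      simp [D]
    have e2 := (pullbackWithin β (halfParam x) halfPlane q).map_smul_univ (fun _ => c)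
      (fun _ => (0, 1))
    rw [e1, e2]
    simp only [Finset.univ_unique, Finset.prod_const, Finset.card_singleton, pow_one, smul_eq_mul,
      coefficient]
    congr 2
    exact funext fun i => by fin_cases i; rfl
  have key : ∀ c : ℝ, 0 < -c * density θ x q → c * coefficient β x (0, 1) q ≤ 0 := by
    intro c hc
    rw [← hcoef]
    refine hbd _ hp _ ⟨h1 c, D (-1, 0), h2, ?_⟩
    rw [hform]
    exact hc
  rcases lt_or_gt_of_ne (density_ne_zero hθ.2 hq) with h | h
  · have := key 1 (by linarith)
    rw [abs_of_neg h, div_neg, div_self h.ne]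
    linarith
  · have := key (-1) (by linarith)
    rw [abs_of_pos h, div_self h.ne']
    linarith

omit [IsManifold (𝓡∂ 2) ∞ S] in
theorem extD_eq_zero {k : ℕ} {η : DiffForm (𝓡∂ 2) S k} {p : S} (h : ∀ᶠ p' in 𝓝 p, η p' = 0) :
    PartialSections.extD η p = 0 := by
  have h1 : formInChart η p =ᶠ[𝓝[range (𝓡∂ 2)] (extChartAt (𝓡∂ 2) p p)] fun _ => 0 := by
    have h2 := continuousAt_extChartAt_symm (I := 𝓡∂ 2) p
    rw [ContinuousAt, extChartAt_to_inv] at h2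
    filter_upwards [(h2.mono_left nhdsWithin_le_nhds).eventually h] with y hy
    rw [formInChart, hy]
    rfl
  rw [PartialSections.extD, h1.extDerivWithin_eq_of_mem (extChartAt_mem_range p p)]
  have h3 : extDerivWithin (fun _ => (0 : EuclideanSpace ℝ (Fin 2) [⋀^Fin k]→L[ℝ] ℝ))
      (range (𝓡∂ 2)) (extChartAt (𝓡∂ 2) p p) = 0 := by
    simp only [extDerivWithin, fderivWithin_fun_const]
    exact (ContinuousAlternatingMap.alternatizeUncurryFinCLM ℝ (EuclideanSpace ℝ (Fin 2)) ℝ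
      (n := k)).map_zero
  rw [h3]
  rfl

theorem orientedDensity_pos (hθ : IsVolumeForm θ) {η : DiffForm (𝓡∂ 2) S 2}
    (hint : ∀ p ∈ (𝓡∂ 2).interior S, ∀ u v, 0 < θ p ![u, v] → 0 < η p ![u, v])
    {q : ℝ × ℝ} (hq : q ∈ halfInterior x) : 0 < orientedDensity θ η x q := by
  have hp : halfParam x q ∈ (𝓡∂ 2).interior S := (halfParam_mem_interior_iff hq.1).2 hq.2
  set D := mfderivWithin 𝓘(ℝ, ℝ × ℝ) (𝓡∂ 2) (halfParam x) halfPlane q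
  have h1 : ∀ η : DiffForm (𝓡∂ 2) S 2,
      η (halfParam x q) ![D (1, 0), D (0, 1)] = density η x q := fun η => by
    rw [density, pullbackWithin_apply]
    exact congrArg _ (funext fun i => by fin_cases i <;> rfl)
  have h2 : ∀ η : DiffForm (𝓡∂ 2) S 2,
      η (halfParam x q) ![D (0, 1), D (1, 0)] = -density η x q := fun η => by
    have e1 : η (halfParam x q) ![D (0, 1), D (1, 0)] =
        pullbackWithin η (halfParam x) halfPlane q ![(0, 1), (1, 0)] := by
      rw [pullbackWithin_apply]
      exact congrArg _ (funext fun i => by fin_cases i <;> rfl)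
    rw [e1, ContinuousAlternatingMap.apply_plane, Module.Basis.det_apply, Matrix.det_fin_two]
    simp [Module.Basis.toMatrix_apply, density]
  have h3 := hint _ hp (D (1, 0)) (D (0, 1))
  have h4 := hint _ hp (D (0, 1)) (D (1, 0))
  rw [h1, h1] at h3
  rw [h2, h2] at h4
  rw [orientedDensity]
  rcases lt_or_gt_of_ne (density_ne_zero hθ.2 hq.1) with h | h
  · rw [abs_of_neg h, div_neg, div_self h.ne]
    linarith [h4 (by linarith)]
  · rw [abs_of_pos h, div_self h.ne', one_mul]
    exact h3 h

/-- There is no positive exact area form on a compact surface whose primitive is nonpositive on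
the boundary. -/
theorem not_exact_of_boundary_nonpos [T2Space S] [CompactSpace S] [Nonempty S]
    (hθ : IsVolumeForm θ) (hβ : IsSmoothForm β)
    (hint : ∀ p ∈ (𝓡∂ 2).interior S, ∀ u v, 0 < θ p ![u, v] →
      0 < PartialSections.extD β p ![u, v])
    (hbd : ∀ p ∈ (𝓡∂ 2).boundary S, ∀ τ, IsBoundaryPositive θ p τ → β p ![τ] ≤ 0) : False := by
  obtain ⟨t, ht⟩ := isCompact_univ.elim_finite_subcover
    (fun x : S => (chartAt (EuclideanHalfSpace 2) x).source)
    (fun x => (chartAt (EuclideanHalfSpace 2) x).open_source)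
    (fun x _ => mem_iUnion.2 ⟨x, mem_chart_source _ x⟩)
  obtain ⟨ρ, hρ⟩ := SmoothPartitionOfUnity.exists_isSubordinate (𝓡∂ 2) isClosed_univ
    (fun x : t => (chartAt (EuclideanHalfSpace 2) (x : S)).source)
    (fun x => (chartAt (EuclideanHalfSpace 2) (x : S)).open_source)
    (by simpa [iUnion_subtype] using ht)
  have hρsum : ∀ p, ∑ i, ρ i p = 1 := fun p => by
    rw [← finsum_eq_sum_of_fintype]; exact ρ.sum_eq_one (mem_univ p)
  have hC : ∀ i, IsCompact (tsupport (ρ i)) := fun i => (isClosed_tsupport _).isCompact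
  have hρ0 : ∀ i, ∀ p ∉ tsupport (ρ i), ρ i p = 0 := fun i p hp => image_eq_zero_of_notMem_tsupport hp
  set γ : t → DiffForm (𝓡∂ 2) S 1 := fun i p => ρ i p • β p with hγ
  have hγs : ∀ i, IsSmoothForm (γ i) := fun i => hβ.smul_fun (ρ i).contMDiff
  set η : t → DiffForm (𝓡∂ 2) S 2 := fun i => PartialSections.extD (γ i) with hη
  have hηs : ∀ i, IsSmoothForm (η i) := fun i => (hγs i).extD
  have hγ0 : ∀ i, ∀ p ∉ tsupport (ρ i), γ i p = 0 := fun i p hp => by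
    rw [hγ]; simp only [hρ0 i p hp, zero_smul]
  have hη0 : ∀ i, ∀ p ∉ tsupport (ρ i), η i p = 0 := fun i p hp =>
    extD_eq_zero (Filter.eventually_of_mem ((isClosed_tsupport _).isOpen_compl.mem_nhds hp)
      fun p' hp' => hγ0 i p' hp')
  have hdens : ∀ x : S, ∀ q ∈ halfDomain x,
      ∑ i, density (η i) x q = density (PartialSections.extD β) x q := by
    intro x q hq
    have hU := uniqueDiffOn_halfPlane q (halfDomain_subset x hq)
    have hc : ∀ v, ∑ i, fderivWithin ℝ (coefficient (γ i) x v) halfPlane q =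
        fderivWithin ℝ (coefficient β x v) halfPlane q := by
      intro v
      rw [← fderivWithin_fun_sum hU fun i _ =>
        ((hγs i).contDiffWithinAt_coefficient hq v).differentiableWithinAt (by simp)]
      congr 1
      ext z
      have : ∀ i, coefficient (γ i) x v z = ρ i (halfParam x z) * coefficient β x v z :=
        fun i => rfl
      simp_rw [this]
      rw [← Finset.sum_mul, hρsum, one_mul]
    simp_rw [hη, (hγs _).density_extD hq, hβ.density_extD hq, ← hc, Finset.sum_sub_distrib,
      sum_apply]
  -- Each `η i` has nonpositive integral in its own chart, but their sum is known only pointwise.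
  -- The pieces `ρ j • η i` are supported in both charts, so they can be moved from chart `i` to
  -- chart `j`, where the sum over `i` gives the integral of `ρ j` times the derivative of `β`.
  set ζ : t → t → DiffForm (𝓡∂ 2) S 2 := fun j i p => ρ j p • η i p with hζ
  have hζs : ∀ j i, IsSmoothForm (ζ j i) := fun j i => (hηs i).smul_fun (ρ j).contMDiff
  have hζi : ∀ j i, ∀ p ∉ tsupport (ρ i), ζ j i p = 0 := fun j i p hp => by
    rw [hζ]; simp only [hη0 i p hp, smul_zero]
  have hζj : ∀ j i, ∀ p ∉ tsupport (ρ j), ζ j i p = 0 := fun j i p hp => by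
    rw [hζ]; simp only [hρ0 j p hp, zero_smul]
  have hζd : ∀ j i x q, orientedDensity θ (ζ j i) x q =
      ρ j (halfParam x q) * orientedDensity θ (η i) x q := fun j i x q => by
    have : density (ζ j i) x q = ρ j (halfParam x q) * density (η i) x q := rfl
    rw [orientedDensity, orientedDensity, this]; ring
  have hle : ∀ i, chartIntegral θ (η i) i ≤ 0 := fun i =>
    chartIntegral_extD_nonpos hθ (hγs i) (hC i) (hρ i) (hγ0 i) fun q hq hq0 =>
      sign_mul_coefficient_nonneg hθ (fun p hp τ hτ => by
        have h1 : γ i p ![τ] = ρ i p * β p ![τ] := rfl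
        rw [h1]
        exact mul_nonpos_of_nonneg_of_nonpos (ρ.nonneg i p) (hbd p hp τ hτ)) hq hq0
  have hsplit : ∀ i, chartIntegral θ (η i) i = ∑ j, chartIntegral θ (ζ j i) i := by
    intro i
    rw [chartIntegral]
    simp_rw [chartIntegral]
    rw [← integral_finsetSum _ fun j _ =>
      integrableOn_orientedDensity hθ (hζs j i) (hC i) (hρ i) (hζi j i)]
    refine setIntegral_congr_fun (isOpen_halfInterior _).measurableSet fun q _ => ?_
    simp only [hζd]
    rw [← Finset.sum_mul, hρsum, one_mul]
  have hswap : ∀ j i, chartIntegral θ (ζ j i) i = chartIntegral θ (ζ j i) j := fun j i =>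
    chartIntegral_eq θ fun p hp => ⟨hρ i (by_contra fun h => hp (hζi j i p h)),
      hρ j (by_contra fun h => hp (hζj j i p h))⟩
  have hjoin : ∀ j : t, ∑ i, chartIntegral θ (ζ j i) j =
      ∫ q in halfInterior (j : S), ρ j (halfParam j q) *
        orientedDensity θ (PartialSections.extD β) j q := by
    intro j
    simp_rw [chartIntegral]
    rw [← integral_finsetSum _ fun i _ =>
      integrableOn_orientedDensity hθ (hζs j i) (hC j) (hρ j) (hζj j i)]
    refine setIntegral_congr_fun (isOpen_halfInterior _).measurableSet fun q hq => ?_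
    simp only [hζd]
    rw [← Finset.mul_sum]
    simp only [orientedDensity]
    rw [← hdens j q hq.1, Finset.mul_sum, Finset.mul_sum, Finset.mul_sum]
  have hpos : ∀ x : S, ∀ q ∈ halfInterior x,
      0 < orientedDensity θ (PartialSections.extD β) x q := fun x q hq =>
    orientedDensity_pos hθ hint hq
  have hnonneg : ∀ j : t, ∀ q ∈ halfInterior (j : S), 0 ≤ ρ j (halfParam j q) *
      orientedDensity θ (PartialSections.extD β) j q := fun j q hq =>
    mul_nonneg (ρ.nonneg j _) (hpos j q hq).le
  obtain ⟨p₀⟩ := ‹Nonempty S›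
  obtain ⟨j, hj⟩ : ∃ j, ρ j p₀ ≠ 0 := by
    by_contra! h
    have := hρsum p₀
    simp [h] at this
  have hp₀ : p₀ ∈ (chartAt (EuclideanHalfSpace 2) (j : S)).source :=
    hρ j (subset_tsupport _ hj)
  have hq₀ := halfChart_mem hp₀
  have hopen : IsOpen (halfInterior (j : S) ∩ halfParam (j : S) ⁻¹' {p | ρ j p ≠ 0}) :=
    ((continuousOn_halfParam (j : S)).mono inter_subset_left).isOpen_inter_preimage
      (isOpen_halfInterior _) (isOpen_ne_fun (ρ j).contMDiff.continuous continuous_const)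
  -- The point `p₀` may lie on the boundary, but arbitrarily close to it there are interior points
  -- where `ρ j` is still nonzero; they give a set of positive measure.
  have hne : (halfInterior (j : S) ∩ halfParam (j : S) ⁻¹' {p | ρ j p ≠ 0}).Nonempty := by
    have h1 : ∀ᶠ q in 𝓝[halfPlane] (halfChart (j : S) p₀),
        q ∈ halfDomain (j : S) ∧ ρ j (halfParam j q) ≠ 0 := by
      refine Filter.Eventually.and (halfDomain_mem_nhdsWithin hq₀) ?_
      have h2 : ContinuousWithinAt (fun q => ρ j (halfParam (j : S) q)) halfPlane
          (halfChart (j : S) p₀) :=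
        (ρ j).contMDiff.continuous.continuousAt.comp_continuousWithinAt
          (contMDiffWithinAt_halfParam hq₀).continuousWithinAt
      refine h2.eventually_ne ?_
      change ρ j (halfParam (j : S) (halfChart (j : S) p₀)) ≠ 0
      rwa [halfParam_halfChart hp₀]
    have h3 := mem_closure_iff_nhdsWithin_neBot.1
      (subset_closure_interior_halfPlane (halfDomain_subset _ hq₀))
    obtain ⟨q, hq, hq'⟩ := ((h1.filter_mono (nhdsWithin_mono _ interior_subset)).and
      self_mem_nhdsWithin).exists
    have hq'' : q ∈ interior halfPlane := hq'
    rw [interior_halfPlane] at hq''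
    exact ⟨q, ⟨hq.1, hq''⟩, hq.2⟩
  have hjpos : 0 < ∫ q in halfInterior (j : S), ρ j (halfParam j q) *
      orientedDensity θ (PartialSections.extD β) j q := by
    have hi : IntegrableOn (fun q => ρ j (halfParam (j : S) q) *
        orientedDensity θ (PartialSections.extD β) j q) (halfInterior (j : S)) := by
      have h1 := integrableOn_orientedDensity (x := (j : S)) hθ
        (hβ.extD.smul_fun (ρ j).contMDiff) (hC j) (hρ j)
        (fun p hp => by simp only [hρ0 j p hp, zero_smul])
      refine h1.congr_fun (fun q _ => ?_) (isOpen_halfInterior _).measurableSet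
      have : density (fun p => ρ j p • PartialSections.extD β p) (j : S) q =
        ρ j (halfParam (j : S) q) * density (PartialSections.extD β) j q := rfl
      simp only [orientedDensity, this]; ring
    rw [setIntegral_pos_iff_support_of_nonneg_ae
      ((ae_restrict_iff' (isOpen_halfInterior _).measurableSet).2
        (Filter.Eventually.of_forall (hnonneg j))) hi]
    refine (hopen.measure_pos volume hne).trans_le (measure_mono ?_)
    rintro q ⟨hq, hq'⟩
    exact ⟨mul_ne_zero hq' (hpos j q hq).ne', hq⟩
  have htotal : ∑ j : t, ∫ q in halfInterior (j : S), ρ j (halfParam j q) *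
      orientedDensity θ (PartialSections.extD β) j q ≤ 0 := by
    simp_rw [← hjoin]
    rw [Finset.sum_comm]
    refine Finset.sum_nonpos fun i _ => ?_
    rw [← Finset.sum_congr rfl fun j _ => hswap j i, ← hsplit]
    exact hle i
  have := Finset.sum_pos' (s := Finset.univ) (fun j _ => setIntegral_nonneg
    (isOpen_halfInterior _).measurableSet (hnonneg j)) ⟨j, Finset.mem_univ j, hjpos⟩
  linarith

end ChartStokes

end PartialSections

/-! ### Two-forms and three-forms on a three-dimensional vector space -/

section ThreeForms

local notation "ℝ³" => EuclideanSpace ℝ (Fin 3)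

theorem linearIndependent_of_threeForm_ne_zero {O : ℝ³ [⋀^Fin 3]→L[ℝ] ℝ} {v : Fin 3 → ℝ³}
    (h : O v ≠ 0) : LinearIndependent ℝ v :=
  by_contra fun hv => h (O.toAlternatingMap.map_linearDependent v hv)

theorem ContinuousAlternatingMap.swap_two {E : Type*} [AddCommGroup E] [Module ℝ E]
    [TopologicalSpace E] (B : E [⋀^Fin 2]→L[ℝ] ℝ) (u v : E) : B ![u, v] = -B ![v, u] := by
  have h := B.toAlternatingMap.map_swap ![v, u] (i := 0) (j := 1) (by simp)
  have h2 : ![v, u] ∘ Equiv.swap (0 : Fin 2) 1 = ![u, v] := by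
    ext i; fin_cases i <;> simp
  rw [h2] at h
  exact h

/-- Two-forms on a three-dimensional space with the same kernel are proportional. -/
theorem exists_eq_mul_of_curryLeft_eq_zero {O : ℝ³ [⋀^Fin 3]→L[ℝ] ℝ} {B : ℝ³ [⋀^Fin 2]→L[ℝ] ℝ}
    {X : ℝ³} (hB : B.curryLeft X = 0) {w : Fin 2 → ℝ³} (hw : O.curryLeft X w ≠ 0) :
    ∃ c : ℝ, ∀ v, B v = c * O.curryLeft X v := by
  have hli : LinearIndependent ℝ (Matrix.vecCons X w) :=
    linearIndependent_of_threeForm_ne_zero (O := O) hw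
  let b := basisOfLinearIndependentOfCardEqFinrank hli (by simp)
  have hb : (b : Fin 3 → ℝ³) = Matrix.vecCons X w := by simp [b]
  have hB' : ∀ v, B ![X, v] = 0 := fun v => by
    have := DFunLike.congr_fun hB ![v]
    simpa [ContinuousAlternatingMap.curryLeft_apply_apply] using this
  have hO' : ∀ v, O.curryLeft X ![X, v] = 0 := fun v => by
    exact DFunLike.congr_fun (ContinuousAlternatingMap.curryLeft_same O X) ![v]
  set c := B w / O.curryLeft X w with hc
  set D : ℝ³ [⋀^Fin 2]→L[ℝ] ℝ := B - c • O.curryLeft X with hD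
  have hD0 : ∀ v, D ![X, v] = 0 := fun v => by
    simp [hD, hB', hO']
  have hw2 : ![w 0, w 1] = w := by ext i; fin_cases i <;> rfl
  have hDw : D ![w 0, w 1] = 0 := by
    rw [hw2, hD]
    simp only [ContinuousAlternatingMap.sub_apply, ContinuousAlternatingMap.smul_apply,
      smul_eq_mul, hc]
    rw [div_mul_cancel₀ _ hw, sub_self]
  -- In the basis `X, w 0, w 1`, the difference `D` vanishes on pairs containing `X` by the kernel
  -- condition and on the remaining pair by the choice of `c`.
  have hzero : D.toAlternatingMap = 0 := by
    refine Module.Basis.ext_alternating b fun i hi => ?_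
    change D (fun j => b (i j)) = 0
    have hpair : (fun j => b (i j)) = ![b (i 0), b (i 1)] := by ext j; fin_cases j <;> rfl
    rw [hpair]
    have hne : i 0 ≠ i 1 := fun h => absurd (hi h) (by simp)
    have b0 : b 0 = X := by rw [hb]; rfl
    have b1 : b 1 = w 0 := by rw [hb]; rfl
    have b2 : b 2 = w 1 := by rw [hb]; rfl
    generalize i 0 = k at *
    generalize i 1 = l at *
    fin_cases k <;> fin_cases l <;> simp only [Fin.zero_eta, Fin.mk_one, Fin.reduceFinMk,
      ne_eq, not_true_eq_false] at hne ⊢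
    · rw [b0]; exact hD0 _
    · rw [b0]; exact hD0 _
    · rw [D.swap_two, b0, hD0, neg_zero]
    · rw [b1, b2]; exact hDw
    · rw [D.swap_two, b0, hD0, neg_zero]
    · rw [D.swap_two, b1, b2, hDw, neg_zero]
  refine ⟨c, fun v => ?_⟩
  have := DFunLike.congr_fun hzero v
  have h3 : B v - c * O.curryLeft X v = 0 := this
  linarith

/-- A nonzero vector extends to a basis, on which a nonzero form of top degree does not vanish. -/
theorem exists_curryLeft_ne_zero {O : ℝ³ [⋀^Fin 3]→L[ℝ] ℝ} (hO : O ≠ 0) {X : ℝ³} (hX : X ≠ 0) :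
    ∃ w, O.curryLeft X w ≠ 0 := by
  have h1 : LinearIndependent ℝ ![X] := by
    rw [linearIndependent_unique_iff]; simpa using hX
  obtain ⟨u, hu⟩ := exists_linearIndependent_snoc_of_lt_finrank h1
    (show 1 < Module.finrank ℝ ℝ³ by simp)
  obtain ⟨v, hv⟩ := exists_linearIndependent_snoc_of_lt_finrank hu
    (show 2 < Module.finrank ℝ ℝ³ by simp)
  have hcard : Fintype.card (Fin 3) = Module.finrank ℝ ℝ³ := by simp
  let b := basisOfLinearIndependentOfCardEqFinrank hv hcard
  have hb : (b : Fin 3 → ℝ³) = Fin.snoc (Fin.snoc ![X] u) v :=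
    coe_basisOfLinearIndependentOfCardEqFinrank hv _
  refine ⟨![u, v], fun h => hO ?_⟩
  have h2 : O b = 0 := by
    rw [ContinuousAlternatingMap.curryLeft_apply_apply] at h
    rw [hb, ← h]
    congr 1
    ext i
    fin_cases i <;> rfl
  apply ContinuousAlternatingMap.toAlternatingMap_injective
  have h3 := AlternatingMap.eq_smul_basis_det b O.toAlternatingMap
  rw [h3]
  have h4 : O.toAlternatingMap b = 0 := h2
  rw [h4, zero_smul]
  rfl

end ThreeForms

/-! ### The obstruction: partial sections of both signs exclude a Reeb-like field -/

namespace PartialSections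

variable {M : Type*} [TopologicalSpace M] [ChartedSpace (EuclideanSpace ℝ (Fin 3)) M]
  [IsManifold (𝓡 3) ∞ M] {o : DiffForm (𝓡 3) M 3} {X : ∀ x : M, TangentSpace (𝓡 3) x}

/-- On a connected manifold, the differential of the contact form has a constant sign on the planes
that are positively transverse to the Reeb field. -/
theorem extD_sign_of_reeb [ConnectedSpace M] (ho : IsVolumeForm o) (hX : IsNonvanishingField X)
    {α : DiffForm (𝓡 3) M 1} (hα : IsContactForm α)
    (hker : ∀ x, interiorProd X (extD α) x = 0) :
    (∀ x, ∀ u v : TangentSpace (𝓡 3) x, 0 < o x ![X x, u, v] → 0 < extD α x ![u, v]) ∨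
      (∀ x, ∀ u v : TangentSpace (𝓡 3) x, 0 < o x ![X x, u, v] → extD α x ![u, v] < 0) := by
  set U : Set M := {x | ∃ v, 0 < interiorProd X o x v * extD α x v} with hU
  set W : Set M := {x | ∃ v, 0 < interiorProd X o x v * (-extD α x) v} with hW
  have hprop : ∀ x, ∃ c : ℝ, ∀ v, extD α x v = c * interiorProd X o x v := by
    intro x
    obtain ⟨w, hw⟩ := exists_curryLeft_ne_zero (ho.2 x) (hX.2 x)
    exact exists_eq_mul_of_curryLeft_eq_zero (hker x) hw
  have hne : ∀ x, ∃ v, interiorProd X o x v * extD α x v ≠ 0 := by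
    intro x
    obtain ⟨w, hw⟩ := exists_curryLeft_ne_zero (ho.2 x) (hX.2 x)
    obtain ⟨c, hc⟩ := hprop x
    refine ⟨w, mul_ne_zero hw ?_⟩
    refine (hc w).trans_ne (mul_ne_zero (fun h => ?_) hw)
    obtain ⟨u, v, w', hu⟩ := hα.2 x
    refine hu ?_
    simp [wedge, hc, h]
  have hUo : IsOpen U := isOpen_setOf_mul_pos (ho.1.interiorProd hX.1) hα.1.extD
  have hWo : IsOpen W := isOpen_setOf_mul_pos (ho.1.interiorProd hX.1) hα.1.extD.neg
  have hcov : ∀ x, x ∈ U ∨ x ∈ W := by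
    intro x
    obtain ⟨v, hv⟩ := hne x
    rcases lt_or_gt_of_ne hv with h | h
    · exact Or.inr ⟨v, by
        have : (-extD α x) v = -(extD α x v) := rfl
        rw [this]; linarith⟩
    · exact Or.inl ⟨v, h⟩
  have hdisj : ∀ x, x ∈ U → x ∈ W → False := by
    rintro x ⟨v, hv⟩ ⟨w, hw⟩
    obtain ⟨c, hc⟩ := hprop x
    have : (-extD α x) w = -(extD α x w) := rfl
    rw [this, hc] at hw
    rw [hc] at hv
    rcases le_or_gt c 0 with h | h
    · nlinarith [mul_self_nonneg (interiorProd X o x v)]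
    · nlinarith [mul_self_nonneg (interiorProd X o x w)]
  -- The manifold is covered by the disjoint open sets where the proportionality factor between the
  -- two forms is positive or negative; connectedness leaves only one of them.
  have hclopen : IsClopen U := by
    refine ⟨?_, hUo⟩
    have : U = Wᶜ := by
      ext x
      exact ⟨fun h h' => hdisj x h h', fun h => (hcov x).resolve_right h⟩
    rw [this]
    exact hWo.isClosed_compl
  have happ : ∀ x, ∀ u v : TangentSpace (𝓡 3) x,
      o x ![X x, u, v] = interiorProd X o x ![u, v] := fun x u v => rfl
  rcases isClopen_iff.1 hclopen with h | h
  · right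
    intro x u v huv
    obtain ⟨w, hw⟩ := (hcov x).resolve_left (by rw [h]; exact notMem_empty x)
    obtain ⟨c, hc⟩ := hprop x
    have h1 : (-extD α x) w = -(extD α x w) := rfl
    rw [h1, hc] at hw
    have hcneg : c < 0 := by
      by_contra! hc0
      nlinarith [mul_self_nonneg (interiorProd X o x w)]
    rw [hc, ← happ]
    exact mul_neg_of_neg_of_pos hcneg huv
  · left
    intro x u v huv
    obtain ⟨w, hw⟩ : x ∈ U := by rw [h]; exact mem_univ x
    obtain ⟨c, hc⟩ := hprop x
    rw [hc] at hw
    have hcpos : 0 < c := by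
      by_contra! hc0
      nlinarith [mul_self_nonneg (interiorProd X o x w)]
    rw [hc, ← happ]
    exact mul_pos hcpos huv

/-- A field that has a positive and a negative partial section is not Reeb-like. -/
theorem not_isReebLike_of_partialSections [ConnectedSpace M] (ho : IsVolumeForm o)
    (hX : IsNonvanishingField X) (hpos : AdmitsPositivePartialSection o X)
    (hneg : AdmitsNegativePartialSection o X) : ¬ IsReebLike X := by
  rintro ⟨α, hα, hαX, hker⟩
  have hmap : ∀ {L : EuclideanSpace ℝ (Fin 3) [⋀^Fin 1]→L[ℝ] ℝ} (c : ℝ)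
      (v : EuclideanSpace ℝ (Fin 3)), L ![c • v] = c * L ![v] := by
    intro L c v
    have h := L.map_smul_univ (fun _ => c) ![v]
    simp only [Finset.univ_unique, Finset.prod_const, Finset.card_singleton, pow_one,
      smul_eq_mul] at h
    rw [← h]
    congr 1
    ext i
    fin_cases i
    rfl
  -- The sign decides which section is contradictory: the negative one, with `α`, if the derivative
  -- is positive on positively transverse planes, and the positive one, with `-α`, otherwise.
  rcases extD_sign_of_reeb ho hX hα hker with h | h
  · obtain ⟨S, _, _, _, _, _, _, f, hf, θ, hθ, hb⟩ := hneg
    refine not_exact_of_boundary_nonpos hθ.1 (hα.1.pullbackForm_one hf.smooth) ?_ ?_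
    · intro p hp u v huv
      rw [hα.1.extD_pullbackForm_one hf.smooth]
      have h1 := h _ _ _ ((hθ.2 p hp u v).1 huv)
      refine h1.trans_eq (congrArg _ (funext fun i => ?_))
      fin_cases i <;> rfl
    · intro p hp τ hτ
      obtain ⟨c, hc, hτc⟩ := hb p hp τ hτ
      have h1 : pullbackForm (𝓡∂ 2) α f p ![τ] = α (f p) ![mfderiv (𝓡∂ 2) (𝓡 3) f p τ] :=
        congrArg (α (f p)) (funext fun i => by fin_cases i; rfl)
      rw [h1, hτc]
      refine (hmap c (X (f p))).trans_le ?_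
      exact (mul_neg_of_neg_of_pos hc (hαX (f p))).le
  · obtain ⟨S, _, _, _, _, _, _, f, hf, θ, hθ, hb⟩ := hpos
    refine not_exact_of_boundary_nonpos hθ.1 (hα.1.neg.pullbackForm_one hf.smooth) ?_ ?_
    · intro p hp u v huv
      rw [hα.1.neg.extD_pullbackForm_one hf.smooth]
      have h1 := h _ _ _ ((hθ.2 p hp u v).1 huv)
      have h2 : pullbackForm (𝓡∂ 2) (extD fun x => -α x) f p ![u, v] =
          -extD α (f p) ![mfderiv (𝓡∂ 2) (𝓡 3) f p u, mfderiv (𝓡∂ 2) (𝓡 3) f p v] := by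
        rw [pullbackForm, extD_neg]
        refine congrArg (fun t => -(extD α (f p) t)) (funext fun i => ?_)
        fin_cases i <;> rfl
      rw [h2]
      linarith
    · intro p hp τ hτ
      obtain ⟨c, hc, hτc⟩ := hb p hp τ hτ
      have h1 : pullbackForm (𝓡∂ 2) (fun x => -α x) f p ![τ] =
          -α (f p) ![mfderiv (𝓡∂ 2) (𝓡 3) f p τ] :=
        congrArg (fun t => -(α (f p) t)) (funext fun i => by fin_cases i; rfl)
      rw [h1, hτc]
      have h2 : α (f p) ![c • X (f p)] = c * α (f p) ![X (f p)] := hmap c (X (f p))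
      rw [h2]
      have := mul_pos hc (hαX (f p))
      linarith

end PartialSections

/-! ### Forms of top degree -/

section Space

/-- An alternating form of top degree on `ℝ³` is a multiple of the determinant. -/
theorem ContinuousAlternatingMap.apply_space (F : (ℝ × ℝ × ℝ) [⋀^Fin 3]→L[ℝ] ℝ)
    (u v w : ℝ × ℝ × ℝ) : F ![u, v, w] = F ![(1, 0, 0), (0, 1, 0), (0, 0, 1)] *
      (u.1 * (v.2.1 * w.2.2 - v.2.2 * w.2.1) - u.2.1 * (v.1 * w.2.2 - v.2.2 * w.1) +
        u.2.2 * (v.1 * w.2.1 - v.2.1 * w.1)) := by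
  let φ : (Fin 3 → ℝ) →ₗ[ℝ] ℝ × ℝ × ℝ :=
    (LinearMap.proj 0).prod ((LinearMap.proj 1).prod (LinearMap.proj 2))
  have hφ : ∀ x, φ x = (x 0, x 1, x 2) := fun x => rfl
  have h := AlternatingMap.eq_smul_basis_det (Pi.basisFun ℝ (Fin 3))
    (F.toAlternatingMap.compLinearMap φ)
  have h2 := DFunLike.congr_fun h
    ![![u.1, u.2.1, u.2.2], ![v.1, v.2.1, v.2.2], ![w.1, w.2.1, w.2.2]]
  rw [AlternatingMap.smul_apply, Pi.basisFun_det_apply, Matrix.det_fin_three] at h2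
  simp only [AlternatingMap.compLinearMap_apply, smul_eq_mul] at h2
  have e1 : (fun i => φ ((![![u.1, u.2.1, u.2.2], ![v.1, v.2.1, v.2.2],
      ![w.1, w.2.1, w.2.2]] : Fin 3 → Fin 3 → ℝ) i)) = ![u, v, w] := by
    ext i : 1; fin_cases i <;> rfl
  have e2 : (fun i => φ ((Pi.basisFun ℝ (Fin 3)) i)) =
      ![((1, 0, 0) : ℝ × ℝ × ℝ), (0, 1, 0), (0, 0, 1)] := by
    ext i : 1; fin_cases i <;> simp [hφ]
  rw [e1, e2] at h2
  refine (h2.trans ?_)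
  simp [Matrix.of_apply]
  left; ring

/-- A family on which some top-degree form does not vanish is a basis, so every nonzero top-degree
form is nonzero on it. Thus a frame oriented by `o` can also be measured with `μ`. -/
theorem ContinuousAlternatingMap.apply_ne_zero {E : Type*} [AddCommGroup E] [Module ℝ E]
    [TopologicalSpace E] {n : ℕ} (hn : Module.finrank ℝ E = n + 1)
    {O Ω : E [⋀^Fin (n + 1)]→L[ℝ] ℝ} {v : Fin (n + 1) → E}
    (hO : O v ≠ 0) (hΩ : Ω ≠ 0) : Ω v ≠ 0 := by
  have hli : LinearIndependent ℝ v :=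
    by_contra fun hv => hO (O.toAlternatingMap.map_linearDependent v hv)
  let b := basisOfLinearIndependentOfCardEqFinrank hli (by simp [hn])
  have hb : (b : Fin (n + 1) → E) = v := by simp [b]
  rw [← hb]
  refine (AlternatingMap.map_basis_ne_zero_iff b Ω.toAlternatingMap).2 fun h => hΩ ?_
  ext w
  exact DFunLike.congr_fun h w

theorem ContinuousAlternatingMap.rotate_three {E : Type*} [AddCommGroup E] [Module ℝ E]
    [TopologicalSpace E] (F : E [⋀^Fin 3]→L[ℝ] ℝ) (u v w : E) : F ![w, u, v] = F ![u, v, w] := by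
  have h1 := F.toAlternatingMap.map_swap ![u, v, w] (i := 0) (j := 2) (by simp)
  have h2 := F.toAlternatingMap.map_swap ![w, v, u] (i := 1) (j := 2) (by simp)
  have e1 : ![u, v, w] ∘ Equiv.swap (0 : Fin 3) 2 = ![w, v, u] := by
    ext i; fin_cases i <;> rfl
  have e2 : ![w, v, u] ∘ Equiv.swap (1 : Fin 3) 2 = ![w, u, v] := by
    ext i; fin_cases i <;> rfl
  rw [e1] at h1
  rw [e2, h1, neg_neg] at h2
  exact h2

end Space

/-! ### Integrable regions: periodicity, flux densities and the closed one-forms on the tori -/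

namespace PartialSections

section Translation

variable {E : Type*} [NormedAddCommGroup E] [NormedSpace ℝ E]
  {H : Type*} [TopologicalSpace H] {I : ModelWithCorners ℝ E H}
  {M : Type*} [TopologicalSpace M] [ChartedSpace H M]
  {V : Type*} [NormedAddCommGroup V] [NormedSpace ℝ V] {k : ℕ}

theorem pullbackWithin_add_period (η : DiffForm I M k) {g : V → M} {s : Set V} {e : V}
    (hs : UniqueDiffOn ℝ s) (he : ∀ z ∈ s, z + e ∈ s) (hge : ∀ z ∈ s, g (z + e) = g z)
    {z : V} (hz : z ∈ s) (hg : MDifferentiableWithinAt 𝓘(ℝ, V) I g s (z + e)) :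
    pullbackWithin η g s (z + e) = pullbackWithin η g s z := by
  have h1 : HasMFDerivWithinAt 𝓘(ℝ, V) 𝓘(ℝ, V) (fun z => z + e) s z (ContinuousLinearMap.id ℝ V) :=
    (HasFDerivWithinAt.hasMFDerivWithinAt ((hasFDerivWithinAt_id z s).add_const e))
  have h2 := HasMFDerivWithinAt.comp (x := z) (g := g) (f := fun z => z + e) (u := s)
    hg.hasMFDerivWithinAt h1 he
  have h3 := (HasMFDerivWithinAt.congr_of_eventuallyEq (f₁ := g) h2
    (Filter.eventually_of_mem self_mem_nhdsWithin fun z hz => (hge z hz).symm)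
    (hge z hz).symm).mfderivWithin (hs z hz).uniqueMDiffWithinAt
  ext v
  refine (DiffForm.apply_congr η (hge z hz) _).trans ?_
  exact congrArg (η (g z)) (funext fun i => (DFunLike.congr_fun h3 (v i)).symm)

end Translation

section Region

variable {M : Type*} [TopologicalSpace M] [ChartedSpace (EuclideanSpace ℝ (Fin 3)) M]
  {o μ : DiffForm (𝓡 3) M 3} {X : ∀ x : M, TangentSpace (𝓡 3) x} {Φ : ℝ × ℝ × ℝ → M}

theorem push_smul (Φ : ℝ × ℝ × ℝ → M) (q : ℝ × ℝ × ℝ) (t : ℝ) (v : ℝ × ℝ × ℝ) :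
    push Φ q (t • v) = t • push Φ q v :=
  (mfderivWithin 𝓘(ℝ, ℝ × ℝ × ℝ) (𝓡 3) Φ slab q).map_smul t v

/-- The coefficients of the closed one-form `ι_X σ_r` on the tori of an integrable region. -/
noncomputable def fluxDensity (μ : DiffForm (𝓡 3) M 3) (X : ∀ x : M, TangentSpace (𝓡 3) x)
    (Φ : ℝ × ℝ × ℝ → M) (v q : ℝ × ℝ × ℝ) : ℝ :=
  pullbackWithin (interiorProd X μ) Φ slab q ![v, (0, 0, 1)]

/-- The density of a three-form in the coordinates of an integrable region. -/
noncomputable def volumeDensity (μ : DiffForm (𝓡 3) M 3) (Φ : ℝ × ℝ × ℝ → M)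
    (q : ℝ × ℝ × ℝ) : ℝ :=
  pullbackWithin μ Φ slab q ![(1, 0, 0), (0, 1, 0), (0, 0, 1)]

theorem fluxDensity_eq (μ : DiffForm (𝓡 3) M 3) (X : ∀ x : M, TangentSpace (𝓡 3) x)
    (Φ : ℝ × ℝ × ℝ → M) (v q : ℝ × ℝ × ℝ) :
    fluxDensity μ X Φ v q = μ (Φ q) ![push Φ q (0, 0, 1), X (Φ q), push Φ q v] := by
  refine Eq.trans ?_ (ContinuousAlternatingMap.rotate_three (μ (Φ q)) _ _ _).symm
  exact congrArg (μ (Φ q)) (funext fun i => by fin_cases i <;> rfl)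

theorem apply_push (μ : DiffForm (𝓡 3) M 3) (Φ : ℝ × ℝ × ℝ → M) (q u v w : ℝ × ℝ × ℝ) :
    μ (Φ q) ![push Φ q u, push Φ q v, push Φ q w] = volumeDensity μ Φ q *
      (u.1 * (v.2.1 * w.2.2 - v.2.2 * w.2.1) - u.2.1 * (v.1 * w.2.2 - v.2.2 * w.1) +
        u.2.2 * (v.1 * w.2.1 - v.2.1 * w.1)) := by
  refine Eq.trans ?_ ((pullbackWithin μ Φ slab q).apply_space u v w)
  exact congrArg (μ (Φ q)) (funext fun i => by fin_cases i <;> rfl)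

theorem pullbackWithin_interiorProd (μ : DiffForm (𝓡 3) M 3) {q c : ℝ × ℝ × ℝ}
    (hc : X (Φ q) = push Φ q c) (u v : ℝ × ℝ × ℝ) :
    pullbackWithin (interiorProd X μ) Φ slab q ![u, v] = volumeDensity μ Φ q *
      (c.1 * (u.2.1 * v.2.2 - u.2.2 * v.2.1) - c.2.1 * (u.1 * v.2.2 - u.2.2 * v.1) +
        c.2.2 * (u.1 * v.2.1 - u.2.1 * v.1)) := by
  rw [← apply_push, ← hc]
  exact congrArg (μ (Φ q)) (funext fun i => by fin_cases i <;> rfl)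

theorem fluxClass_eq (μ : DiffForm (𝓡 3) M 3) (X : ∀ x : M, TangentSpace (𝓡 3) x)
    (Φ : ℝ × ℝ × ℝ → M) (r : ℝ) : fluxClass μ X Φ r =
      ⟨∫ s in (0 : ℝ)..1, fluxDensity μ X Φ (1, 0, 0) (s, 0, r),
        ∫ s in (0 : ℝ)..1, fluxDensity μ X Φ (0, 1, 0) (0, s, r)⟩ := by
  simp only [fluxDensity_eq]
  rfl

namespace IsIntegrableRegion

variable (h : IsIntegrableRegion o X Φ)
include h

theorem volumeDensity_pos {q : ℝ × ℝ × ℝ} (hq : q ∈ slab) : 0 < volumeDensity o Φ q := by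
  have := h.oriented q hq
  rw [apply_push] at this
  simpa using this

theorem volumeDensity_ne_zero (hμ : IsVolumeForm μ) {q : ℝ × ℝ × ℝ} (hq : q ∈ slab) :
    volumeDensity μ Φ q ≠ 0 := by
  have h1 := ContinuousAlternatingMap.apply_ne_zero (n := 2) (E := EuclideanSpace ℝ (Fin 3))
    (by simp) (h.oriented q hq).ne' (hμ.2 (Φ q))
  have h2 := apply_push μ Φ q (1, 0, 0) (0, 1, 0) (0, 0, 1)
  exact left_ne_zero_of_mul (h2 ▸ h1)

/-- The coordinates of `X` in an integrable region. -/
theorem field_eq (hμ : IsVolumeForm μ) {q : ℝ × ℝ × ℝ} (hq : q ∈ slab) :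
    X (Φ q) = (volumeDensity μ Φ q)⁻¹ •
      push Φ q (fluxDensity μ X Φ (0, 1, 0) q, -fluxDensity μ X Φ (1, 0, 0) q, 0) := by
  obtain ⟨c₁, c₂, hc⟩ := h.tangent q hq
  have hm := h.volumeDensity_ne_zero hμ hq
  have h1 : push Φ q (c₁, c₂, 0) = (volumeDensity μ Φ q)⁻¹ •
      push Φ q (volumeDensity μ Φ q • ((c₁, c₂, 0) : ℝ × ℝ × ℝ)) := by
    rw [push_smul, smul_smul, inv_mul_cancel₀ hm, one_smul]
  rw [fluxDensity, fluxDensity, pullbackWithin_interiorProd μ hc, pullbackWithin_interiorProd μ hc,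
    hc, h1]
  congr 2
  simp

theorem pullbackWithin_add {k : ℕ} (η : DiffForm (𝓡 3) M k) {q : ℝ × ℝ × ℝ} (hq : q ∈ slab) :
    pullbackWithin η Φ slab (q + (1, 0, 0)) = pullbackWithin η Φ slab q ∧
      pullbackWithin η Φ slab (q + (0, 1, 0)) = pullbackWithin η Φ slab q := by
  have hm : ∀ e : ℝ × ℝ × ℝ, e.2.2 = 0 → ∀ z ∈ slab, z + e ∈ slab := by
    intro e he z hz
    simpa [slab, he] using hz
  constructor
  · refine pullbackWithin_add_period η uniqueDiffOn_slab (hm _ rfl) (fun z hz => ?_) hq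
      ((h.smooth _ (hm _ rfl q hq)).mdifferentiableWithinAt (by simp))
    obtain ⟨x, y, r⟩ := z
    simpa using (h.periodic x y r hz).1
  · refine pullbackWithin_add_period η uniqueDiffOn_slab (hm _ rfl) (fun z hz => ?_) hq
      ((h.smooth _ (hm _ rfl q hq)).mdifferentiableWithinAt (by simp))
    obtain ⟨x, y, r⟩ := z
    simpa using (h.periodic x y r hz).2

variable [IsManifold (𝓡 3) ∞ M]

theorem continuousOn_volumeDensity (hμ : IsVolumeForm μ) :
    ContinuousOn (volumeDensity μ Φ) slab := fun q hq =>
  (hμ.1.contDiffWithinAt_pullbackWithin uniqueDiffOn_slab hq (h.smooth q hq) _).continuousWithinAt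

/-- The exterior derivative of `ι_X μ` vanishes; evaluated on the coordinate frame it is the sum of
three terms, of which the `r`-derivative drops out because `X` is tangent to the tori. The densities
have no common zero since they determine `X`. -/
theorem isClosedFamily (hX : IsNonvanishingField X) (hμ : IsVolumeForm μ) (hp : Preserves X μ) :
    IsClosedFamily (fluxDensity μ X Φ (1, 0, 0)) (fluxDensity μ X Φ (0, 1, 0)) := by
  have hN : IsSmoothForm (interiorProd X μ) := hμ.1.interiorProd hX.1
  have hs : ∀ v : Fin 2 → ℝ × ℝ × ℝ,
      ContDiffOn ℝ ∞ (fun q => pullbackWithin (interiorProd X μ) Φ slab q v) slab := fun v q hq =>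
    hN.contDiffWithinAt_pullbackWithin uniqueDiffOn_slab hq (h.smooth q hq) v
  have hper : ∀ v, ∀ r ∈ Icc (0 : ℝ) 1, IsDoublyPeriodic (fluxDensity μ X Φ v ∘ atHeight r) := by
    refine fun v r hr => ⟨fun z => ?_, fun z => ?_⟩
    · have := (h.pullbackWithin_add (interiorProd X μ) (atHeight_mem hr z)).1
      simp only [Function.comp_apply, fluxDensity]
      rw [← this]
      simp [atHeight]
    · have := (h.pullbackWithin_add (interiorProd X μ) (atHeight_mem hr z)).2
      simp only [Function.comp_apply, fluxDensity]
      rw [← this]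
      simp [atHeight]
  refine ⟨hs _, hs _, hper _, hper _, fun q hq => ?_, fun q hq => ?_⟩
  · have hcl : q ∈ closure (interior slab) := by
      rw [convex_slab.closure_interior_eq_closure_of_nonempty_interior]
      · exact subset_closure hq
      · rw [interior_slab]; exact ⟨(0, 0, 1 / 2), by norm_num⟩
    have h1 := hN.extDerivWithin_pullbackWithin uniqueDiffOn_slab hq hcl (h.smooth q hq)
    have h2 := DFunLike.congr_fun h1 ![((1, 0, 0) : ℝ × ℝ × ℝ), (0, 1, 0), (0, 0, 1)]
    have h3 : pullbackWithin (PartialSections.extD (interiorProd X μ)) Φ slab q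
        ![((1, 0, 0) : ℝ × ℝ × ℝ), (0, 1, 0), (0, 0, 1)] = 0 := by
      rw [pullbackWithin_apply, hp]; rfl
    rw [h3, extDerivWithin_apply
      (hN.differentiableWithinAt_pullbackWithin uniqueDiffOn_slab hq (h.smooth q hq))
      (uniqueDiffOn_slab q hq), Fin.sum_univ_three] at h2
    have e0 : Fin.removeNth 0 ![((1, 0, 0) : ℝ × ℝ × ℝ), (0, 1, 0), (0, 0, 1)] =
      ![(0, 1, 0), (0, 0, 1)] := by ext i : 1; fin_cases i <;> rfl
    have e1 : Fin.removeNth 1 ![((1, 0, 0) : ℝ × ℝ × ℝ), (0, 1, 0), (0, 0, 1)] =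
      ![(1, 0, 0), (0, 0, 1)] := by ext i : 1; fin_cases i <;> rfl
    have e2 : Fin.removeNth 2 ![((1, 0, 0) : ℝ × ℝ × ℝ), (0, 1, 0), (0, 0, 1)] =
      ![(1, 0, 0), (0, 1, 0)] := by ext i : 1; fin_cases i <;> rfl
    rw [e0, e1, e2] at h2
    -- On two horizontal vectors `ι_X μ` is zero, as three vectors tangent to a torus are dependent.
    have h4 : fderivWithin ℝ (fun q => pullbackWithin (interiorProd X μ) Φ slab q
        ![(1, 0, 0), (0, 1, 0)]) slab q = 0 := by
      have hz : ∀ p ∈ slab, pullbackWithin (interiorProd X μ) Φ slab p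
          ![(1, 0, 0), (0, 1, 0)] = 0 := fun p hp => by
        obtain ⟨c₁, c₂, hc⟩ := h.tangent p hp
        simp [pullbackWithin_interiorProd μ hc]
      rw [fderivWithin_congr (f := fun _ => (0 : ℝ)) hz (hz q hq)]
      simp
    rw [h4] at h2
    simp only [Fin.val_zero, pow_zero, one_smul, Fin.val_one, pow_one, Matrix.cons_val_zero,
      Matrix.cons_val_one, zero_apply, smul_zero, add_zero] at h2
    unfold fluxDensity
    linarith [h2.symm.trans (congrArg _ (neg_one_smul ℤ _))]
  · by_contra! hne
    refine hX.2 (Φ q) ?_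
    rw [h.field_eq hμ hq, hne.1, hne.2, show ((0, -0, 0) : ℝ × ℝ × ℝ) = (0 : ℝ) • 0 by simp,
      push_smul, zero_smul, smul_zero]

/-- Coordinates of an integrable region in which the orbits of `X` are straight. -/
theorem exists_coordinateFamily (hX : IsNonvanishingField X) (hμ : IsVolumeForm μ)
    (hp : Preserves X μ) : ∃ (F G : ℝ × ℝ × ℝ → ℝ) (c d : ℝ → ℝ),
      IsCoordinateFamily (fluxDensity μ X Φ (1, 0, 0)) (fluxDensity μ X Φ (0, 1, 0)) F G
        (fun r => (fluxClass μ X Φ r).re) (fun r => (fluxClass μ X Φ r).im) c d := by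
  have hc := h.isClosedFamily hX hμ hp
  obtain ⟨F, hF⟩ := hc.exists_potentialFamily
  obtain ⟨G, c, d, hG, hGq⟩ := hF.exists_transverse_family hc
  refine ⟨F, G, c, d, hc, ?_, hG, fun r hr => (hGq r hr).1, fun r hr => (hGq r hr).2⟩
  simpa only [fluxClass_eq] using hF

end IsIntegrableRegion

end Region

end PartialSections

/-! ### The annulus as a compact surface with boundary -/

namespace PartialSections

section Annulus

/-- The annulus `S¹ × [0, 1]`. -/
def Annulus : Type := AddCircle (1 : ℝ) × Icc (0 : ℝ) 1

namespace Annulus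

instance : TopologicalSpace Annulus :=
  inferInstanceAs (TopologicalSpace (AddCircle (1 : ℝ) × Icc (0 : ℝ) 1))

instance : T2Space Annulus := inferInstanceAs (T2Space (AddCircle (1 : ℝ) × Icc (0 : ℝ) 1))

instance : CompactSpace Annulus := by
  have : Fact ((0 : ℝ) < 1) := ⟨one_pos⟩
  exact inferInstanceAs (CompactSpace (AddCircle (1 : ℝ) × Icc (0 : ℝ) 1))

instance : Nonempty Annulus := inferInstanceAs (Nonempty (AddCircle (1 : ℝ) × Icc (0 : ℝ) 1))

/-- The height coordinate that vanishes on the lower or on the upper boundary circle. -/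
def reflect (k : Bool) (x : ℝ) : ℝ := if k then 1 - x else x

/-- The derivative of `reflect k`. -/
def reflectSign (k : Bool) : ℝ := if k then -1 else 1

theorem reflect_reflect (k : Bool) (x : ℝ) : reflect k (reflect k x) = x := by
  cases k <;> simp [reflect]

theorem reflect_mem_Icc {k : Bool} {x : ℝ} (hx : x ∈ Icc (0 : ℝ) 1) :
    reflect k x ∈ Icc (0 : ℝ) 1 := by
  cases k
  · exact hx
  · simpa [reflect, and_comm] using hx

theorem contDiff_reflect (k : Bool) : ContDiff ℝ ∞ (reflect k) := by
  cases k
  · exact contDiff_id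
  · exact contDiff_const.sub contDiff_id

theorem hasDerivAt_reflect (k : Bool) (x : ℝ) : HasDerivAt (reflect k) (reflectSign k) x := by
  cases k
  · exact hasDerivAt_id x
  · exact (hasDerivAt_id x).const_sub 1

theorem reflectSign_mul_self (k : Bool) : reflectSign k * reflectSign k = 1 := by
  cases k <;> simp [reflectSign]

/-- The point of the annulus with given angle and height. -/
noncomputable def point (z : ℝ × ℝ) : Annulus := ((z.1 : AddCircle (1 : ℝ)), projIcc 0 1 zero_le_one z.2)

theorem continuous_point : Continuous point :=
  ((AddCircle.continuous_mk' 1).comp continuous_fst).prodMk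
    (continuous_projIcc.comp continuous_snd)

/-- The plane, with coordinates adapted to one of the boundary circles. -/
def unroll (k : Bool) (y : EuclideanSpace ℝ (Fin 2)) : ℝ × ℝ := (y 1, reflect k (y 0))

/-- The inverse of `unroll k`. -/
noncomputable def reroll (k : Bool) (z : ℝ × ℝ) : EuclideanSpace ℝ (Fin 2) := !₂[reflect k z.2, z.1]

theorem unroll_reroll (k : Bool) (z : ℝ × ℝ) : unroll k (reroll k z) = z := by
  simp [unroll, reroll, reflect_reflect]

theorem reroll_unroll (k : Bool) (y : EuclideanSpace ℝ (Fin 2)) : reroll k (unroll k y) = y := by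
  ext i; fin_cases i <;> simp [unroll, reroll, reflect_reflect]

theorem contDiff_unroll (k : Bool) : ContDiff ℝ ∞ (unroll k) := by
  have := contDiff_reflect k
  unfold unroll
  fun_prop

theorem contDiff_reroll (k : Bool) : ContDiff ℝ ∞ (reroll k) := by
  have h := contDiff_reflect k
  rw [contDiff_euclidean]
  intro i
  fin_cases i
  · exact h.comp contDiff_snd
  · exact contDiff_fst

instance fact_one_pos : Fact ((0 : ℝ) < 1) := ⟨one_pos⟩

/-- The angle in `(θ, θ + 1)` of a point of the circle. -/
noncomputable def angle (θ : ℝ) (x : AddCircle (1 : ℝ)) : ℝ := AddCircle.equivIco 1 θ x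

theorem coe_angle (θ : ℝ) (x : AddCircle (1 : ℝ)) : (angle θ x : AddCircle (1 : ℝ)) = x :=
  (AddCircle.equivIco 1 θ).symm_apply_apply x

theorem angle_mem {θ : ℝ} {x : AddCircle (1 : ℝ)} (hx : x ≠ θ) : angle θ x ∈ Ioo θ (θ + 1) :=
  (AddCircle.openPartialHomeomorphCoe (1 : ℝ) θ).map_target hx

theorem angle_coe {θ s : ℝ} (hs : s ∈ Ioo θ (θ + 1)) : angle θ (s : AddCircle (1 : ℝ)) = s :=
  (AddCircle.openPartialHomeomorphCoe (1 : ℝ) θ).left_inv hs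

theorem coe_ne {θ s : ℝ} (hs : s ∈ Ioo θ (θ + 1)) : (s : AddCircle (1 : ℝ)) ≠ θ :=
  (AddCircle.openPartialHomeomorphCoe (1 : ℝ) θ).map_source hs

/-- Two branches of the angle differ by a locally constant integer, which is why the changes of
charts of the annulus are affine. -/
theorem eventually_angle_coe {θ s₀ : ℝ} (hs : (s₀ : AddCircle (1 : ℝ)) ≠ θ) :
    ∃ n : ℤ, ∀ᶠ s : ℝ in 𝓝 s₀, angle θ (s : AddCircle (1 : ℝ)) = s + (n : ℝ) := by
  have h1 := coe_angle θ (s₀ : AddCircle (1 : ℝ))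
  rw [← sub_eq_zero, ← AddCircle.coe_sub, AddCircle.coe_eq_zero_iff] at h1
  obtain ⟨n, hn⟩ := h1
  rw [zsmul_one] at hn
  refine ⟨n, ?_⟩
  have h2 : s₀ + n ∈ Ioo θ (θ + 1) := by
    rw [hn, add_sub_cancel]; exact angle_mem hs
  filter_upwards [(continuous_add_const (n : ℝ)).continuousAt.eventually
    (isOpen_Ioo.mem_nhds h2)] with s hs
  rw [← angle_coe hs, AddCircle.coe_add, show ((n : ℝ) : AddCircle (1 : ℝ)) = 0 from
    (AddCircle.coe_eq_zero_iff 1).2 ⟨n, zsmul_one n⟩, add_zero]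

/-- The charts of the annulus. -/
noncomputable def annulusChart (k : Bool) (θ : ℝ) :
    OpenPartialHomeomorph Annulus (EuclideanHalfSpace 2) where
  toFun p := ⟨reroll k (angle θ p.1, p.2), (reflect_mem_Icc p.2.2).1⟩
  invFun w := point (unroll k w.1)
  -- Besides one angle, the boundary circle opposite to the chosen one is left out, so each chart
  -- sees a single boundary circle, on the boundary line of the half-plane.
  source := {p | p.1 ≠ θ ∧ reflect k p.2 < 1}
  target := {w | w.1 1 ∈ Ioo θ (θ + 1) ∧ w.1 0 < 1}
  map_source' p hp := ⟨angle_mem hp.1, hp.2⟩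
  map_target' w hw := by
    have h : reflect k (w.1 0) ∈ Icc (0 : ℝ) 1 := reflect_mem_Icc ⟨w.2, hw.2.le⟩
    refine ⟨coe_ne hw.1, ?_⟩
    simp only [point, unroll, projIcc_of_mem zero_le_one h, reflect_reflect]
    exact hw.2
  left_inv' p hp := by
    rw [unroll_reroll]
    exact Prod.ext (coe_angle θ p.1) (projIcc_val zero_le_one p.2)
  right_inv' w hw := by
    have h : reflect k (w.1 0) ∈ Icc (0 : ℝ) 1 := reflect_mem_Icc ⟨w.2, hw.2.le⟩
    refine Subtype.ext ?_
    simp only [point, unroll, projIcc_of_mem zero_le_one h, angle_coe hw.1]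
    exact reroll_unroll k w.1
  open_source := by
    refine (isOpen_compl_singleton.preimage continuous_fst).inter
      (isOpen_lt ((contDiff_reflect k).continuous.comp
        (continuous_subtype_val.comp continuous_snd)) continuous_const)
  open_target := by
    have h : ∀ i, Continuous fun w : EuclideanHalfSpace 2 => w.1 i := fun i => by
      have : Continuous fun w : EuclideanHalfSpace 2 => w.1 := continuous_subtype_val
      fun_prop
    exact (isOpen_Ioo.preimage (h 1)).inter (isOpen_lt (h 0) continuous_const)
  continuousOn_toFun := by
    have h : Topology.IsInducing (Subtype.val : EuclideanHalfSpace 2 → EuclideanSpace ℝ (Fin 2)) :=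
      Topology.IsInducing.subtypeVal
    refine h.continuousOn_iff.2 ((contDiff_reroll k).continuous.comp_continuousOn
      (ContinuousOn.prodMk ?_ (continuous_subtype_val.comp continuous_snd).continuousOn))
    exact (AddCircle.openPartialHomeomorphCoe (1 : ℝ) θ).continuousOn_symm.comp
      continuous_fst.continuousOn fun p hp => hp.1
  continuousOn_invFun :=
    (continuous_point.comp ((contDiff_unroll k).continuous.comp continuous_subtype_val)).continuousOn

theorem exists_coe_ne (x : AddCircle (1 : ℝ)) : ∃ θ : ℝ, x ≠ θ := by
  obtain ⟨s, rfl⟩ := QuotientAddGroup.mk_surjective x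
  exact ⟨s - 1 / 2, coe_ne ⟨by linarith, by linarith⟩⟩

/-- The boundary circle that is visible in the preferred chart at `p`. -/
noncomputable def side (p : Annulus) : Bool := decide (¬ (p.2 : ℝ) < 1)

/-- The angle that is omitted in the preferred chart at `p`. -/
noncomputable def cut (p : Annulus) : ℝ := (exists_coe_ne p.1).choose

theorem reflect_side_lt (p : Annulus) : reflect (side p) p.2 < 1 := by
  by_cases h : (p.2 : ℝ) < 1
  · simp [side, reflect, h]
  · simp only [side, reflect, h, not_false_eq_true, decide_true, if_true]
    linarith [not_lt.1 h]

noncomputable instance : ChartedSpace (EuclideanHalfSpace 2) Annulus where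
  atlas := range fun i : Bool × ℝ => annulusChart i.1 i.2
  chartAt p := annulusChart (side p) (cut p)
  mem_chart_source p := ⟨(exists_coe_ne p.1).choose_spec, reflect_side_lt p⟩
  chart_mem_atlas p := ⟨(side p, cut p), rfl⟩

theorem mem_extend_target_iff {k : Bool} {θ : ℝ} {y : EuclideanSpace ℝ (Fin 2)} :
    y ∈ ((annulusChart k θ).extend (𝓡∂ 2)).target ↔ y 0 ∈ Ico (0 : ℝ) 1 ∧ y 1 ∈ Ioo θ (θ + 1) := by
  rw [OpenPartialHomeomorph.extend_target, range_modelWithCornersEuclideanHalfSpace]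
  constructor
  · rintro ⟨⟨h1, h2⟩, h3⟩
    have h3' : 0 ≤ y 0 := h3
    have h4 : ((𝓡∂ 2).symm y).1 = y := (𝓡∂ 2).right_inv
      (by rw [range_modelWithCornersEuclideanHalfSpace]; exact h3)
    rw [h4] at h1 h2
    exact ⟨⟨h3', h2⟩, h1⟩
  · rintro ⟨⟨h1, h2⟩, h3⟩
    have h4 : ((𝓡∂ 2).symm y).1 = y := (𝓡∂ 2).right_inv
      (by rw [range_modelWithCornersEuclideanHalfSpace]; exact h1)
    refine ⟨?_, h1⟩
    change ((𝓡∂ 2).symm y).1 1 ∈ _ ∧ ((𝓡∂ 2).symm y).1 0 < 1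
    rw [h4]
    exact ⟨h3, h2⟩

theorem extend_symm_apply {k : Bool} {θ : ℝ} {y : EuclideanSpace ℝ (Fin 2)}
    (hy : 0 ≤ y 0) : ((annulusChart k θ).extend (𝓡∂ 2)).symm y = point (unroll k y) := by
  have h4 : ((𝓡∂ 2).symm y).1 = y := (𝓡∂ 2).right_inv
    (by rw [range_modelWithCornersEuclideanHalfSpace]; exact hy)
  change point (unroll k ((𝓡∂ 2).symm y).1) = _
  rw [h4]

theorem extend_apply {k : Bool} {θ : ℝ} {p : Annulus} :
    (annulusChart k θ).extend (𝓡∂ 2) p = reroll k (angle θ p.1, p.2) := rfl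

/-- Up to a period, the coordinates of all charts of the annulus agree. -/
theorem eventually_extend_symm {k k' : Bool} {θ θ' : ℝ} {y₀ : EuclideanSpace ℝ (Fin 2)}
    (h : y₀ 0 ∈ Ico (0 : ℝ) 1) (h' : (y₀ 1 : AddCircle (1 : ℝ)) ≠ θ') :
    ∃ n : ℤ, ∀ᶠ y in 𝓝[range (𝓡∂ 2)] y₀,
      (annulusChart k' θ').extend (𝓡∂ 2) (((annulusChart k θ).extend (𝓡∂ 2)).symm y) =
        reroll k' (unroll k y + ((n : ℝ), 0)) := by
  obtain ⟨n, hn⟩ := eventually_angle_coe h'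
  refine ⟨n, ?_⟩
  have hc : ∀ i, Continuous fun y : EuclideanSpace ℝ (Fin 2) => y i := fun i => by fun_prop
  have h1 := Filter.Eventually.filter_mono (nhdsWithin_le_nhds (s := range (𝓡∂ 2)))
    ((hc 1).continuousAt.eventually hn)
  have h2 := Filter.Eventually.filter_mono (nhdsWithin_le_nhds (s := range (𝓡∂ 2)))
    ((hc 0).continuousAt.eventually (isOpen_Iio.mem_nhds h.2))
  filter_upwards [h1, h2, self_mem_nhdsWithin] with y hy1 hy2 hy3
  rw [range_modelWithCornersEuclideanHalfSpace] at hy3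
  have h3 : reflect k (y 0) ∈ Icc (0 : ℝ) 1 := reflect_mem_Icc ⟨hy3, le_of_lt hy2⟩
  rw [extend_symm_apply hy3, extend_apply]
  simp only [point, unroll, projIcc_of_mem zero_le_one h3, Prod.mk_add_mk, add_zero]
  exact congrArg (fun s => reroll k' (s, reflect k (y 0))) hy1

/-- Changes of charts are locally compositions of reflections of the height and integer translations
of the angle. -/
instance : IsManifold (𝓡∂ 2) ∞ Annulus := by
  refine isManifold_of_contDiffOn _ _ _ ?_
  rintro _ _ ⟨⟨k, θ⟩, rfl⟩ ⟨⟨k', θ'⟩, rfl⟩ y ⟨⟨hy1, hy2⟩, hy3⟩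
  have hy : y ∈ ((annulusChart k θ).extend (𝓡∂ 2)).target := by
    rw [OpenPartialHomeomorph.extend_target]; exact ⟨hy1, hy3⟩
  rw [mem_extend_target_iff] at hy
  have h1 : ((annulusChart k θ).extend (𝓡∂ 2)).symm y ∈ (annulusChart k' θ').source := hy2
  rw [extend_symm_apply hy.1.1] at h1
  obtain ⟨n, hn⟩ := eventually_extend_symm (k := k) (k' := k') (θ := θ) hy.1 h1.1
  have h2 : ContDiffWithinAt ℝ ∞ (fun y => reroll k' (unroll k y + ((n : ℝ), 0)))
      (range (𝓡∂ 2)) y :=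
    ((contDiff_reroll k').comp ((contDiff_unroll k).add contDiff_const)).contDiffAt.contDiffWithinAt
  exact (h2.congr_of_eventuallyEq_of_mem hn hy3).mono inter_subset_right

end Annulus

end Annulus

end PartialSections

/-- The determinant, as a two-form on the plane. -/
noncomputable def planeArea : (ℝ × ℝ) [⋀^Fin 2]→L[ℝ] ℝ :=
  { (Module.Basis.finTwoProd ℝ).det with
    cont := by
      have h : (fun v : Fin 2 → ℝ × ℝ => (Module.Basis.finTwoProd ℝ).det v) =
          fun v => (v 0).1 * (v 1).2 - (v 1).1 * (v 0).2 := by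
        funext v
        rw [Module.Basis.det_apply, Matrix.det_fin_two]
        simp [Module.Basis.toMatrix_apply]
      change Continuous fun v : Fin 2 → ℝ × ℝ => (Module.Basis.finTwoProd ℝ).det v
      rw [h]
      fun_prop }

theorem planeArea_apply (v : Fin 2 → ℝ × ℝ) :
    planeArea v = (v 0).1 * (v 1).2 - (v 1).1 * (v 0).2 := by
  change (Module.Basis.finTwoProd ℝ).det v = _
  rw [Module.Basis.det_apply, Matrix.det_fin_two]
  simp [Module.Basis.toMatrix_apply]

/-! ### The global frame of the annulus and its area forms -/

namespace PartialSections

section Annulus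

namespace Annulus

/-- The derivative of `unroll k`. -/
noncomputable def unrollLinear (k : Bool) : EuclideanSpace ℝ (Fin 2) →L[ℝ] ℝ × ℝ :=
  (EuclideanSpace.proj (1 : Fin 2)).prod (reflectSign k • EuclideanSpace.proj (0 : Fin 2))

theorem unrollLinear_apply (k : Bool) (w : EuclideanSpace ℝ (Fin 2)) :
    unrollLinear k w = (w 1, reflectSign k * w 0) := rfl

theorem unrollLinear_bijective (k : Bool) : Function.Bijective (unrollLinear k) := by
  refine ⟨fun v w h => ?_, fun z => ⟨!₂[reflectSign k * z.2, z.1], ?_⟩⟩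
  · rw [unrollLinear_apply, unrollLinear_apply, Prod.mk.injEq] at h
    have h2 := congrArg (reflectSign k * ·) h.2
    simp only [← mul_assoc, reflectSign_mul_self, one_mul] at h2
    ext i; fin_cases i
    · exact h2
    · exact h.1
  · simp [unrollLinear_apply, ← mul_assoc, reflectSign_mul_self]

theorem hasFDerivAt_unroll (k : Bool) (y : EuclideanSpace ℝ (Fin 2)) :
    HasFDerivAt (unroll k) (unrollLinear k) y := by
  have h : ∀ i : Fin 2, HasFDerivAt (fun y : EuclideanSpace ℝ (Fin 2) => y i)
      (EuclideanSpace.proj i : EuclideanSpace ℝ (Fin 2) →L[ℝ] ℝ) y := fun i =>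
    (EuclideanSpace.proj i : EuclideanSpace ℝ (Fin 2) →L[ℝ] ℝ).hasFDerivAt
  have h2 : HasFDerivAt (reflect k ∘ fun y : EuclideanSpace ℝ (Fin 2) => y 0)
      (reflectSign k • (EuclideanSpace.proj 0 : EuclideanSpace ℝ (Fin 2) →L[ℝ] ℝ)) y :=
    (hasDerivAt_reflect k (y 0)).comp_hasFDerivAt y (h 0)
  exact (h 1).prodMk h2

/-- The angle and the height. -/
noncomputable def unrolled (θ : ℝ) (p : Annulus) : ℝ × ℝ := (angle θ p.1, p.2)

theorem extChartAt_apply (p q : Annulus) :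
    extChartAt (𝓡∂ 2) p q = reroll (side p) (unrolled (cut p) q) := rfl

theorem unroll_extChartAt (p q : Annulus) :
    unroll (side p) (extChartAt (𝓡∂ 2) p q) = unrolled (cut p) q := by
  rw [extChartAt_apply, unroll_reroll]

/-- The coordinates of tangent vectors of the annulus. -/
noncomputable def tangentCoord (p : Annulus) : TangentSpace (𝓡∂ 2) p →L[ℝ] ℝ × ℝ :=
  (unrollLinear (side p)).comp
    (mfderiv (𝓡∂ 2) 𝓘(ℝ, EuclideanSpace ℝ (Fin 2)) (extChartAt (𝓡∂ 2) p) p)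

theorem tangentCoord_bijective (p : Annulus) : Function.Bijective (tangentCoord p) :=
  (unrollLinear_bijective _).comp
    (isInvertible_mfderiv_extChartAt (mem_extChartAt_source p)).bijective

/-- The inward direction is that of increasing height at the lower circle and of decreasing height
at the upper one; the sign of the reflection records this. -/
theorem inwardCoord_eq (p : Annulus) (v : TangentSpace (𝓡∂ 2) p) :
    inwardCoord p v = reflectSign (side p) * (tangentCoord p v).2 := by
  set w : EuclideanSpace ℝ (Fin 2) :=
    mfderiv (𝓡∂ 2) 𝓘(ℝ, EuclideanSpace ℝ (Fin 2)) (extChartAt (𝓡∂ 2) p) p v with hw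
  have h : tangentCoord p v = (w 1, reflectSign (side p) * w 0) := rfl
  rw [h, ← mul_assoc, reflectSign_mul_self, one_mul]
  rfl

theorem contMDiffAt_unrolled {p q : Annulus}
    (hq : q ∈ (chartAt (EuclideanHalfSpace 2) p).source) :
    ContMDiffAt (𝓡∂ 2) 𝓘(ℝ, ℝ × ℝ) ∞ (unrolled (cut p)) q := by
  have h : unrolled (cut p) = unroll (side p) ∘ extChartAt (𝓡∂ 2) p :=
    funext fun q => (unroll_extChartAt p q).symm
  rw [h]
  exact ((contDiff_unroll (side p)).contMDiff _).comp q (contMDiffAt_extChartAt' hq)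

theorem hasMFDerivAt_unrolled (p : Annulus) :
    HasMFDerivAt (𝓡∂ 2) 𝓘(ℝ, ℝ × ℝ) (unrolled (cut p)) p (tangentCoord p) := by
  have h : unrolled (cut p) = unroll (side p) ∘ extChartAt (𝓡∂ 2) p :=
    funext fun q => (unroll_extChartAt p q).symm
  rw [h]
  exact HasMFDerivAt.comp p (hasFDerivAt_unroll (side p) _).hasMFDerivAt
    (mdifferentiableAt_extChartAt (mem_chart_source _ p)).hasMFDerivAt

/-- The tangent coordinates are the derivatives of the coordinates of any chart. -/
theorem tangentCoord_comp_symm (p : Annulus) {y : EuclideanSpace ℝ (Fin 2)}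
    (hy : y ∈ (extChartAt (𝓡∂ 2) p).target) (v : EuclideanSpace ℝ (Fin 2)) :
    tangentCoord ((extChartAt (𝓡∂ 2) p).symm y)
      (mfderivWithin 𝓘(ℝ, EuclideanSpace ℝ (Fin 2)) (𝓡∂ 2) (extChartAt (𝓡∂ 2) p).symm
        (range (𝓡∂ 2)) y v) = unrollLinear (side p) v := by
  set q := (extChartAt (𝓡∂ 2) p).symm y with hq
  have hyr := extChartAt_target_subset_range p hy
  have hy' := mem_extend_target_iff.1 (show y ∈ ((annulusChart (side p) (cut p)).extend
    (𝓡∂ 2)).target from hy)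
  have hqs : q ∈ (chartAt (EuclideanHalfSpace 2) q).source := mem_chart_source _ q
  have hne : (y 1 : AddCircle (1 : ℝ)) ≠ cut q := by
    have h1 : q.1 = y 1 := congrArg Prod.fst (extend_symm_apply (k := side p) (θ := cut p) hy'.1.1)
    rw [← h1]
    exact hqs.1
  obtain ⟨n, hn⟩ := eventually_extend_symm (k := side p) (k' := side q) (θ := cut p) hy'.1 hne
  have h1 : (unrolled (cut q) ∘ (extChartAt (𝓡∂ 2) p).symm) =ᶠ[𝓝[range (𝓡∂ 2)] y]
      fun y => unroll (side p) y + ((n : ℝ), 0) := by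
    filter_upwards [hn] with z hz
    exact (unroll_extChartAt q _).symm.trans ((congrArg (unroll (side q)) hz).trans
      (unroll_reroll _ _))
  have h2 : HasMFDerivWithinAt 𝓘(ℝ, EuclideanSpace ℝ (Fin 2)) 𝓘(ℝ, ℝ × ℝ)
      (fun y => unroll (side p) y + ((n : ℝ), 0)) (range (𝓡∂ 2)) y (unrollLinear (side p)) :=
    ((hasFDerivAt_unroll (side p) y).add_const _).hasFDerivWithinAt.hasMFDerivWithinAt
  have h3 := (HasMFDerivWithinAt.congr_of_eventuallyEq h2 h1
    (h1.self_of_nhdsWithin hyr)).mfderivWithin ((𝓡∂ 2).uniqueMDiffOn y hyr)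
  have h4 := HasMFDerivAt.comp_hasMFDerivWithinAt y (hasMFDerivAt_unrolled q)
    (mdifferentiableWithinAt_extChartAt_symm hy).hasMFDerivWithinAt
  rw [h4.mfderivWithin ((𝓡∂ 2).uniqueMDiffOn y hyr)] at h3
  exact DFunLike.congr_fun h3 v

/-- The area form `σ ds ∧ dr` of the annulus. -/
noncomputable def areaForm (σ : ℝ) : DiffForm (𝓡∂ 2) Annulus 2 := fun p =>
  (σ • planeArea).compContinuousLinearMap (tangentCoord p)

theorem areaForm_apply (σ : ℝ) (p : Annulus) (u v : TangentSpace (𝓡∂ 2) p) :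
    areaForm σ p ![u, v] = σ * ((tangentCoord p u).1 * (tangentCoord p v).2 -
      (tangentCoord p v).1 * (tangentCoord p u).2) :=
  congrArg (σ * ·) (planeArea_apply fun i => tangentCoord p (![u, v] i))

/-- In the chart at any point the form has constant coefficients, because the tangent coordinates
there are given by a fixed linear isomorphism. -/
theorem isVolumeForm_areaForm {σ : ℝ} (hσ : σ ≠ 0) : IsVolumeForm (areaForm σ) := by
  refine ⟨fun p => ?_, fun p hp => ?_⟩
  · refine (contDiffOn_const (c := (σ • planeArea).compContinuousLinearMap
      (unrollLinear (side p)))).congr fun y hy => ?_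
    ext v
    exact congrArg (σ • planeArea) (funext fun i => tangentCoord_comp_symm p hy (v i))
  · obtain ⟨u, hu⟩ := (tangentCoord_bijective p).2 (1, 0)
    obtain ⟨v, hv⟩ := (tangentCoord_bijective p).2 (0, 1)
    have h := areaForm_apply σ p u v
    rw [hu, hv, hp] at h
    have h2 : σ = 0 := by simpa using h.symm
    exact hσ h2

/-- The preferred chart at a point shows the lower circle unless the point lies on the upper one, so
its half-plane coordinate vanishes exactly at heights 0 and 1. -/
theorem mem_interior_iff (p : Annulus) : p ∈ (𝓡∂ 2).interior Annulus ↔ (p.2 : ℝ) ∈ Ioo (0 : ℝ) 1 := by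
  change extChartAt (𝓡∂ 2) p p ∈ interior (range (𝓡∂ 2)) ↔ _
  rw [interior_range_modelWithCornersEuclideanHalfSpace]
  change 0 < reflect (side p) p.2 ↔ _
  by_cases h : (p.2 : ℝ) < 1
  · simp [side, reflect, h]
  · have h2 := p.2.2.2
    simp [side, reflect, h]

theorem side_eq_false {p : Annulus} (h : (p.2 : ℝ) = 0) : side p = false := by
  simp [side, h]

theorem side_eq_true {p : Annulus} (h : (p.2 : ℝ) = 1) : side p = true := by
  simp [side, h]

end Annulus

end Annulus

end PartialSections

/-! ### From periodic maps of the strip to partial sections -/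

namespace PartialSections

/-- The strip `ℝ × [0, 1]`, the universal cover of the annulus. -/
def strip : Set (ℝ × ℝ) := {z | z.2 ∈ Icc (0 : ℝ) 1}

theorem uniqueDiffOn_strip : UniqueDiffOn ℝ strip := by
  have h : strip = univ ×ˢ Icc (0 : ℝ) 1 := by ext; simp [strip]
  rw [h]
  exact uniqueDiffOn_univ.prod (uniqueDiffOn_Icc zero_lt_one)

theorem field_congr {E : Type*} [NormedAddCommGroup E] [NormedSpace ℝ E]
    {H : Type*} [TopologicalSpace H] {I : ModelWithCorners ℝ E H} {M : Type*} [TopologicalSpace M]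
    [ChartedSpace H M] (X : ∀ x : M, TangentSpace I x) {x x' : M} (h : x = x') :
    @Eq E (X x) (X x') := by
  subst h; rfl

section Section

variable {M : Type*} [TopologicalSpace M] [ChartedSpace (EuclideanSpace ℝ (Fin 3)) M]
  {o : DiffForm (𝓡 3) M 3} {X : ∀ x : M, TangentSpace (𝓡 3) x} {g : ℝ × ℝ → M} {σ κ : ℝ}

/-- The lift `g` to the strip of a parametrization by the annulus of a partial section, which is
cooriented by `σ ds ∧ dr`, and whose sign is the one of `κ`. -/
structure IsSectionLift (o : DiffForm (𝓡 3) M 3) (X : ∀ x : M, TangentSpace (𝓡 3) x)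
    (g : ℝ × ℝ → M) (σ κ : ℝ) : Prop where
  ne_zero : σ ≠ 0
  smooth : ContMDiffOn 𝓘(ℝ, ℝ × ℝ) (𝓡 3) ∞ g strip
  periodic : ∀ s r, r ∈ Icc (0 : ℝ) 1 → g (s + 1, r) = g (s, r)
  immersion : ∀ z ∈ strip, Function.Injective (mfderivWithin 𝓘(ℝ, ℝ × ℝ) (𝓡 3) g strip z)
  injective : ∀ z ∈ strip, ∀ z' ∈ strip, g z = g z' → z.2 = z'.2 ∧ ∃ n : ℤ, z'.1 = z.1 + n
  transverse : ∀ z : ℝ × ℝ, z.2 ∈ Ioo (0 : ℝ) 1 → 0 < σ * o (g z) ![X (g z),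
    mfderivWithin 𝓘(ℝ, ℝ × ℝ) (𝓡 3) g strip z (1, 0),
    mfderivWithin 𝓘(ℝ, ℝ × ℝ) (𝓡 3) g strip z (0, 1)]
  lower : ∀ s : ℝ, ∃ c : ℝ, 0 < κ * (σ * c) ∧
    mfderivWithin 𝓘(ℝ, ℝ × ℝ) (𝓡 3) g strip (s, 0) (1, 0) = c • X (g (s, 0))
  upper : ∀ s : ℝ, ∃ c : ℝ, κ * (σ * c) < 0 ∧
    mfderivWithin 𝓘(ℝ, ℝ × ℝ) (𝓡 3) g strip (s, 1) (1, 0) = c • X (g (s, 1))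

open Annulus

/-- The map of the annulus that is induced by a periodic map of the strip. -/
noncomputable def annulusMap (g : ℝ × ℝ → M) (p : Annulus) : M := g (unrolled 0 p)

theorem unrolled_mem_strip (θ : ℝ) (p : Annulus) : unrolled θ p ∈ strip := p.2.2

theorem point_eq_of_unrolled {p q : Annulus} {n : ℤ} {θ θ' : ℝ}
    (h1 : (unrolled θ' q).1 = (unrolled θ p).1 + n) (h2 : (p.2 : ℝ) = q.2) : p = q := by
  refine Prod.ext ?_ (Subtype.ext h2)
  rw [← coe_angle θ p.1, ← coe_angle θ' q.1]
  have h3 : angle θ' q.1 = angle θ p.1 + n := h1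
  rw [h3, AddCircle.coe_add, show ((n : ℝ) : AddCircle (1 : ℝ)) = 0 from
    (AddCircle.coe_eq_zero_iff 1).2 ⟨n, zsmul_one n⟩, add_zero]

theorem boundary_eq {p : Annulus} (hp : p ∈ (𝓡∂ 2).boundary Annulus) :
    (p.2 : ℝ) = 0 ∨ (p.2 : ℝ) = 1 := by
  have h1 : p ∉ (𝓡∂ 2).interior Annulus := fun h =>
    ((𝓡∂ 2).isInteriorPoint_iff_not_isBoundaryPoint p).1 h hp
  rw [mem_interior_iff] at h1
  by_contra! h2
  exact h1 ⟨lt_of_le_of_ne p.2.2.1 h2.1.symm, lt_of_le_of_ne p.2.2.2 h2.2⟩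

namespace IsSectionLift

variable (h : IsSectionLift o X g σ κ)
include h

theorem periodic_int (s : ℝ) {r : ℝ} (hr : r ∈ Icc (0 : ℝ) 1) (n : ℤ) : g (s + n, r) = g (s, r) := by
  have h1 : Function.Periodic (fun s => g (s, r)) 1 := fun s => h.periodic s r hr
  simpa using h1.int_mul n s

/-- Angles with different cuts differ by integers, under which `g` is periodic. So the map, though
defined with a discontinuous angle, can be computed near each point with an angle that is smooth
there. -/
theorem annulusMap_eq (θ : ℝ) : annulusMap g = g ∘ unrolled θ := by
  funext p
  have h1 := (coe_angle θ p.1).trans (coe_angle 0 p.1).symm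
  rw [← sub_eq_zero, ← AddCircle.coe_sub, AddCircle.coe_eq_zero_iff] at h1
  obtain ⟨n, hn⟩ := h1
  rw [zsmul_one] at hn
  have h2 := h.periodic_int (angle 0 p.1) p.2.2 n
  rw [hn, add_sub_cancel] at h2
  exact h2.symm

theorem contMDiff_annulusMap : ContMDiff (𝓡∂ 2) (𝓡 3) ∞ (annulusMap g) := by
  intro p
  rw [h.annulusMap_eq (cut p)]
  exact ContMDiffWithinAt.comp p (f := unrolled (cut p)) (t := strip)
    (h.smooth _ (unrolled_mem_strip _ p))
    (contMDiffAt_unrolled (mem_chart_source _ p)).contMDiffWithinAt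
    (fun q _ => unrolled_mem_strip _ q)

theorem annulusMap_apply (p : Annulus) : annulusMap g p = g (unrolled (cut p) p) :=
  congrFun (h.annulusMap_eq (cut p)) p

theorem mfderiv_annulusMap (p : Annulus) (v : TangentSpace (𝓡∂ 2) p) :
    @Eq (EuclideanSpace ℝ (Fin 3)) (mfderiv (𝓡∂ 2) (𝓡 3) (annulusMap g) p v)
      (mfderivWithin 𝓘(ℝ, ℝ × ℝ) (𝓡 3) g strip (unrolled (cut p) p) (tangentCoord p v)) := by
  have h1 := HasMFDerivWithinAt.comp p (f := unrolled (cut p)) (u := strip) (s := univ)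
    ((h.smooth _ (unrolled_mem_strip (cut p) p)).mdifferentiableWithinAt (by simp)).hasMFDerivWithinAt
    (hasMFDerivAt_unrolled p).hasMFDerivWithinAt (fun q _ => unrolled_mem_strip _ q)
  rw [← h.annulusMap_eq] at h1
  exact DFunLike.congr_fun (hasMFDerivWithinAt_univ.1 h1).mfderiv v

theorem injective_annulusMap : Function.Injective (annulusMap g) := by
  intro p q hpq
  obtain ⟨h1, n, hn⟩ := h.injective _ (unrolled_mem_strip 0 p) _ (unrolled_mem_strip 0 q) hpq
  exact point_eq_of_unrolled hn h1

/-- The coorienting two-form in the coordinates of the annulus. -/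
theorem apply_frame (p : Annulus) (u v : TangentSpace (𝓡∂ 2) p) :
    o (annulusMap g p) ![X (annulusMap g p), mfderiv (𝓡∂ 2) (𝓡 3) (annulusMap g) p u,
        mfderiv (𝓡∂ 2) (𝓡 3) (annulusMap g) p v] =
      o (g (unrolled (cut p) p)) ![X (g (unrolled (cut p) p)),
        mfderivWithin 𝓘(ℝ, ℝ × ℝ) (𝓡 3) g strip (unrolled (cut p) p) (1, 0),
        mfderivWithin 𝓘(ℝ, ℝ × ℝ) (𝓡 3) g strip (unrolled (cut p) p) (0, 1)] *
      ((tangentCoord p u).1 * (tangentCoord p v).2 -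
        (tangentCoord p v).1 * (tangentCoord p u).2) := by
  set z := unrolled (cut p) p with hz
  let B : (ℝ × ℝ) [⋀^Fin 2]→L[ℝ] ℝ :=
    (pullbackWithin (interiorProd X o) g strip z)
  have h1 := B.apply_plane (fun i => tangentCoord p (![u, v] i))
  have h2 : (Module.Basis.finTwoProd ℝ).det (fun i => tangentCoord p (![u, v] i)) =
      (tangentCoord p u).1 * (tangentCoord p v).2 - (tangentCoord p v).1 * (tangentCoord p u).2 :=
    planeArea_apply _
  rw [h2] at h1
  refine Eq.trans ?_ (h1.trans (congrArg (· * _) ?_))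
  · refine (DiffForm.apply_congr o (h.annulusMap_apply p) _).trans
      (congrArg (o (g z)) (funext fun i => ?_))
    fin_cases i
    · exact field_congr X (h.annulusMap_apply p)
    · exact h.mfderiv_annulusMap p u
    · exact h.mfderiv_annulusMap p v
  · exact congrArg (o (g z)) (funext fun i => by fin_cases i <;> rfl)

theorem apply_frame_pos {p : Annulus} (hp : p ∈ (𝓡∂ 2).interior Annulus) :
    0 < σ * o (g (unrolled (cut p) p)) ![X (g (unrolled (cut p) p)),
      mfderivWithin 𝓘(ℝ, ℝ × ℝ) (𝓡 3) g strip (unrolled (cut p) p) (1, 0),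
      mfderivWithin 𝓘(ℝ, ℝ × ℝ) (𝓡 3) g strip (unrolled (cut p) p) (0, 1)] :=
  h.transverse (unrolled (cut p) p) ((mem_interior_iff p).1 hp)

theorem interior_transverse {p : Annulus} (hp : p ∈ (𝓡∂ 2).interior Annulus) :
    X (annulusMap g p) ∉ range (mfderiv (𝓡∂ 2) (𝓡 3) (annulusMap g) p) := by
  rintro ⟨v, hv⟩
  have hD := right_ne_zero_of_mul (h.apply_frame_pos hp).ne'
  -- The partner `w` is the rotation of `v` by a right angle. If `X` were the image of `v`, the
  -- frame would be degenerate, yet its area factor is the squared length of `v`; hence `v = 0` and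
  -- `X = 0`, against the transversality of `g`.
  obtain ⟨w, hw⟩ := (tangentCoord_bijective p).2 (-(tangentCoord p v).2, (tangentCoord p v).1)
  have h1 := h.apply_frame p v w
  have h2 : o (annulusMap g p) ![X (annulusMap g p), mfderiv (𝓡∂ 2) (𝓡 3) (annulusMap g) p v,
      mfderiv (𝓡∂ 2) (𝓡 3) (annulusMap g) p w] = 0 :=
    (o (annulusMap g p)).toAlternatingMap.map_eq_zero_of_eq _ (i := 0) (j := 1) hv.symm (by simp)
  have h3 := (mul_eq_zero.1 (h1.symm.trans h2)).resolve_left hD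
  rw [hw] at h3
  simp only at h3
  have h4 : tangentCoord p v = 0 := by
    ext
    · have := sq_nonneg (tangentCoord p v).2
      have := sq_nonneg (tangentCoord p v).1
      exact pow_eq_zero_iff two_ne_zero |>.1 (show (tangentCoord p v).1 ^ 2 = 0 by nlinarith)
    · have := sq_nonneg (tangentCoord p v).2
      have := sq_nonneg (tangentCoord p v).1
      exact pow_eq_zero_iff two_ne_zero |>.1 (show (tangentCoord p v).2 ^ 2 = 0 by nlinarith)
  have h5 : v = 0 := (tangentCoord_bijective p).1 (h4.trans (map_zero _).symm)
  rw [h5, map_zero] at hv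
  obtain ⟨e₁, he₁⟩ := (tangentCoord_bijective p).2 (1, 0)
  obtain ⟨e₂, he₂⟩ := (tangentCoord_bijective p).2 (0, 1)
  have h6 := h.apply_frame p e₁ e₂
  have h7 : o (annulusMap g p) ![X (annulusMap g p), mfderiv (𝓡∂ 2) (𝓡 3) (annulusMap g) p e₁,
      mfderiv (𝓡∂ 2) (𝓡 3) (annulusMap g) p e₂] = 0 :=
    (o (annulusMap g p)).toAlternatingMap.map_coord_zero 0 hv.symm
  rw [he₁, he₂] at h6
  exact hD (by simpa using h6.symm.trans h7)

/-- A boundary vector has no height component, so its image is a multiple of the image of the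
angular direction. The opposite signs required at the two circles are merged by the sign of the
reflection. -/
theorem boundary_tangent {p : Annulus} (hp : p ∈ (𝓡∂ 2).boundary Annulus)
    {τ : TangentSpace (𝓡∂ 2) p} (hτ : inwardCoord p τ = 0) :
    (tangentCoord p τ).2 = 0 ∧ ∃ c : ℝ, 0 < κ * (σ * (reflectSign (side p) * c)) ∧
      mfderiv (𝓡∂ 2) (𝓡 3) (annulusMap g) p τ =
        ((tangentCoord p τ).1 * c) • X (annulusMap g p) := by
  have h0 : (tangentCoord p τ).2 = 0 := by
    rw [inwardCoord_eq] at hτ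
    exact (mul_eq_zero.1 hτ).resolve_left
      (left_ne_zero_of_mul (by rw [reflectSign_mul_self]; exact one_ne_zero))
  have h1 : tangentCoord p τ = (tangentCoord p τ).1 • ((1, 0) : ℝ × ℝ) := by
    ext
    · simp
    · simp [h0]
  refine ⟨h0, ?_⟩
  have key : ∀ c : ℝ, mfderivWithin 𝓘(ℝ, ℝ × ℝ) (𝓡 3) g strip (unrolled (cut p) p) (1, 0) =
      c • X (g (unrolled (cut p) p)) → mfderiv (𝓡∂ 2) (𝓡 3) (annulusMap g) p τ =
        ((tangentCoord p τ).1 * c) • X (annulusMap g p) := fun c hc => by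
    refine (h.mfderiv_annulusMap p τ).trans ?_
    have h2 : ∀ t : ℝ, mfderivWithin 𝓘(ℝ, ℝ × ℝ) (𝓡 3) g strip (unrolled (cut p) p)
        (t • ((1, 0) : ℝ × ℝ)) = t •
        mfderivWithin 𝓘(ℝ, ℝ × ℝ) (𝓡 3) g strip (unrolled (cut p) p) (1, 0) := fun t =>
      (mfderivWithin 𝓘(ℝ, ℝ × ℝ) (𝓡 3) g strip (unrolled (cut p) p)).map_smul t _
    rw [h1, h2, hc, smul_smul]
    simp only [Prod.smul_mk, smul_eq_mul, mul_one]
    exact congrArg (((tangentCoord p τ).1 * c) • ·) (field_congr X (h.annulusMap_apply p).symm)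
  rcases boundary_eq hp with h2 | h2
  · have h3 : unrolled (cut p) p = (angle (cut p) p.1, 0) := Prod.ext rfl h2
    obtain ⟨c, hc, hc'⟩ := h.lower (angle (cut p) p.1)
    refine ⟨c, ?_, key c (h3 ▸ hc')⟩
    rw [side_eq_false h2]
    simpa [reflectSign] using hc
  · have h3 : unrolled (cut p) p = (angle (cut p) p.1, 1) := Prod.ext rfl h2
    obtain ⟨c, hc, hc'⟩ := h.upper (angle (cut p) p.1)
    refine ⟨c, ?_, key c (h3 ▸ hc')⟩
    rw [side_eq_true h2]
    simpa [reflectSign] using hc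

/-- The map is injective up to the boundary, so compactness of the annulus makes it an embedding as
a whole. -/
theorem isPartialSection [T2Space M] : IsPartialSection X (annulusMap g) where
  smooth := h.contMDiff_annulusMap
  immersion p u v huv := by
    refine (tangentCoord_bijective p).1 (h.immersion _ (unrolled_mem_strip (cut p) p) ?_)
    exact (h.mfderiv_annulusMap p u).symm.trans (huv.trans (h.mfderiv_annulusMap p v))
  interior_embedded :=
    (h.contMDiff_annulusMap.continuous.isClosedEmbedding
      h.injective_annulusMap).isEmbedding.comp Topology.IsEmbedding.subtypeVal
  interior_transverse _ hp := h.interior_transverse hp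
  boundary_tangent _ hp _ hτ :=
    let ⟨_, c, _, hc⟩ := h.boundary_tangent hp hτ
    ⟨_, hc⟩

theorem exists_boundary_sign {p : Annulus} (hp : p ∈ (𝓡∂ 2).boundary Annulus)
    {τ : TangentSpace (𝓡∂ 2) p} (hτ : IsBoundaryPositive (areaForm σ) p τ) :
    ∃ c : ℝ, 0 < κ * c ∧ mfderiv (𝓡∂ 2) (𝓡 3) (annulusMap g) p τ = c • X (annulusMap g p) := by
  obtain ⟨hτ, n, hn, hpos⟩ := hτ
  obtain ⟨h0, c, hc, hc'⟩ := h.boundary_tangent hp hτ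
  refine ⟨_, ?_, hc'⟩
  rw [areaForm_apply, h0, mul_zero, zero_sub] at hpos
  rw [inwardCoord_eq] at hn
  set ε := reflectSign (side p)
  set a := (tangentCoord p n).2
  set t := (tangentCoord p τ).1
  have hε : ε * ε = 1 := reflectSign_mul_self _
  -- The product of the sign condition on the circle, the positivity of the frame `(n, τ)` and the
  -- outwardness of `n` is a square times the sought sign.
  have h1 : 0 < (κ * (σ * (ε * c))) * (σ * -(t * a) * -(ε * a)) :=
    mul_pos hc (mul_pos hpos (neg_pos.2 hn))
  have h2 : (κ * (σ * (ε * c))) * (σ * -(t * a) * -(ε * a)) =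
      (σ * a) ^ 2 * (κ * (t * c)) := by linear_combination (κ * σ * c * σ * t * a * a) * hε
  rw [h2] at h1
  exact pos_of_mul_pos_right h1 (sq_nonneg _)

theorem isCoorientedBy : IsCoorientedBy o X (annulusMap g) (areaForm σ) := by
  refine ⟨isVolumeForm_areaForm h.ne_zero, fun p hp u v => ?_⟩
  have hpos := h.apply_frame_pos hp
  rw [areaForm_apply, h.apply_frame]
  set D := o (g (unrolled (cut p) p)) ![X (g (unrolled (cut p) p)),
        mfderivWithin 𝓘(ℝ, ℝ × ℝ) (𝓡 3) g strip (unrolled (cut p) p) (1, 0),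
        mfderivWithin 𝓘(ℝ, ℝ × ℝ) (𝓡 3) g strip (unrolled (cut p) p) (0, 1)]
  set t := (tangentCoord p u).1 * (tangentCoord p v).2 - (tangentCoord p v).1 * (tangentCoord p u).2
  constructor
  · intro ht
    by_contra! hD
    nlinarith [mul_pos hpos ht, mul_self_nonneg σ, mul_nonneg (mul_self_nonneg σ) (neg_nonneg.2 hD)]
  · intro ht
    by_contra! hD
    nlinarith [mul_pos hpos ht, mul_self_nonneg D, mul_nonneg (mul_self_nonneg D) (neg_nonneg.2 hD)]

end IsSectionLift

theorem IsSectionLift.admitsPositivePartialSection [T2Space M] (h : IsSectionLift o X g σ 1) :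
    AdmitsPositivePartialSection o X := by
  refine ⟨Annulus, inferInstance, inferInstance, inferInstance, inferInstance, inferInstance,
    inferInstance, annulusMap g, h.isPartialSection, areaForm σ, h.isCoorientedBy,
    fun p hp τ hτ => ?_⟩
  obtain ⟨c, hc, hc'⟩ := h.exists_boundary_sign hp hτ
  exact ⟨c, by linarith, hc'⟩

theorem IsSectionLift.admitsNegativePartialSection [T2Space M] (h : IsSectionLift o X g σ (-1)) :
    AdmitsNegativePartialSection o X := by
  refine ⟨Annulus, inferInstance, inferInstance, inferInstance, inferInstance, inferInstance,
    inferInstance, annulusMap g, h.isPartialSection, areaForm σ, h.isCoorientedBy,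
    fun p hp τ hτ => ?_⟩
  obtain ⟨c, hc, hc'⟩ := h.exists_boundary_sign hp hτ
  exact ⟨c, by linarith, hc'⟩

end Section

end PartialSections

/-! ### Straight bands in the coordinates `(F, G, r)` -/

open PartialSections

namespace IsCoordinateFamily

variable {P Q F G : ℝ × ℝ × ℝ → ℝ} {A B c d : ℝ → ℝ}

theorem coordMap_add_int (h : IsCoordinateFamily P Q F G A B c d) {x y r : ℝ}
    (hr : r ∈ Icc (0 : ℝ) 1) (m n : ℤ) : coordMap F G (x + m, y + n, r) =
      coordMap F G (x, y, r) + (A r * m + B r * n, c r * m + d r * n, 0) := by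
  have h1 := (h.potential.regular r hr).quasi.int (x, y) m n
  have h2 := (h.quasi r hr).int (x, y) m n
  simp only [Function.comp_apply, atHeight, Prod.mk_add_mk] at h1 h2
  simp only [coordMap, Prod.mk_add_mk, add_zero, h1, h2]

/-- The map from the strip to the slab with straight image in the given coordinates, whose
horizontal lines have the period `(p, q)`, over the heights between `a` and `b`. -/
noncomputable def straight (F G : ℝ × ℝ × ℝ → ℝ) (p q : ℤ) (a b : ℝ) (z : ℝ × ℝ) : ℝ × ℝ × ℝ :=
  z.1 • (coordMap F G (p, q, a + (b - a) * z.2) - coordMap F G (0, 0, a + (b - a) * z.2)) +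
    (0, 0, a + (b - a) * z.2)

variable {p q : ℤ} {a b : ℝ}

theorem height_mem (ha : 0 ≤ a) (hab : a < b) (hb : b ≤ 1) {t : ℝ} (ht : t ∈ Icc (0 : ℝ) 1) :
    a + (b - a) * t ∈ Icc (0 : ℝ) 1 :=
  ⟨by nlinarith [ht.1], by nlinarith [ht.2]⟩

theorem straight_eq (h : IsCoordinateFamily P Q F G A B c d) {s t : ℝ}
    (hr : a + (b - a) * t ∈ Icc (0 : ℝ) 1) : straight F G p q a b (s, t) =
      (s * (A (a + (b - a) * t) * p + B (a + (b - a) * t) * q),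
        s * (c (a + (b - a) * t) * p + d (a + (b - a) * t) * q), a + (b - a) * t) := by
  have h1 := h.coordMap_add_int (x := 0) (y := 0) hr p q
  rw [zero_add, zero_add] at h1
  rw [straight, h1]
  simp

theorem straight_snd_snd (z : ℝ × ℝ) : (straight F G p q a b z).2.2 = a + (b - a) * z.2 := by
  simp [straight, coordMap]

/-- The periods enter `straight` as differences of coordinates of points over `(p, q)` and `(0, 0)`;
this makes smoothness in the height visible without discussing the period functions. -/
theorem contDiffOn_straight (h : IsCoordinateFamily P Q F G A B c d) (ha : 0 ≤ a) (hab : a < b)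
    (hb : b ≤ 1) : ContDiffOn ℝ ∞ (straight F G p q a b) strip := by
  have h1 : ∀ x y : ℝ, ContDiffOn ℝ ∞
      (fun z : ℝ × ℝ => coordMap F G (x, y, a + (b - a) * z.2)) strip := fun x y =>
    h.contDiffOn_coordMap.comp (by fun_prop) fun z hz => height_mem ha hab hb hz
  unfold straight
  exact (contDiff_fst.contDiffOn.smul ((h1 p q).sub (h1 0 0))).add (by fun_prop)

theorem fderivWithin_straight (h : IsCoordinateFamily P Q F G A B c d) (ha : 0 ≤ a) (hab : a < b)
    (hb : b ≤ 1) {s t : ℝ} (ht : t ∈ Icc (0 : ℝ) 1) :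
    fderivWithin ℝ (straight F G p q a b) strip (s, t) (1, 0) =
      (A (a + (b - a) * t) * p + B (a + (b - a) * t) * q,
        c (a + (b - a) * t) * p + d (a + (b - a) * t) * q, 0) ∧
    (fderivWithin ℝ (straight F G p q a b) strip (s, t) (0, 1)).2.2 = b - a := by
  have hz : (s, t) ∈ strip := ht
  have hd := ((h.contDiffOn_straight (p := p) (q := q) ha hab hb).differentiableOn (by simp)
    _ hz).hasFDerivWithinAt
  constructor
  · have h1 : HasDerivAt (fun s : ℝ => (s, t)) (1, 0) s := (hasDerivAt_id s).prodMk (hasDerivAt_const s t)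
    have h2 := hd.comp_hasDerivWithinAt s (h1.hasDerivWithinAt (s := univ)) fun _ _ => ht
    rw [hasDerivWithinAt_univ] at h2
    have h3 : straight F G p q a b ∘ (fun s : ℝ => (s, t)) = fun s =>
        (s * (A (a + (b - a) * t) * p + B (a + (b - a) * t) * q),
          s * (c (a + (b - a) * t) * p + d (a + (b - a) * t) * q), a + (b - a) * t) :=
      funext fun s => h.straight_eq (height_mem ha hab hb ht)
    rw [h3] at h2
    refine h2.unique ?_
    have h4 : ∀ x : ℝ, HasDerivAt (fun s : ℝ => s * x) x s := fun x => by
      simpa using (hasDerivAt_id s).mul_const x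
    exact (h4 _).prodMk ((h4 _).prodMk (hasDerivAt_const s _))
  · let φ : ℝ × ℝ × ℝ →L[ℝ] ℝ :=
      (ContinuousLinearMap.snd ℝ ℝ ℝ).comp (ContinuousLinearMap.snd ℝ ℝ (ℝ × ℝ))
    have h1 := φ.hasFDerivAt.comp_hasFDerivWithinAt (s, t) hd
    have h2 : φ ∘ straight F G p q a b = fun z => a + (b - a) * z.2 := funext straight_snd_snd
    rw [h2] at h1
    have h3 : HasFDerivWithinAt (fun z : ℝ × ℝ => a + (b - a) * z.2)
        ((b - a) • ContinuousLinearMap.snd ℝ ℝ ℝ) strip (s, t) :=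
      ((hasFDerivAt_snd.const_mul (b - a)).const_add a).hasFDerivWithinAt
    have h4 := (uniqueDiffOn_strip _ hz).eq h1 h3
    have h5 := DFunLike.congr_fun h4 (0, 1)
    exact h5.trans (by simp)

/-- A band that lies over the heights between `a` and `b`. -/
structure IsBand (F G : ℝ × ℝ × ℝ → ℝ) (p q : ℤ) (a b : ℝ) (w k : ℝ → ℝ)
    (γ : ℝ × ℝ → ℝ × ℝ × ℝ) : Prop where
  smooth : ContDiffOn ℝ ∞ γ strip
  coord : ∀ s, ∀ t ∈ Icc (0 : ℝ) 1, coordMap F G (γ (s, t)) =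
    (s * w (a + (b - a) * t), s * k (a + (b - a) * t), a + (b - a) * t)
  period : ∀ s, ∀ t ∈ Icc (0 : ℝ) 1, γ (s + 1, t) = γ (s, t) + ((p : ℝ), (q : ℝ), 0)
  deriv_fst : ∀ s, ∀ t ∈ Icc (0 : ℝ) 1, fderivWithin ℝ (coordMap F G) slab (γ (s, t))
    (fderivWithin ℝ γ strip (s, t) (1, 0)) = (w (a + (b - a) * t), k (a + (b - a) * t), 0)
  deriv_snd : ∀ s, ∀ t ∈ Icc (0 : ℝ) 1, (fderivWithin ℝ γ strip (s, t) (0, 1)).2.2 = b - a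

theorem IsBand.mapsTo {w k : ℝ → ℝ} {γ : ℝ × ℝ → ℝ × ℝ × ℝ} (hγ : IsBand F G p q a b w k γ)
    (ha : 0 ≤ a) (hab : a < b) (hb : b ≤ 1) : MapsTo γ strip slab := fun z hz => by
  have h1 : (γ z).2.2 = a + (b - a) * z.2 := congrArg (fun x => x.2.2) (hγ.coord z.1 z.2 hz)
  rw [slab, mem_ofPred_eq, h1]
  exact height_mem ha hab hb hz

/-- The period lattice is nondegenerate at each height, so the translation by the nonzero vector
`(p, q)` moves the coordinates. This keeps the horizontal velocity of the band away from zero. -/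
theorem period_ne_zero (h : IsCoordinateFamily P Q F G A B c d) (hpq : IsCoprime p q) {r : ℝ}
    (hr : r ∈ Icc (0 : ℝ) 1) (h1 : A r * p + B r * q = 0) (h2 : c r * p + d r * q = 0) : False := by
  have hD := (h.det_pos hr).ne'
  have hp : (p : ℝ) * (B r * c r - A r * d r) = 0 := by linear_combination B r * h2 - d r * h1
  have hq : (q : ℝ) * (B r * c r - A r * d r) = 0 := by linear_combination c r * h1 - A r * h2
  have hp0 : p = 0 := by exact_mod_cast (mul_eq_zero.1 hp).resolve_right hD
  have hq0 : q = 0 := by exact_mod_cast (mul_eq_zero.1 hq).resolve_right hD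
  obtain ⟨u, v, huv⟩ := hpq
  simp [hp0, hq0] at huv

/-- Translations that preserve a line of slope `(p, q)` are multiples of `(p, q)`. -/
theorem exists_int_of_period (h : IsCoordinateFamily P Q F G A B c d) (hpq : IsCoprime p q) {r δ : ℝ}
    (hr : r ∈ Icc (0 : ℝ) 1) {m n : ℤ} (h1 : δ * (A r * p + B r * q) = A r * m + B r * n)
    (h2 : δ * (c r * p + d r * q) = c r * m + d r * n) : ∃ k : ℤ, δ = k := by
  have hD := (h.det_pos hr).ne'
  have hp : (δ * p - m) * (B r * c r - A r * d r) = 0 := by linear_combination B r * h2 - d r * h1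
  have hq : (δ * q - n) * (B r * c r - A r * d r) = 0 := by linear_combination c r * h1 - A r * h2
  have hp0 := (mul_eq_zero.1 hp).resolve_right hD
  have hq0 := (mul_eq_zero.1 hq).resolve_right hD
  obtain ⟨u, v, huv⟩ := hpq
  have huv' : (u : ℝ) * p + v * q = 1 := by exact_mod_cast huv
  -- By nondegeneracy `(m, n) = δ (p, q)`; a Bézout relation for `p` and `q` recovers `δ` as an
  -- integer combination.
  refine ⟨u * m + v * n, ?_⟩
  push_cast
  linear_combination u * hp0 + v * hq0 - δ * huv'

/-- The straight map is carried back by the smooth inverse of the coordinates. Advancing `s` by 1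
adds the gains of `(p, q)` to the coordinates, which by injectivity is the translation by `(p, q)`.
-/
theorem exists_isBand (h : IsCoordinateFamily P Q F G A B c d) (p q : ℤ) (ha : 0 ≤ a) (hab : a < b)
    (hb : b ≤ 1) : ∃ γ, IsBand F G p q a b (fun r => A r * p + B r * q)
      (fun r => c r * p + d r * q) γ := by
  obtain ⟨Γ, hΓ, hm, hr, hl⟩ := h.exists_inverse
  have hW := h.contDiffOn_straight (p := p) (q := q) ha hab hb
  have hWm : MapsTo (straight F G p q a b) strip slab := fun z hz => by
    rw [slab, mem_ofPred_eq, straight_snd_snd]; exact height_mem ha hab hb hz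
  have hγ : ContDiffOn ℝ ∞ (Γ ∘ straight F G p q a b) strip := hΓ.comp hW hWm
  have hcomp : ∀ z ∈ strip, coordMap F G ((Γ ∘ straight F G p q a b) z) = straight F G p q a b z :=
    fun z hz => hr _ (hWm hz)
  have hd : ∀ s, ∀ t ∈ Icc (0 : ℝ) 1, ∀ v,
      fderivWithin ℝ (coordMap F G) slab ((Γ ∘ straight F G p q a b) (s, t))
        (fderivWithin ℝ (Γ ∘ straight F G p q a b) strip (s, t) v) =
      fderivWithin ℝ (straight F G p q a b) strip (s, t) v := fun s t ht v => by
    have h1 := (h.contDiffOn_coordMap.differentiableOn (by simp) _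
      (hm (hWm (show (s, t) ∈ strip from ht)))).hasFDerivWithinAt.comp (s, t)
      ((hγ.differentiableOn (by simp) (s, t) ht).hasFDerivWithinAt) fun z hz => hm (hWm hz)
    have h2 := (h1.congr (fun z hz => (hcomp z hz).symm) (hcomp _ ht).symm).fderivWithin
      (uniqueDiffOn_strip (s, t) ht)
    exact (DFunLike.congr_fun h2 v).symm
  refine ⟨Γ ∘ straight F G p q a b, hγ, fun s t ht => ?_, fun s t ht => ?_, fun s t ht => ?_,
    fun s t ht => ?_⟩
  · rw [hcomp _ ht]; exact h.straight_eq (height_mem ha hab hb ht)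
  · have hz : (s, t) ∈ strip := ht
    have hz' : (s + 1, t) ∈ strip := ht
    have hq := hm (hWm hz)
    refine h.injOn (hm (hWm hz')) ?_ ?_
    · simpa [slab] using hq
    · have h1 := hcomp _ hz
      have h2 := hcomp _ hz'
      simp only [Function.comp_apply] at h1 h2 ⊢
      set u := Γ (straight F G p q a b (s, t)) with hu
      have h3 : u.2.2 = a + (b - a) * t := by
        have := congrArg (fun x => x.2.2) h1
        simpa [coordMap, straight_snd_snd] using this
      have h4 := h.coordMap_add_int (x := u.1) (y := u.2.1) (r := u.2.2) hq p q
      have h5 : u + ((p : ℝ), (q : ℝ), 0) = (u.1 + p, u.2.1 + q, u.2.2) := by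
        ext <;> simp
      rw [h5, h4, h2, show (u.1, u.2.1, u.2.2) = u from rfl, h1,
        h.straight_eq (height_mem ha hab hb ht), h.straight_eq (height_mem ha hab hb ht), h3]
      ext <;> simp <;> ring
  · rw [hd s t ht]; exact (h.fderivWithin_straight ha hab hb ht).1
  · have h1 := hd s t ht (0, 1)
    have hz : (Γ ∘ straight F G p q a b) (s, t) ∈ slab := hm (hWm (show (s, t) ∈ strip from ht))
    rw [h.fderiv_coord hz] at h1
    rw [← (h.fderivWithin_straight (s := s) (p := p) (q := q) ha hab hb ht).2, ← h1]

end IsCoordinateFamily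

theorem exists_sign_of_ne_zero {V : Type*} [TopologicalSpace V] {s : Set V} (hs : IsPreconnected s)
    {f : V → ℝ} (hf : ContinuousOn f s) (h0 : ∀ q ∈ s, f q ≠ 0) :
    ∃ ε : ℝ, ε * ε = 1 ∧ ∀ q ∈ s, 0 < ε * f q := by
  by_cases h : ∃ q ∈ s, 0 < f q
  · obtain ⟨q, hq, hpos⟩ := h
    refine ⟨1, by norm_num, fun x hx => ?_⟩
    by_contra! hneg
    obtain ⟨y, hy, hy0⟩ := hs.intermediate_value hx hq hf ⟨by linarith, hpos.le⟩
    exact h0 y hy hy0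
  · push Not at h
    exact ⟨-1, by norm_num, fun q hq => by
      have := lt_of_le_of_ne (h q hq) (h0 q hq); linarith⟩

/-! ### The annulus inside a twisting region -/

namespace PartialSections

section Region

variable {M : Type*} [TopologicalSpace M] [ChartedSpace (EuclideanSpace ℝ (Fin 3)) M]
  {o μ : DiffForm (𝓡 3) M 3} {X : ∀ x : M, TangentSpace (𝓡 3) x} {Φ : ℝ × ℝ × ℝ → M}
  {F G : ℝ × ℝ × ℝ → ℝ} {A B c d : ℝ → ℝ} {p q : ℤ} {a b ν : ℝ} {γ : ℝ × ℝ → ℝ × ℝ × ℝ}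

open IsCoordinateFamily

theorem IsIntegrableRegion.push_eq_zero (h : IsIntegrableRegion o X Φ) {x v : ℝ × ℝ × ℝ}
    (hx : x ∈ slab) (hv : push Φ x v = 0) : v = 0 := by
  have ho := (h.volumeDensity_pos hx).ne'
  have key : ∀ u w : ℝ × ℝ × ℝ, u.1 * (v.2.1 * w.2.2 - v.2.2 * w.2.1) -
      u.2.1 * (v.1 * w.2.2 - v.2.2 * w.1) + u.2.2 * (v.1 * w.2.1 - v.2.1 * w.1) = 0 := by
    intro u w
    have h1 := apply_push o Φ x u v w
    have h2 : o (Φ x) ![push Φ x u, push Φ x v, push Φ x w] = 0 :=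
      (o (Φ x)).toAlternatingMap.map_coord_zero 1 hv
    exact (mul_eq_zero.1 (h1.symm.trans h2)).resolve_left ho
  have k1 := key (0, 1, 0) (0, 0, 1)
  have k2 := key (1, 0, 0) (0, 0, 1)
  have k3 := key (1, 0, 0) (0, 1, 0)
  ext
  · simpa using k1
  · simpa using k2
  · simpa using k3

theorem push_comp_band (hΦ : ContMDiffOn 𝓘(ℝ, ℝ × ℝ × ℝ) (𝓡 3) ∞ Φ slab)
    (hγ : ContDiffOn ℝ ∞ γ strip) (hm : MapsTo γ strip slab) {z : ℝ × ℝ} (hz : z ∈ strip)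
    (v : ℝ × ℝ) : mfderivWithin 𝓘(ℝ, ℝ × ℝ) (𝓡 3) (Φ ∘ γ) strip z v =
      push Φ (γ z) (fderivWithin ℝ γ strip z v) := by
  have h1 := HasMFDerivWithinAt.comp z (f := γ) (u := slab) (s := strip)
    ((hΦ _ (hm hz)).mdifferentiableWithinAt (by simp)).hasMFDerivWithinAt
    ((hγ.differentiableOn (by simp) z hz).hasFDerivWithinAt.hasMFDerivWithinAt) hm
  exact DFunLike.congr_fun (h1.mfderivWithin (uniqueDiffOn_strip z hz).uniqueMDiffWithinAt) v

variable [IsManifold (𝓡 3) ∞ M]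

/-- The oriented volume spanned by `X` and the two derivatives of the band is a nonzero factor times
`A p + B q`, whose sign is that of `-ν` inside. At the ends this pairing vanishes, so the horizontal
velocity is a multiple of `X`, and the sign of the gain `c p + d q` of `G` decides in which sense.
-/
theorem IsIntegrableRegion.exists_isSectionLift (h : IsIntegrableRegion o X Φ)
    (hμ : IsVolumeForm μ)
    (K : IsCoordinateFamily (fluxDensity μ X Φ (1, 0, 0)) (fluxDensity μ X Φ (0, 1, 0)) F G A B c d)
    (ha : 0 ≤ a) (hab : a < b) (hb : b ≤ 1) (hpq : IsCoprime p q) (hν : ν * ν = 1)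
    (hw : ∀ r ∈ Ioo a b, ν * (A r * p + B r * q) < 0)
    (hwa : A a * p + B a * q = 0) (hwb : A b * p + B b * q = 0)
    (hka : c a * p + d a * q < 0) (hkb : 0 < c b * p + d b * q) :
    ∃ (g : ℝ × ℝ → M) (σ : ℝ), IsSectionLift o X g σ ν := by
  obtain ⟨γ, hγ⟩ := K.exists_isBand p q ha hab hb
  obtain ⟨ε, hε, hεm⟩ := exists_sign_of_ne_zero convex_slab.isPreconnected
    (h.continuousOn_volumeDensity hμ) fun x hx => h.volumeDensity_ne_zero hμ hx
  have hm := hγ.mapsTo ha hab hb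
  have hmem : ∀ s, ∀ t ∈ Icc (0 : ℝ) 1, γ (s, t) ∈ slab := fun s t ht => hm (show (s, t) ∈ strip from ht)
  have hd : ∀ s, ∀ t ∈ Icc (0 : ℝ) 1, ∀ v, mfderivWithin 𝓘(ℝ, ℝ × ℝ) (𝓡 3) (Φ ∘ γ) strip (s, t) v =
      push Φ (γ (s, t)) (fderivWithin ℝ γ strip (s, t) v) := fun s t ht v =>
    push_comp_band h.smooth hγ.smooth hm ht v
  have hν0 : ν ≠ 0 := left_ne_zero_of_mul (by rw [hν]; exact one_ne_zero)
  have hε0 : ε ≠ 0 := left_ne_zero_of_mul (by rw [hε]; exact one_ne_zero)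
  -- The derivative along the horizontal lines.
  have hT : ∀ s, ∀ t ∈ Icc (0 : ℝ) 1, ∃ v : ℝ × ℝ,
      fderivWithin ℝ γ strip (s, t) (1, 0) = horizontal v ∧
      v.1 * fluxDensity μ X Φ (1, 0, 0) (γ (s, t)) + v.2 * fluxDensity μ X Φ (0, 1, 0) (γ (s, t)) =
        A (a + (b - a) * t) * p + B (a + (b - a) * t) * q ∧
      fderivWithin ℝ G slab (γ (s, t)) (horizontal v) =
        c (a + (b - a) * t) * p + d (a + (b - a) * t) * q := fun s t ht => by
    have h1 := hγ.deriv_fst s t ht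
    rw [K.fderiv_coord (hmem s t ht), Prod.mk.injEq, Prod.mk.injEq] at h1
    set T := fderivWithin ℝ γ strip (s, t) (1, 0)
    have h2 : T = horizontal (T.1, T.2.1) := by
      rw [horizontal_apply]
      ext
      · rfl
      · rfl
      · exact h1.2.2
    refine ⟨(T.1, T.2.1), h2, ?_, ?_⟩
    · rw [← K.fderivWithin_fst (hmem s t ht), ← h2, h1.1]
    · rw [← h2, h1.2.1]
  have hbd : ∀ s, ∀ t ∈ Icc (0 : ℝ) 1,
      A (a + (b - a) * t) * p + B (a + (b - a) * t) * q = 0 →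
      ∃ e f : ℝ, 0 < f ∧ c (a + (b - a) * t) * p + d (a + (b - a) * t) * q = e * f ∧
        mfderivWithin 𝓘(ℝ, ℝ × ℝ) (𝓡 3) (Φ ∘ γ) strip (s, t) (1, 0) =
          (e * volumeDensity μ Φ (γ (s, t))) • X ((Φ ∘ γ) (s, t)) := fun s t ht h0 => by
    obtain ⟨v, hv1, hv2, hv3⟩ := hT s t ht
    rw [h0] at hv2
    have hpos := K.fderivWithin_snd (hmem s t ht)
    have hne := K.closed.ne_zero _ (hmem s t ht)
    set P := fluxDensity μ X Φ (1, 0, 0) (γ (s, t))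
    set Q := fluxDensity μ X Φ (0, 1, 0) (γ (s, t))
    have hPQ : 0 < P ^ 2 + Q ^ 2 := by
      rcases hne with h1 | h1
      · have := sq_nonneg Q; positivity
      · have := sq_nonneg P; positivity
    -- A vector annihilated by the nonzero covector `(P, Q)` is a multiple of `(Q, -P)`, which is
    -- `X` up to the volume density; its factor `e` has the sign of the derivative of `G` along the
    -- velocity.
    have hv : v = ((v.1 * Q - v.2 * P) / (P ^ 2 + Q ^ 2)) • (Q, -P) := by
      ext
      · simp only [Prod.smul_mk, smul_eq_mul]
        field_simp
        linear_combination P * hv2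
      · simp only [Prod.smul_mk, smul_eq_mul]
        field_simp
        linear_combination Q * hv2
    set e := (v.1 * Q - v.2 * P) / (P ^ 2 + Q ^ 2)
    refine ⟨e, _, hpos, ?_, ?_⟩
    · rw [← hv3, hv, map_smul, map_smul, smul_eq_mul]
    · refine (hd s t ht (1, 0)).trans ?_
      rw [hv1, hv, map_smul, push_smul]
      have h1 : X ((Φ ∘ γ) (s, t)) = _ := h.field_eq hμ (hmem s t ht)
      rw [h1, smul_smul, mul_assoc, mul_inv_cancel₀ (h.volumeDensity_ne_zero hμ (hmem s t ht)),
        mul_one]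
      rfl
  -- The sign `ε` of `μ` relative to the coordinates enters because `X` is the Hamiltonian field
  -- divided by the density of `μ`, and `-ν` is the sign of the pairing inside.
  refine ⟨Φ ∘ γ, -(ν * ε), neg_ne_zero.2 (mul_ne_zero hν0 hε0), ?_, ?_, ?_, ?_, ?_, ?_, ?_⟩
  · exact h.smooth.comp hγ.smooth.contMDiffOn hm
  · intro s t ht
    have h1 : Function.Periodic (fun z : ℝ × ℝ => Φ (z.1, z.2, (γ (s, t)).2.2)) (1, 0) := fun z =>
      by simpa using (h.periodic z.1 z.2 _ (hmem s t ht)).1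
    have h2 : Function.Periodic (fun z : ℝ × ℝ => Φ (z.1, z.2, (γ (s, t)).2.2)) (0, 1) := fun z =>
      by simpa using (h.periodic z.1 z.2 _ (hmem s t ht)).2
    have h3 := IsDoublyPeriodic.int ⟨h1, h2⟩ ((γ (s, t)).1, (γ (s, t)).2.1) p q
    have h4 : γ (s, t) + ((p : ℝ), (q : ℝ), 0) =
        ((γ (s, t)).1 + p, (γ (s, t)).2.1 + q, (γ (s, t)).2.2) := by ext <;> simp
    simp only [Function.comp_apply, hγ.period s t ht, h4]
    exact h3
  · rintro ⟨s, t⟩ ht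
    rw [injective_iff_map_eq_zero]
    intro v hv
    have h1 := h.push_eq_zero (hmem s t ht) ((hd s t ht v).symm.trans hv)
    have hL : ∀ v : ℝ × ℝ, fderivWithin ℝ γ strip (s, t) v =
        v.1 • fderivWithin ℝ γ strip (s, t) (1, 0) +
          v.2 • fderivWithin ℝ γ strip (s, t) (0, 1) := fun v => by
      rw [← map_smul, ← map_smul, ← map_add]; simp
    replace hL := h1.symm.trans (hL v)
    obtain ⟨u, hu, hu1, hu2⟩ := hT s t ht
    rw [hu, horizontal_apply] at hL
    have hv2 : v.2 = 0 := by
      have h3 := congrArg (fun x => x.2.2) hL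
      simp only [Prod.snd_add, Prod.smul_snd, hγ.deriv_snd s t ht, smul_eq_mul, mul_zero,
        zero_add, Prod.snd_zero] at h3
      exact (mul_eq_zero.1 h3.symm).resolve_right (sub_ne_zero.2 hab.ne')
    by_contra hv0
    have hv1 : v.1 ≠ 0 := fun hv1 => hv0 (Prod.ext hv1 hv2)
    rw [hv2, zero_smul, add_zero, ← horizontal_apply u] at hL
    have hu0 : horizontal u = 0 := (smul_eq_zero.1 hL.symm).resolve_left hv1
    have e1 : u.1 = 0 := congrArg (fun x => x.1) hu0
    have e2 : u.2 = 0 := congrArg (fun x => x.2.1) hu0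
    rw [hu0, map_zero] at hu2
    rw [e1, e2, zero_mul, zero_mul, add_zero] at hu1
    exact K.period_ne_zero hpq (height_mem ha hab hb ht) hu1.symm hu2.symm
  · rintro ⟨s, t⟩ ht ⟨s', t'⟩ ht' heq
    have h1 := hγ.coord s t ht
    have h2 := hγ.coord s' t' ht'
    obtain ⟨h3, m, n, hm', hn'⟩ := h.injective (γ (s, t)).1 (γ (s, t)).2.1 (γ (s, t)).2.2
      (γ (s', t')).1 (γ (s', t')).2.1 (γ (s', t')).2.2 (hmem s t ht) (hmem s' t' ht') heq
    have e1 : (γ (s, t)).2.2 = a + (b - a) * t := congrArg (fun x => x.2.2) h1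
    have e2 : (γ (s', t')).2.2 = a + (b - a) * t' := congrArg (fun x => x.2.2) h2
    have htt : t = t' := by
      rw [e1, e2] at h3
      exact mul_left_cancel₀ (sub_ne_zero.2 hab.ne') (add_left_cancel h3)
    subst htt
    refine ⟨rfl, ?_⟩
    have h4 := K.coordMap_add_int (x := (γ (s, t)).1) (y := (γ (s, t)).2.1) (hmem s t ht) m n
    rw [← hm', ← hn', e1, ← e2, show ((γ (s', t)).1, (γ (s', t)).2.1, (γ (s', t)).2.2) = γ (s', t)
      from rfl, h2, e2, ← e1, show ((γ (s, t)).1, (γ (s, t)).2.1, (γ (s, t)).2.2) = γ (s, t)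
      from rfl, h1, e1, Prod.mk_add_mk, Prod.mk_add_mk, Prod.mk.injEq, Prod.mk.injEq] at h4
    -- Two points of the band with the same image differ by a lattice vector, while lying on one
    -- straight line through the origin at the same height; as `(p, q)` is primitive, their
    -- parameters differ by an integer.
    obtain ⟨k, hk⟩ := K.exists_int_of_period hpq (height_mem ha hab hb ht) (δ := s' - s) (m := m)
      (n := n) (by linear_combination h4.1) (by linear_combination h4.2.1)
    exact ⟨k, by linarith⟩
  · rintro ⟨s, t⟩ ht
    have ht' : t ∈ Icc (0 : ℝ) 1 := Ioo_subset_Icc_self ht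
    have hr : a + (b - a) * t ∈ Ioo a b := by
      have := sub_pos.2 hab
      exact ⟨by nlinarith [ht.1], by nlinarith [ht.2]⟩
    obtain ⟨v, hv1, hv2, -⟩ := hT s t ht'
    have hX : X ((Φ ∘ γ) (s, t)) = _ := h.field_eq hμ (hmem s t ht')
    rw [← push_smul] at hX
    have hs := hγ.deriv_snd s t ht'
    have h1 := apply_push o Φ (γ (s, t)) ((volumeDensity μ Φ (γ (s, t)))⁻¹ •
      (fluxDensity μ X Φ (0, 1, 0) (γ (s, t)), -fluxDensity μ X Φ (1, 0, 0) (γ (s, t)), 0))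
      (horizontal v) (fderivWithin ℝ γ strip (s, t) (0, 1))
    have h2 : o ((Φ ∘ γ) (s, t)) ![X ((Φ ∘ γ) (s, t)),
        mfderivWithin 𝓘(ℝ, ℝ × ℝ) (𝓡 3) (Φ ∘ γ) strip (s, t) (1, 0),
        mfderivWithin 𝓘(ℝ, ℝ × ℝ) (𝓡 3) (Φ ∘ γ) strip (s, t) (0, 1)] = _ :=
      (congrArg (o (Φ (γ (s, t)))) (funext fun i => by
        fin_cases i
        · exact hX
        · exact (hd s t ht' (1, 0)).trans (congrArg (push Φ (γ (s, t))) hv1)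
        · exact hd s t ht' (0, 1))).trans h1
    refine lt_of_lt_of_eq ?_ (congrArg (-(ν * ε) * ·) h2).symm
    simp only [hs, horizontal_apply, Prod.smul_mk, smul_eq_mul]
    have ho := h.volumeDensity_pos (hmem s t ht')
    have hmp := hεm _ (hmem s t ht')
    have hm0 := h.volumeDensity_ne_zero hμ (hmem s t ht')
    have hwr := hw _ hr
    rw [← hv2] at hwr
    have hp : 0 < volumeDensity o Φ (γ (s, t)) * (b - a) *
        (ε * volumeDensity μ Φ (γ (s, t)) * ((volumeDensity μ Φ (γ (s, t)))⁻¹) ^ 2) *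
        -(ν * (v.1 * fluxDensity μ X Φ (1, 0, 0) (γ (s, t)) +
          v.2 * fluxDensity μ X Φ (0, 1, 0) (γ (s, t)))) :=
      mul_pos (mul_pos (mul_pos ho (sub_pos.2 hab))
        (mul_pos hmp (by have := inv_ne_zero hm0; positivity))) (neg_pos.2 hwr)
    refine lt_of_lt_of_eq hp ?_
    field_simp
    ring
  · intro s
    have hz : (0 : ℝ) ∈ Icc (0 : ℝ) 1 := ⟨le_rfl, zero_le_one⟩
    obtain ⟨e, f, hf, hef, he⟩ := hbd s 0 hz (by simpa using hwa)
    refine ⟨_, ?_, he⟩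
    rw [mul_zero, add_zero] at hef
    rw [hef] at hka
    have hmp := hεm _ (hmem s 0 hz)
    have h1 : e < 0 := by
      by_contra! h2
      exact absurd hka (not_lt.2 (mul_nonneg h2 hf.le))
    have h2 : ν * (-(ν * ε) * (e * volumeDensity μ Φ (γ (s, 0)))) =
        -e * (ε * volumeDensity μ Φ (γ (s, 0))) := by
      linear_combination (-(ε * e * volumeDensity μ Φ (γ (s, 0)))) * hν
    rw [h2]
    exact mul_pos (neg_pos.2 h1) hmp
  · intro s
    have hz : (1 : ℝ) ∈ Icc (0 : ℝ) 1 := ⟨zero_le_one, le_rfl⟩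
    have hab1 : a + (b - a) * 1 = b := by ring
    obtain ⟨e, f, hf, hef, he⟩ := hbd s 1 hz (by rw [hab1]; exact hwb)
    refine ⟨_, ?_, he⟩
    rw [hab1] at hef
    rw [hef] at hkb
    have hmp := hεm _ (hmem s 1 hz)
    have h2 : ν * (-(ν * ε) * (e * volumeDensity μ Φ (γ (s, 1)))) =
        -(e * (ε * volumeDensity μ Φ (γ (s, 1)))) := by
      linear_combination (-(ε * e * volumeDensity μ Φ (γ (s, 1)))) * hν
    rw [h2]
    exact neg_neg_of_pos (mul_pos (pos_of_mul_pos_left hkb hf.le) hmp)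

end Region

end PartialSections

/-! ### Arcs and rational points of the circle of directions -/

namespace PartialSections

section Directions

/-- Rotation by `t` takes `z` to `-z` with `0 < t < 2π`, which forces `t = π`; so the rotation angle
of `u` lies in `(0, π)`. -/
theorem exists_of_mem_clockwiseArc_neg {z u : ℂ} (hz : z ≠ 0) (h : u ∈ clockwiseArc z (-z)) :
    ∃ φ : ℝ, 0 < Real.sin φ ∧ u = Complex.exp (-(φ : ℂ) * Complex.I) * z := by
  obtain ⟨s, t, hs, hst, ht, hu, hz'⟩ := h
  refine ⟨s, Real.sin_pos_of_pos_of_lt_pi hs ?_, hu⟩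
  have h1 : Complex.exp (-(t : ℂ) * Complex.I) = -1 := by
    refine mul_right_cancel₀ hz ?_
    rw [← hz', neg_one_mul]
  have h2 := congrArg Complex.im h1
  rw [← Complex.ofReal_neg, Complex.exp_ofReal_mul_I_im] at h2
  have h3 : Real.sin t = 0 := by simpa using h2
  obtain ⟨n, hn⟩ := Real.sin_eq_zero_iff.1 h3
  have hpi := Real.pi_pos
  have hn2 : n < 2 := by
    have : (n : ℝ) < 2 := by
      rw [← hn] at ht
      exact lt_of_mul_lt_mul_right ht hpi.le
    exact_mod_cast this
  have hn1 : (n : ℝ) ≤ 1 := by exact_mod_cast Int.lt_add_one_iff.1 hn2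
  calc s < t := hst
    _ = n * Real.pi := hn.symm
    _ ≤ Real.pi := by nlinarith

/-- A rational direction is the one of a primitive class. -/
theorem IsRationalDirection.exists_primitive {z : ℂ} (h : IsRationalDirection z) :
    ∃ (ρ : ℝ) (p q : ℤ), 0 < ρ ∧ IsCoprime p q ∧ z.re = ρ * q ∧ z.im = -(ρ * p) := by
  obtain ⟨hz, t, m, n, ht, hzt⟩ := h
  have hre : z.re = t * m := by simp [hzt]
  have him : z.im = t * n := by simp [hzt]
  have hg : 0 < Int.gcd m n := by
    rw [Nat.pos_iff_ne_zero, ne_eq, Int.gcd_eq_zero_iff]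
    rintro ⟨rfl, rfl⟩
    exact hz (by simp [hzt])
  obtain ⟨m', n', hco, hm, hn⟩ := Int.exists_gcd_one hg
  -- The primitive class turned by a right angle, so that the pairing of `z` with `(p, q)` vanishes.
  refine ⟨t * Int.gcd m n, -n', m', by positivity,
    (Int.isCoprime_iff_gcd_eq_one.2 hco).symm.neg_left, ?_, ?_⟩
  · rw [hre]; nth_rw 1 [hm]; push_cast; ring
  · rw [him]; nth_rw 1 [hn]; push_cast; ring

end Directions

/-! ### From half-twists to partial sections, and the theorem -/

section Main

variable {M : Type*} [TopologicalSpace M] [ChartedSpace (EuclideanSpace ℝ (Fin 3)) M]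
  {o μ : DiffForm (𝓡 3) M 3} {X : ∀ x : M, TangentSpace (𝓡 3) x} {Φ : ℝ × ℝ × ℝ → M} {a b ν : ℝ}

theorem fluxClass_eq_norm_mul_slope {r : ℝ} (h : slope μ X Φ r ≠ 0) :
    0 < ‖fluxClass μ X Φ r‖ ∧
      fluxClass μ X Φ r = (‖fluxClass μ X Φ r‖ : ℂ) * slope μ X Φ r := by
  have h1 : fluxClass μ X Φ r ≠ 0 := fun h0 => h (by rw [slope, h0, zero_div])
  have h2 := norm_pos_iff.2 h1
  refine ⟨h2, ?_⟩
  rw [slope, mul_div_cancel₀]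
  exact_mod_cast h2.ne'

variable [IsManifold (𝓡 3) ∞ M]

/-- A clockwise rotation by `φ` of the covector `ν ρ (q, -p)` pairs with `(p, q)` to `-ν ρ sin φ (p²
+ q²)`, which gives the sign inside. Positivity of `B c - A d` at the ends, where the flux class is
a positive multiple of `(q, -p)` and of `(-q, p)`, gives the opposite signs of `c p + d q`. -/
theorem IsIntegrableRegion.exists_isSectionLift_of_twist (h : IsIntegrableRegion o X Φ)
    (hX : IsNonvanishingField X) (hμ : IsVolumeForm μ) (hp : Preserves X μ)
    (ha : 0 ≤ a) (hab : a < b) (hb : b ≤ 1) (hν : ν * ν = 1)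
    (hba : slope μ X Φ b = -slope μ X Φ a) (hrat : IsRationalDirection (slope μ X Φ a))
    (htw : ∀ r ∈ Ioo a b, ∃ φ : ℝ, 0 < Real.sin φ ∧
      slope μ X Φ r = Complex.exp (-(φ : ℂ) * Complex.I) * (ν * slope μ X Φ a)) :
    ∃ (g : ℝ × ℝ → M) (σ : ℝ), IsSectionLift o X g σ ν := by
  obtain ⟨F, G, c, d, K⟩ := h.exists_coordinateFamily hX hμ hp
  obtain ⟨ρ, p, q, hρ, hpq, hre, him⟩ := hrat.exists_primitive
  obtain ⟨ha1, ha2⟩ := fluxClass_eq_norm_mul_slope hrat.1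
  obtain ⟨hb1, hb2⟩ := fluxClass_eq_norm_mul_slope (μ := μ) (X := X) (Φ := Φ) (r := b)
    (by rw [hba]; exact neg_ne_zero.2 hrat.1)
  rw [hba] at hb2
  have hA : (fluxClass μ X Φ a).re = ‖fluxClass μ X Φ a‖ * ρ * q := by
    conv_lhs => rw [ha2, Complex.re_ofReal_mul, hre]
    ring
  have hB : (fluxClass μ X Φ a).im = -(‖fluxClass μ X Φ a‖ * ρ * p) := by
    conv_lhs => rw [ha2, Complex.im_ofReal_mul, him]
    ring
  have hA' : (fluxClass μ X Φ b).re = -(‖fluxClass μ X Φ b‖ * ρ * q) := by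
    conv_lhs => rw [hb2, Complex.re_ofReal_mul, Complex.neg_re, hre]
    ring
  have hB' : (fluxClass μ X Φ b).im = ‖fluxClass μ X Φ b‖ * ρ * p := by
    conv_lhs => rw [hb2, Complex.im_ofReal_mul, Complex.neg_im, him]
    ring
  have hν0 : ν ≠ 0 := left_ne_zero_of_mul (by rw [hν]; exact one_ne_zero)
  have hpq0 : 0 < (p : ℝ) ^ 2 + (q : ℝ) ^ 2 := by
    rcases eq_or_ne p 0 with rfl | h0
    · have hq : q ≠ 0 := by
        rintro rfl
        exact not_isCoprime_zero_zero hpq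
      have : (q : ℝ) ≠ 0 := by exact_mod_cast hq
      positivity
    · have : (p : ℝ) ≠ 0 := by exact_mod_cast h0
      positivity
  refine h.exists_isSectionLift hμ K ha hab hb hpq hν (fun r hr => ?_) ?_ ?_ ?_ ?_
  · obtain ⟨φ, hφ, hsl⟩ := htw r hr
    obtain ⟨h1, h2⟩ := fluxClass_eq_norm_mul_slope (μ := μ) (X := X) (Φ := Φ) (r := r) (by
      rw [hsl]
      exact mul_ne_zero (Complex.exp_ne_zero _) (mul_ne_zero (by exact_mod_cast hν0) hrat.1))
    rw [hsl, ← Complex.ofReal_neg] at h2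
    set N := ‖fluxClass μ X Φ r‖
    have e1 : (fluxClass μ X Φ r).re = N * (ν * ρ * (Real.cos φ * q - Real.sin φ * p)) := by
      rw [h2, Complex.re_ofReal_mul, Complex.mul_re, Complex.exp_ofReal_mul_I_re,
        Complex.exp_ofReal_mul_I_im, Complex.re_ofReal_mul, Complex.im_ofReal_mul, hre, him,
        Real.cos_neg, Real.sin_neg]
      ring
    have e2 : (fluxClass μ X Φ r).im = N * (ν * ρ * (-(Real.cos φ * p) - Real.sin φ * q)) := by
      rw [h2, Complex.im_ofReal_mul, Complex.mul_im, Complex.exp_ofReal_mul_I_re,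
        Complex.exp_ofReal_mul_I_im, Complex.re_ofReal_mul, Complex.im_ofReal_mul, hre, him,
        Real.cos_neg, Real.sin_neg]
      ring
    rw [e1, e2]
    have e3 : ν * (N * (ν * ρ * (Real.cos φ * q - Real.sin φ * p)) * p +
        N * (ν * ρ * (-(Real.cos φ * p) - Real.sin φ * q)) * q) =
        -(N * ρ * Real.sin φ * ((p : ℝ) ^ 2 + (q : ℝ) ^ 2)) := by
      linear_combination (-(N * ρ * Real.sin φ * ((p : ℝ) ^ 2 + (q : ℝ) ^ 2))) * hν
    rw [e3]
    exact neg_neg_of_pos (by positivity)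
  · rw [hA, hB]; ring
  · rw [hA', hB']; ring
  · have hD := K.det_pos (r := a) ⟨ha, hab.le.trans hb⟩
    rw [hA, hB] at hD
    by_contra! h0
    nlinarith [mul_nonneg (mul_pos ha1 hρ).le h0]
  · have hD := K.det_pos (r := b) ⟨ha.trans hab.le, hb⟩
    rw [hA', hB'] at hD
    by_contra! h0
    nlinarith [mul_nonneg (mul_pos hb1 hρ).le (neg_nonneg.2 h0)]

variable [T2Space M]

theorem admitsPositivePartialSection_of_halfTwist (hX : IsNonvanishingField X)
    (hμ : IsVolumeForm μ) (hp : Preserves X μ) (h : AdmitsPositiveRationalHalfTwist o μ X) :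
    AdmitsPositivePartialSection o X := by
  obtain ⟨Φ, hΦ, a, b, ha, hab, hb, hba, htw, hrat, -⟩ := h
  obtain ⟨g, σ, hg⟩ := hΦ.exists_isSectionLift_of_twist hX hμ hp ha hab hb (ν := 1) (by norm_num)
    hba hrat fun r hr => by
      have h1 := htw r hr
      rw [hba] at h1
      simpa using exists_of_mem_clockwiseArc_neg hrat.1 h1
  exact hg.admitsPositivePartialSection

theorem admitsNegativePartialSection_of_halfTwist (hX : IsNonvanishingField X)
    (hμ : IsVolumeForm μ) (hp : Preserves X μ) (h : AdmitsNegativeRationalHalfTwist o μ X) :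
    AdmitsNegativePartialSection o X := by
  obtain ⟨Φ, hΦ, a, b, ha, hab, hb, hba, htw, hrat, -⟩ := h
  obtain ⟨g, σ, hg⟩ := hΦ.exists_isSectionLift_of_twist hX hμ hp ha hab hb (ν := -1) (by norm_num)
    hba hrat fun r hr => by
      have h1 := htw r hr
      -- For the negative twist the arc starts at `-slope μ X Φ a`, so the roles of the endpoints
      -- are exchanged; this is the factor `ν = -1`.
      rw [hba, ← neg_neg (slope μ X Φ a), neg_neg (-slope μ X Φ a)] at h1
      simpa using exists_of_mem_clockwiseArc_neg (neg_ne_zero.2 hrat.1) h1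
  exact hg.admitsNegativePartialSection

end Main

end PartialSections

theorem mainTheorem10 {M : Type*} [TopologicalSpace M]
    [ChartedSpace (EuclideanSpace ℝ (Fin 3)) M] [IsManifold (𝓡 3) ∞ M]
    [T2Space M] [SecondCountableTopology M] [ConnectedSpace M]
    (o : PartialSections.DiffForm (𝓡 3) M 3) (ho : PartialSections.IsVolumeForm o)
    (X : ∀ x : M, TangentSpace (𝓡 3) x) (hX : PartialSections.IsNonvanishingField X) :
    (PartialSections.AdmitsPositivePartialSection o X →
      PartialSections.AdmitsNegativePartialSection o X → ¬ PartialSections.IsReebLike X) ∧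
    (∀ μ : PartialSections.DiffForm (𝓡 3) M 3, PartialSections.IsVolumeForm μ → PartialSections.Preserves X μ →
      (PartialSections.AdmitsPositiveRationalHalfTwist o μ X →
        PartialSections.AdmitsPositivePartialSection o X) ∧
      (PartialSections.AdmitsNegativeRationalHalfTwist o μ X →
        PartialSections.AdmitsNegativePartialSection o X) ∧
      (PartialSections.AdmitsPositiveRationalHalfTwist o μ X →
        PartialSections.AdmitsNegativeRationalHalfTwist o μ X →
          ¬ PartialSections.IsReebLike X)) := by
  refine ⟨PartialSections.not_isReebLike_of_partialSections ho hX, fun μ hμ hp =>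
    ⟨PartialSections.admitsPositivePartialSection_of_halfTwist hX hμ hp,
      PartialSections.admitsNegativePartialSection_of_halfTwist hX hμ hp, fun hpos hneg =>
      PartialSections.not_isReebLike_of_partialSections ho hX
        (PartialSections.admitsPositivePartialSection_of_halfTwist hX hμ hp hpos)
        (PartialSections.admitsNegativePartialSection_of_halfTwist hX hμ hp hneg)⟩⟩
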